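/- \textbf{Definitions.} Let $B_r(x)$ denote the open ball in $\mathbb{R}^4$ and $\mathring B^4$ the open unit ball. Let $\Sigma\subset\mathbb{S}^3\subset\mathbb{R}^4$ be a closed (compact, without boundary), connected, smooth embedded surface. Its Willmore energy is $\mathcal{W}(\Sigma)=\int_\Sigma\bigl(1+\tfrac14|H|^2\bigr)\,d\mathcal{H}^2$, where $H$ is the mean curvature (sum of the principal curvatures) of $\Sigma$ in $\mathbb{S}^3$. For $\gamma,r_0>0$, $\Sigma$ is \emph{$(\gamma,r_0)$-regular} if for every $x\in\Sigma$ and every $0<r<r_0$ there are an affine $2$-plane $T\subset\mathbb{R}^4$ through $x$ and a conformal map $\varphi:D_r:=T\cap B_r(x)\to\Sigma$ with $\varphi(x)=x$, $\Sigma\cap B_r(x)\subset\varphi(D_r)\subset\Sigma\cap B_{(1+\gamma)r}(x)$, $|\varphi(\tau)-\tau|\le\gamma r$ for all $\tau\in D_r$, and $(1-\gamma)|\tau_1-\tau_2|\le|\varphi(\tau_1)-\varphi(\tau_2)|\le(1+\gamma)|\tau_1-\tau_2|$ for all $\tau_1,\tau_2\in D_r$. Let $A$ be either one of the two connected components of $\mathbb{S}^3\setminus\Sigma$.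 For $v\in\mathring B^4$ put $F_v(x)=(1-|v|^2)\frac{x-v}{|x-v|^2}-v$, $\Sigma_v=F_v(\Sigma)$, $A_v=F_v(A)$, and let $d_v:\mathbb{S}^3\to\mathbb{R}$ be the signed geodesic distance to $\Sigma_v$ in $\mathbb{S}^3$, negative on $A_v$ and nonnegative elsewhere. For $t\in[-\pi,\pi]$ let $\Sigma_{(v,t)}=\partial\{x\in\mathbb{S}^3: d_v(x)<t\}$ (boundary in $\mathbb{S}^3$). \textbf{Theorem (uniform area estimate near the boundary).} There is a constant $\gamma_1>0$ such that for every $r_0>0$ there is a constant $\eta_1>0$ with the following property. Let $\Sigma\subset\mathbb{S}^3$ be a closed, connected, smooth embedded surface of genus at least $1$ which is $(\gamma,r_0)$-regular for some $0<\gamma\le\gamma_1$ and satisfies $\mathcal{W}(\Sigma)\le 8\pi$, and let $A$ be either component of $\mathbb{S}^3\setminus\Sigma$. Then for all $(v,t)\in\mathring B^4\times[-\pi,\pi]$ with $|v|\ge 1-\eta_1$, \[ \mathcal{H}^2(\Sigma_{(v,t)})\le 5\pi . \] -/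

import Mathlib

open Set Metric MeasureTheory
open scoped ENNReal ContDiff

noncomputable section

namespace CanonicalFamily

/-- Euclidean `n`-space. -/
abbrev E (n : ℕ) : Type := EuclideanSpace ℝ (Fin n)

/-- The unit sphere `𝕊³ ⊂ ℝ⁴`. -/
abbrev S3 : Set (E 4) := sphere (0 : E 4) 1

/-! ### Closed embedded surfaces -/

/-- `φ : V → S` is a local parametrization of `S ⊆ ℝⁿ`: a smooth immersion of the open set
`V ⊆ ℝ²` which is a homeomorphism onto a relatively open subset of `S`. -/
structure IsLocalParam {n : ℕ} (S : Set (E n)) (φ : E 2 → E n) (V : Set (E 2)) : Prop where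
  isOpen : IsOpen V
  smooth : ContDiffOn ℝ ∞ φ V
  immersion : ∀ u ∈ V, Function.Injective (fderiv ℝ φ u)
  injOn : InjOn φ V
  isOpen_image : ∀ W ⊆ V, IsOpen W → ∃ U : Set (E n), IsOpen U ∧ φ '' W = S ∩ U

/-- `S` is a closed (compact, without boundary), connected, smooth embedded surface in `𝕊³`. -/
structure IsClosedSurface (S : Set (E 4)) : Prop where
  subset_sphere : S ⊆ S3
  isCompact : IsCompact S
  isConnected : IsConnected S
  exists_param : ∀ p ∈ S, ∃ (φ : E 2 → E 4) (V : Set (E 2)), IsLocalParam S φ V ∧ p ∈ φ '' V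

/-- The genus of a (connected, orientable) surface `X`: the largest number of pairwise disjoint
simple closed curves in `X` whose union does not separate `X`. -/
def genus (X : Type*) [TopologicalSpace X] : ℕ∞ :=
  ⨆ (k : ℕ) (_ : ∃ c : Fin k → Circle → X,
    (∀ i, Continuous (c i) ∧ Function.Injective (c i)) ∧
    (∀ i j, i ≠ j → Disjoint (range (c i)) (range (c j))) ∧
    IsConnected (⋃ i, range (c i))ᶜ), (k : ℕ∞)

/-! ### Mean curvature and Willmore energy -/

/-- Coordinate derivative `∂ᵢ φ`. -/
def pd {n : ℕ} (i : Fin 2) (φ : E 2 → E n) (u : E 2) : E n :=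
  fderiv ℝ φ u (EuclideanSpace.single i 1)

/-- The first fundamental form `gᵢⱼ = ⟨∂ᵢφ, ∂ⱼφ⟩`. -/
def firstForm {n : ℕ} (φ : E 2 → E n) (u : E 2) : Matrix (Fin 2) (Fin 2) ℝ :=
  Matrix.of fun i j => inner ℝ (pd i φ u) (pd j φ u)

/-- The mean curvature vector in `𝕊³` of the parametrized surface `φ` at `φ u`: the component of
`∑ gⁱʲ ∂ᵢ∂ⱼφ` orthogonal to `φ u` (the normal of `𝕊³`) and to the tangent vectors `∂₁φ`, `∂₂φ`.
It equals `(κ₁ + κ₂) N` for a unit normal `N` in `𝕊³` and principal curvatures `κ₁, κ₂`. -/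
def paramMeanCurvature (φ : E 2 → E 4) (u : E 2) : E 4 :=
  (Submodule.span ℝ {φ u, pd 0 φ u, pd 1 φ u})ᗮ.starProjection
    (∑ i, ∑ j, (firstForm φ u)⁻¹ i j • pd i (pd j φ) u)

open Classical in
/-- The mean curvature vector of `S` in `𝕊³` at `p ∈ S`, computed in a local parametrization
(it does not depend on which one; the value off `S` is irrelevant). -/
def meanCurvature (S : Set (E 4)) (p : E 4) : E 4 :=
  if h : ∃ q : (E 2 → E 4) × Set (E 2) × E 2,
      IsLocalParam S q.1 q.2.1 ∧ q.2.2 ∈ q.2.1 ∧ q.1 q.2.2 = p then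
    paramMeanCurvature h.choose.1 h.choose.2.2
  else 0

/-- Area: two-dimensional Hausdorff measure, normalized to be Lebesgue measure on planes. -/
def area (S : Set (E 4)) : ℝ≥0∞ := μHE[2] S

/-- Willmore energy `∫_S (1 + |H|² / 4) dℋ²`. -/
def willmore (S : Set (E 4)) : ℝ≥0∞ :=
  ∫⁻ p in S, ENNReal.ofReal (1 + ‖meanCurvature S p‖ ^ 2 / 4) ∂μHE[2]

/-! ### `(γ, r₀)`-regular surfaces -/

/-- `φ` is a `(γ, r)`-regular conformal parametrization of `S` around `x`, over the disk
`D_r(x) = T ∩ B_r(x)` of the affine plane `T = range σ` through `x`; the disk is identified with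
the standard disk of radius `r` in `ℝ²` through the isometry `σ`. -/
structure IsRegularParam {n : ℕ} (S : Set (E n)) (γ r : ℝ) (x : E n)
    (σ : E 2 →ᵃⁱ[ℝ] E n) (φ : E 2 → E n) : Prop where
  center_plane : σ 0 = x
  center : φ 0 = x
  conformal : ∀ τ ∈ ball (0 : E 2) r, ConformalAt φ τ
  subset_image : S ∩ ball x r ⊆ φ '' ball 0 r
  image_subset : φ '' ball 0 r ⊆ S ∩ ball x ((1 + γ) * r)
  close : ∀ τ ∈ ball (0 : E 2) r, ‖φ τ - σ τ‖ ≤ γ * r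
  lower : ∀ τ₁ ∈ ball (0 : E 2) r, ∀ τ₂ ∈ ball (0 : E 2) r,
    (1 - γ) * ‖τ₁ - τ₂‖ ≤ ‖φ τ₁ - φ τ₂‖
  upper : ∀ τ₁ ∈ ball (0 : E 2) r, ∀ τ₂ ∈ ball (0 : E 2) r,
    ‖φ τ₁ - φ τ₂‖ ≤ (1 + γ) * ‖τ₁ - τ₂‖

/-- `S` is `(γ, r₀)`-regular: every point has regular conformal parametrizations at all scales
below `r₀`. -/
def IsRegular {n : ℕ} (γ r₀ : ℝ) (S : Set (E n)) : Prop :=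
  ∀ x ∈ S, ∀ r, 0 < r → r < r₀ →
    ∃ (σ : E 2 →ᵃⁱ[ℝ] E n) (φ : E 2 → E n), IsRegularParam S γ r x σ φ

/-! ### The canonical family -/

/-- The conformal transformation `F_v` of `𝕊³`, for `|v| < 1`. -/
def conf (v x : E 4) : E 4 := ((1 - ‖v‖ ^ 2) / ‖x - v‖ ^ 2) • (x - v) - v

/-- `A` is a connected component of `𝕊³ ∖ S`. -/
def IsSide (S A : Set (E 4)) : Prop := ∃ x ∈ S3 \ S, A = connectedComponentIn (S3 \ S) x

/-- Geodesic distance in `𝕊³` from the point `x` to the (nonempty) set `S`. -/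
def sphereDist (S : Set (E 4)) (x : E 4) : ℝ := ⨅ y : S, InnerProductGeometry.angle x y

open Classical in
/-- Signed distance to `S` on `𝕊³`, negative on the side `A` of `S`. -/
def signedDist (S A : Set (E 4)) (x : E 4) : ℝ :=
  if x ∈ A then -sphereDist S x else sphereDist S x

/-- `Σ_(v,t) = ∂ {x ∈ 𝕊³ | d_v(x) < t}`, the boundary being taken in `𝕊³`, where `d_v` is the
signed distance to `Σ_v = F_v(Σ)` that is negative on `A_v = F_v(A)`. -/
def canonical (S A : Set (E 4)) (v : E 4) (t : ℝ) : Set (E 4) :=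
  (Subtype.val : S3 → E 4) ''
    frontier {x : S3 | signedDist (conf v '' S) (conf v '' A) x < t}

end CanonicalFamily

end

namespace CanonicalFamily

/-! ### Area of Lipschitz images -/

section Area

variable {X Y : Type*} [MetricSpace X] [MeasurableSpace X] [BorelSpace X]
  [MetricSpace Y] [MeasurableSpace Y] [BorelSpace Y]

/-! As `|v| → 1`, the map `F_v` magnifies `Σ` near the point of `Σ` closest to `v` and crushes the
rest towards `-v`. A surface that is almost flat at all small scales therefore has an image close to
a round sphere, possibly degenerate. A parallel surface of a round sphere in `𝕊³` is again round,
hence of area at most `4π`, and the gap between `4π` and `5π` absorbs the errors.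

`Σ_(v,t)` lies in the set of points at distance exactly `|t|` from `Σ_v` and, for `t ≠ 0`, on one
side of it (`canonical_subset_level`, `canonical_side`). If `y` is a nearest point of `Σ_v` to `x`,
every other point `x'` of that set satisfies `⟨x' - x, y⟩ ≤ 0` (`inner_sub_foot_nonpos`). Using this
at both ends of a chord makes chords almost orthogonal to a common normal, and projection along the
normals bounds the area (`area_le_of_flat`). Applied to arbitrary sets, this gives the crude bound
`C ρ²` for the area in a ball of radius `ρ` (`exists_area_level_le`).

The cases are split by `t`, with absolute thresholds.

At `t = 0` the area of `Σ_v` itself is needed (`exists_area_conf_le`). Seen from `v`, `Σ` is nearly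
orthogonal to the segment to its nearest point, so the area integrand is nearly bounded by that of a
plane, whose total is at most `4π`.

For small `t ≠ 0`, Hausdorff closeness to a sphere is too weak. At scales of a few hundred `t`, away
from `-v`, the surface `Σ_v` is flat and has the given side on exactly one side, so the level set
there is almost a graph over `Σ_v`. Double counting pairs of nearby points compares its area with
that of `Σ_v` (`area_good_level_le`), and the crude bound handles the neighbourhood of `-v`.

For `|sin t|` bounded below, `Σ_v` is Hausdorff close to a round sphere or a point, and
one-sidedness turns the foot-point inequality into a small Lipschitz constant for the height of the
level set. It then projects almost isometrically onto an equator, up to polar caps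
(`exists_area_level_near_round_le`). For `t` near `±π` the level set lies in a small ball around an
antipode.

Flatness yields two sides only if the given component of `𝕊³ ∖ Σ` lies locally on exactly one side
of `Σ`. This is proved by gluing local sign functions over a stereographic chart
(`isLocalSide_of_isSide`) and then carried from infinitesimal scales to scale `r₀` by doubling
(`exists_flatAt_splits`).

The order of constants matters: the threshold for small `t` is absolute, the regularity constant
depends on it, and only the closeness of `|v|` to `1` depends on `r₀`. -/

theorem area_image_le {f : X → Y} {U : Set X} {K : ℝ} (hK : 0 ≤ K)
    (h : ∀ x ∈ U, ∀ y ∈ U, dist (f x) (f y) ≤ K * dist x y) :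
    μHE[2] (f '' U) ≤ ENNReal.ofReal (K ^ 2) * μHE[2] U := by
  have hL : LipschitzOnWith K.toNNReal f U := by
    refine LipschitzOnWith.of_dist_le_mul fun x hx y hy => ?_
    rw [Real.coe_toNNReal K hK]
    exact h x hx y hy
  have h1 := hL.hausdorffMeasure_image_le (d := ((2 : ℕ) : ℝ)) (by norm_num)
  simp only [Measure.euclideanHausdorffMeasure_def, Measure.smul_apply, ENNReal.smul_def,
    smul_eq_mul]
  rw [mul_left_comm]
  gcongr
  refine h1.trans (le_of_eq ?_)
  rw [ENNReal.rpow_natCast, ENNReal.ofReal_pow hK]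
  rfl

theorem area_le_of_expanding {g : X → Y} {U : Set X} {K : ℝ} (hK : 0 ≤ K)
    (h : ∀ x ∈ U, ∀ y ∈ U, dist x y ≤ K * dist (g x) (g y)) :
    μHE[2] U ≤ ENNReal.ofReal (K ^ 2) * μHE[2] (g '' U) := by
  rcases U.eq_empty_or_nonempty with rfl | ⟨x0, -⟩
  · simp
  have : Nonempty X := ⟨x0⟩
  have hinj : InjOn g U := by
    intro x hx y hy hxy
    have := h x hx y hy
    rw [hxy, dist_self, mul_zero] at this
    exact dist_le_zero.1 this
  have himg : Function.invFunOn g U '' (g '' U) = U := by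
    rw [hinj.invFunOn_image (Subset.refl U)]
  have := area_image_le (f := Function.invFunOn g U) (U := g '' U) hK ?_
  · rwa [himg] at this
  · rintro _ ⟨x, hx, rfl⟩ _ ⟨y, hy, rfl⟩
    rw [hinj.leftInvOn_invFunOn hx, hinj.leftInvOn_invFunOn hy]
    exact h x hx y hy

theorem area_plane : (μHE[2] : Measure (E 2)) = volume :=
  EuclideanSpace.euclideanHausdorffMeasure_eq_volume 2

theorem area_ball_plane {x : E 2} {r : ℝ} (hr : 0 ≤ r) :
    μHE[2] (ball x r) = ENNReal.ofReal (Real.pi * r ^ 2) := by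
  rw [area_plane, EuclideanSpace.volume_ball_fin_two, ← ENNReal.ofReal_pow hr,
    ← ENNReal.ofReal_mul (by positivity), mul_comm]

theorem area_closedBall_plane {x : E 2} {r : ℝ} (hr : 0 ≤ r) :
    μHE[2] (closedBall x r) = ENNReal.ofReal (Real.pi * r ^ 2) := by
  rw [area_plane, EuclideanSpace.volume_closedBall_fin_two, ← ENNReal.ofReal_pow hr,
    ← ENNReal.ofReal_mul (by positivity), mul_comm]

theorem area_singleton (x : X) : μHE[2] ({x} : Set X) = 0 := by
  simp only [Measure.euclideanHausdorffMeasure_def, Measure.smul_apply]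
  have := Measure.nullSingletonClass_hausdorff X (d := ((2 : ℕ) : ℝ)) (by norm_num)
  simp

/-- Area of the image of a map with `|f u - f u'| ≤ g(u) g(u') |u - u'|`. -/
theorem area_image_le_lintegral {f : E 2 → Y} {U : Set (E 2)} (hU : MeasurableSet U)
    {g : E 2 → ℝ} (hg : Measurable g) (hpos : ∀ u ∈ U, 0 < g u)
    (h : ∀ u ∈ U, ∀ w ∈ U, dist (f u) (f w) ≤ g u * g w * dist u w) :
    μHE[2] (f '' U) ≤ ∫⁻ u in U, ENNReal.ofReal (g u ^ 4) := by
  have key : ∀ q : ℝ, 1 < q →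
      μHE[2] (f '' U) ≤ ENNReal.ofReal (q ^ 4) * ∫⁻ u in U, ENNReal.ofReal (g u ^ 4) := by
    intro q hq
    have hq0 : 0 < q := by linarith
    -- On the layer where `g` lies in `[q^k, q^(k+1))` the map is Lipschitz with constant
    -- `q^(2(k+1))`, so area grows by at most `q^4 g^4`. Letting `q → 1` removes the loss.
    set V : ℤ → Set (E 2) := fun k => U ∩ g ⁻¹' Ico (q ^ k) (q ^ (k + 1)) with hV
    have hVm : ∀ k, MeasurableSet (V k) := fun k => hU.inter (hg measurableSet_Ico)
    have hVU : ⋃ k, V k = U := by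
      ext u
      simp only [hV, mem_iUnion, mem_inter_iff, mem_preimage, exists_and_left,
        and_iff_left_iff_imp]
      intro hu
      exact exists_mem_Ico_zpow (hpos u hu) hq
    have hVd : Pairwise (Function.onFun Disjoint V) := by
      intro i j hij
      refine Set.disjoint_left.2 fun u hi hj => hij ?_
      have h1 := hi.2
      have h2 := hj.2
      have a1 : q ^ i < q ^ (j + 1) := h1.1.trans_lt h2.2
      have a2 : q ^ j < q ^ (i + 1) := h2.1.trans_lt h1.2
      rw [zpow_lt_zpow_iff_right₀ hq] at a1 a2
      omega
    have hone : ∀ k, μHE[2] (f '' V k) ≤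
        ENNReal.ofReal (q ^ 4) * ∫⁻ u in V k, ENNReal.ofReal (g u ^ 4) := by
      intro k
      have hk : 0 < q ^ k := zpow_pos hq0 k
      have h1 : μHE[2] (f '' V k) ≤
          ENNReal.ofReal (((q ^ (k + 1)) * (q ^ (k + 1))) ^ 2) * μHE[2] (V k) := by
        refine area_image_le (by positivity) fun x hx y hy => ?_
        refine (h x hx.1 y hy.1).trans ?_
        have := hpos x hx.1
        have := hpos y hy.1
        have hx2 : g x ≤ q ^ (k + 1) := hx.2.2.le
        have hy2 : g y ≤ q ^ (k + 1) := hy.2.2.le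
        gcongr
      refine h1.trans ?_
      have e : ((q ^ (k + 1)) * (q ^ (k + 1))) ^ 2 = q ^ 4 * (q ^ k) ^ 4 := by
        rw [zpow_add_one₀ hq0.ne']; ring
      rw [e, ENNReal.ofReal_mul (by positivity), mul_assoc, area_plane, ← setLIntegral_const]
      gcongr 1
      refine setLIntegral_mono' (hVm k) fun u hu => ?_
      have := hu.2.1
      gcongr
    calc μHE[2] (f '' U) = μHE[2] (⋃ k, f '' V k) := by rw [← image_iUnion, hVU]
      _ ≤ ∑' k, μHE[2] (f '' V k) := measure_iUnion_le _
      _ ≤ ∑' k, ENNReal.ofReal (q ^ 4) * ∫⁻ u in V k, ENNReal.ofReal (g u ^ 4) :=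
        ENNReal.tsum_le_tsum hone
      _ = ENNReal.ofReal (q ^ 4) * ∫⁻ u in U, ENNReal.ofReal (g u ^ 4) := by
        rw [ENNReal.tsum_mul_left, ← lintegral_iUnion hVm hVd, hVU]
  set I := ∫⁻ u in U, ENNReal.ofReal (g u ^ 4)
  have ht : Filter.Tendsto (fun n : ℕ => ENNReal.ofReal ((1 + 1 / ((n : ℝ) + 1)) ^ 4) * I)
      Filter.atTop (nhds (ENNReal.ofReal 1 * I)) := by
    refine ENNReal.Tendsto.mul_const (ENNReal.tendsto_ofReal ?_) (Or.inl (by simp))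
    have := (tendsto_const_nhds (x := (1 : ℝ))).add
      (tendsto_one_div_add_atTop_nhds_zero_nat (𝕜 := ℝ))
    simpa using this.pow 4
  rw [ENNReal.ofReal_one, one_mul] at ht
  refine ge_of_tendsto' ht fun n => key _ ?_
  have : (0 : ℝ) < 1 / ((n : ℝ) + 1) := by positivity
  linarith

end Area

/-- `∫_{ℝ²} (h² + |u|²)⁻² du = π / h²`. -/
theorem lintegral_plane_kernel {h : ℝ} (hh : 0 < h) :
    ∫⁻ u : E 2, ENNReal.ofReal (1 / (h ^ 2 + ‖u‖ ^ 2) ^ 2) = ENNReal.ofReal (Real.pi / h ^ 2) := by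
  have hderiv : ∀ x ∈ Ioi (0 : ℝ), HasDerivAt (fun y : ℝ => - (1 / (2 * (h ^ 2 + y ^ 2))))
      (x * (1 / (h ^ 2 + x ^ 2) ^ 2)) x := by
    intro x hx
    have hne : (2 * (h ^ 2 + x ^ 2)) ≠ 0 := by positivity
    have h1 : HasDerivAt (fun y : ℝ => 2 * (h ^ 2 + y ^ 2)) (2 * (2 * x)) x := by
      have := ((hasDerivAt_pow 2 x).const_add (h ^ 2)).const_mul 2
      simpa using this
    have h2 := (h1.inv hne).neg
    have e1 : x * (1 / (h ^ 2 + x ^ 2) ^ 2) = -(-(2 * (2 * x)) / (2 * (h ^ 2 + x ^ 2)) ^ 2) := by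
      field_simp
    rw [e1]
    refine h2.congr_of_eventuallyEq (Filter.Eventually.of_forall fun y => ?_)
    simp
  have hcont : ContinuousWithinAt (fun y : ℝ => - (1 / (2 * (h ^ 2 + y ^ 2)))) (Ici 0) 0 := by
    apply ContinuousAt.continuousWithinAt
    have : (2 * (h ^ 2 + (0:ℝ) ^ 2)) ≠ 0 := by positivity
    fun_prop (disch := assumption)
  have hlim : Filter.Tendsto (fun y : ℝ => - (1 / (2 * (h ^ 2 + y ^ 2)))) Filter.atTop
      (nhds (-0)) := by
    refine Filter.Tendsto.neg ?_
    refine Filter.Tendsto.div_atTop tendsto_const_nhds ?_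
    refine Filter.Tendsto.const_mul_atTop (by norm_num) ?_
    exact Filter.tendsto_atTop_add_const_left _ _ (Filter.tendsto_pow_atTop (by norm_num))
  have hpos : ∀ x ∈ Ioi (0 : ℝ), 0 ≤ x * (1 / (h ^ 2 + x ^ 2) ^ 2) := by
    intro x hx
    have : 0 < x := hx
    positivity
  have hint := integrableOn_Ioi_deriv_of_nonneg hcont hderiv hpos hlim
  have hval := integral_Ioi_of_hasDerivAt_of_tendsto hcont hderiv hint hlim
  have hf := integral_fun_norm_addHaar (volume : Measure (E 2))
    (fun y : ℝ => 1 / (h ^ 2 + y ^ 2) ^ 2)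
  have hfi := (integrable_fun_norm_addHaar (volume : Measure (E 2))
    (f := fun y : ℝ => 1 / (h ^ 2 + y ^ 2) ^ 2)).2 (by simpa using hint)
  rw [← ofReal_integral_eq_lintegral_ofReal hfi
    (Filter.Eventually.of_forall fun u => by positivity), hf]
  have hb : (volume : Measure (E 2)).real (ball 0 1) = Real.pi := by
    rw [Measure.real, EuclideanSpace.volume_ball_fin_two]
    simp [Real.pi_pos.le]
  simp only [finrank_euclideanSpace, Fintype.card_fin, hb, Nat.add_one_sub_one, pow_one,
    smul_eq_mul]
  rw [hval]
  congr 1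
  simp
  field_simp

/-! ### Inversions and elementary geometry of four-space. -/

theorem norm_inversion_sub {F : Type*} [NormedAddCommGroup F] [InnerProductSpace ℝ F] {a b : F}
    (ha : a ≠ 0) (hb : b ≠ 0) :
    ‖(1 / ‖a‖ ^ 2) • a - (1 / ‖b‖ ^ 2) • b‖ = ‖a - b‖ / (‖a‖ * ‖b‖) := by
  have ha' : ‖a‖ ≠ 0 := norm_ne_zero_iff.2 ha
  have hb' : ‖b‖ ≠ 0 := norm_ne_zero_iff.2 hb
  rw [← sq_eq_sq₀ (norm_nonneg _) (by positivity), div_pow, norm_sub_sq_real, norm_sub_sq_real,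
    norm_smul, norm_smul, inner_smul_left, inner_smul_right]
  simp only [Real.norm_eq_abs, mul_pow, sq_abs, conj_trivial]
  field_simp
  ring

/-- An isometric parametrization of the orthogonal complement of two independent vectors. -/
theorem exists_isometry_orthogonal {e₁ e₂ : E 4} (h : LinearIndependent ℝ ![e₁, e₂]) :
    ∃ ι : E 2 →ₗᵢ[ℝ] E 4, LinearMap.range ι.toLinearMap = (Submodule.span ℝ {e₁, e₂})ᗮ := by
  set W := (Submodule.span ℝ {e₁, e₂})ᗮ with hW
  have hr : Module.finrank ℝ (Submodule.span ℝ {e₁, e₂}) = 2 := by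
    have := finrank_span_eq_card h
    rw [Matrix.range_cons, Matrix.range_cons, Matrix.range_empty, union_empty,
      singleton_union] at this
    simpa using this
  have hW2 : Module.finrank ℝ W = 2 := by
    have := Submodule.finrank_add_finrank_orthogonal (Submodule.span ℝ {e₁, e₂})
    rw [hr, finrank_euclideanSpace, Fintype.card_fin] at this
    exact Nat.add_left_cancel (this : 2 + Module.finrank ℝ W = 2 + 2)
  let b := (stdOrthonormalBasis ℝ W).reindex (finCongr hW2)
  refine ⟨W.subtypeₗᵢ.comp b.repr.symm.toLinearIsometry, ?_⟩
  ext x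
  simp only [LinearMap.mem_range]
  constructor
  · rintro ⟨u, rfl⟩
    exact (b.repr.symm u).2
  · intro hx
    exact ⟨b.repr ⟨x, hx⟩, by simp⟩

theorem exists_unit_orthogonal (a b c : E 4) :
    ∃ m : E 4, ‖m‖ = 1 ∧ inner ℝ m a = 0 ∧ inner ℝ m b = 0 ∧ inner ℝ m c = 0 := by
  have hr : Module.finrank ℝ (Submodule.span ℝ ({a, b, c} : Set (E 4))) ≤ 3 := by
    have := finrank_span_le_card (R := ℝ) ({a, b, c} : Set (E 4))
    refine this.trans ?_
    simpa using Finset.card_le_three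
  have h1 := Submodule.finrank_add_finrank_orthogonal (Submodule.span ℝ ({a, b, c} : Set (E 4)))
  rw [finrank_euclideanSpace, Fintype.card_fin] at h1
  have h2 : 0 < Module.finrank ℝ
      ((Submodule.span ℝ ({a, b, c} : Set (E 4)))ᗮ : Submodule ℝ (E 4)) := by
    omega
  have := Module.finrank_pos_iff.1 h2
  obtain ⟨⟨m, hm⟩, hm0⟩ := exists_ne (0 : (Submodule.span ℝ ({a, b, c} : Set (E 4)))ᗮ)
  have hm0' : m ≠ 0 := fun h => hm0 (by simpa using h)
  have ho := (Submodule.mem_orthogonal' _ _).1 hm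
  have hin : ∀ w ∈ ({a, b, c} : Set (E 4)), inner ℝ ((1 / ‖m‖) • m) w = 0 := by
    intro w hw
    rw [inner_smul_left, ho w (Submodule.subset_span hw), mul_zero]
  refine ⟨(1 / ‖m‖) • m, ?_, hin a (by simp), hin b (by simp), hin c (by simp)⟩
  rw [norm_smul]; simp [hm0']

theorem linearIndependent_pair_of_abs_inner_lt {e₁ e₂ : E 4} (h1 : ‖e₁‖ = 1) (h2 : ‖e₂‖ = 1)
    (h : |inner ℝ e₁ e₂| < 1) : LinearIndependent ℝ ![e₁, e₂] := by
  rw [LinearIndependent.pair_iff]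
  intro s t hst
  have a1 : s + t * inner ℝ e₁ e₂ = 0 := by
    have := congrArg (fun x => inner ℝ e₁ x) hst
    simpa [inner_add_right, inner_smul_right, h1] using this
  have a2 : s * inner ℝ e₁ e₂ + t = 0 := by
    have := congrArg (fun x => inner ℝ e₂ x) hst
    simpa [inner_add_right, inner_smul_right, h2, real_inner_comm] using this
  have h' : (inner ℝ e₁ e₂) ^ 2 < 1 := by rwa [sq_lt_one_iff_abs_lt_one]
  have ht : t = 0 := by
    have : t * (1 - (inner ℝ e₁ e₂) ^ 2) = 0 := by linear_combination a2 - inner ℝ e₁ e₂ * a1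
    rcases mul_eq_zero.1 this with h | h
    · exact h
    · linarith
  subst ht
  simpa using a1

/-- The equatorial two-sphere orthogonal to a unit vector has area at most `4π`. -/
theorem area_equator_le {n : E 4} (hn : ‖n‖ = 1) :
    μHE[2] {w : E 4 | ‖w‖ = 1 ∧ inner ℝ w n = 0} ≤ ENNReal.ofReal (4 * Real.pi) := by
  obtain ⟨e, he, hen, -⟩ := exists_unit_orthogonal n n n
  have hli := linearIndependent_pair_of_abs_inner_lt he hn (by rw [hen]; simp)
  obtain ⟨ι, hι⟩ := exists_isometry_orthogonal hli
  have hιm : ∀ u, inner ℝ (ι u) e = 0 ∧ inner ℝ (ι u) n = 0 := by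
    intro u
    have : ι u ∈ (Submodule.span ℝ {e, n})ᗮ := by rw [← hι]; exact ⟨u, rfl⟩
    have ho := (Submodule.mem_orthogonal' _ _).1 this
    exact ⟨ho e (Submodule.subset_span (by simp)), ho n (Submodule.subset_span (by simp))⟩
  have hnorm : ∀ u, ‖ι u - e‖ ^ 2 = 1 + ‖u‖ ^ 2 := by
    intro u
    rw [norm_sub_sq_real, (hιm u).1, he, ι.norm_map]; ring
  have hne : ∀ u, ι u - e ≠ 0 := by
    intro u hu
    have := hnorm u
    rw [hu] at this
    simp at this
    nlinarith [sq_nonneg ‖u‖]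
  -- Inverse stereographic projection from the pole `e`, written as an inversion so that chords
  -- transform exactly; it reaches every point of the equator but `e`.
  set f : E 2 → E 4 := fun u => e + (2 : ℝ) • ((1 / ‖ι u - e‖ ^ 2) • (ι u - e)) with hf
  have hsub : {w : E 4 | ‖w‖ = 1 ∧ inner ℝ w n = 0} ⊆ {e} ∪ f '' univ := by
    rintro w ⟨h1, h2⟩
    by_cases hw : w = e
    · exact Or.inl hw
    right
    set p := w - e with hp
    have hp0 : p ≠ 0 := sub_ne_zero.2 hw
    have hp' : ‖p‖ ≠ 0 := norm_ne_zero_iff.2 hp0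
    have hpe : inner ℝ p e = - ‖p‖ ^ 2 / 2 := by
      have : ‖p‖ ^ 2 = 2 - 2 * inner ℝ w e := by
        rw [hp, norm_sub_sq_real, h1, he]; ring
      rw [this, hp, inner_sub_left, real_inner_self_eq_norm_sq, he]; ring
    have hmem : (2 / ‖p‖ ^ 2) • p + e ∈ (Submodule.span ℝ {e, n})ᗮ := by
      rw [Submodule.mem_orthogonal']
      intro w hw
      obtain ⟨a, b, rfl⟩ := Submodule.mem_span_pair.1 hw
      have e1 : inner ℝ ((2 / ‖p‖ ^ 2) • p + e) e = 0 := by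
        rw [inner_add_left, inner_smul_left, hpe, real_inner_self_eq_norm_sq, he]
        simp only [conj_trivial]
        field_simp
        ring
      have e2 : inner ℝ ((2 / ‖p‖ ^ 2) • p + e) n = 0 := by
        rw [inner_add_left, inner_smul_left, hp, inner_sub_left, h2, hen]; simp
      rw [inner_add_right, inner_smul_right, inner_smul_right, e1, e2]; simp
    rw [← hι] at hmem
    obtain ⟨u, hu⟩ := hmem
    refine ⟨u, mem_univ _, ?_⟩
    have hu' : ι u - e = (2 / ‖p‖ ^ 2) • p := by
      have : ι u = (2 / ‖p‖ ^ 2) • p + e := hu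
      rw [this]; abel
    simp only [hf, hu', norm_smul, smul_smul]
    have : (2 : ℝ) * (1 / (‖2 / ‖p‖ ^ 2‖ * ‖p‖) ^ 2 * (2 / ‖p‖ ^ 2)) = 1 := by
      rw [Real.norm_eq_abs, mul_pow, sq_abs]
      field_simp
    rw [mul_assoc, this, one_smul, hp]; abel
  set g : E 2 → ℝ := fun u => √(2 / (1 + ‖u‖ ^ 2)) * 1 with hg
  have hgs : ∀ u, g u = √2 / ‖ι u - e‖ := by
    intro u
    rw [hg]
    simp only [mul_one]
    rw [Real.sqrt_div (by norm_num), ← hnorm u, Real.sqrt_sq (norm_nonneg _)]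
  have harea : μHE[2] (f '' univ) ≤ ∫⁻ u in univ, ENNReal.ofReal (g u ^ 4) := by
    refine area_image_le_lintegral MeasurableSet.univ (by fun_prop) ?_ ?_
    · intro u _
      simp only [hg]
      positivity
    · intro u _ w _
      rw [dist_eq_norm, dist_eq_norm]
      have : f u - f w = (2 : ℝ) • ((1 / ‖ι u - e‖ ^ 2) • (ι u - e)
          - (1 / ‖ι w - e‖ ^ 2) • (ι w - e)) := by
        simp only [hf, smul_sub]; abel
      rw [this, norm_smul, norm_inversion_sub (hne u) (hne w), sub_sub_sub_cancel_right,
        ← map_sub, ι.norm_map, hgs, hgs]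
      have := Real.mul_self_sqrt (show (0:ℝ) ≤ 2 by norm_num)
      have := norm_ne_zero_iff.2 (hne u)
      have := norm_ne_zero_iff.2 (hne w)
      apply le_of_eq
      simp only [Real.norm_ofNat]
      field_simp
      rw [Real.sq_sqrt (by norm_num)]
      ring
  calc μHE[2] {w : E 4 | ‖w‖ = 1 ∧ inner ℝ w n = 0} ≤ μHE[2] ({e} ∪ f '' univ) :=
        measure_mono hsub
    _ ≤ μHE[2] {e} + μHE[2] (f '' univ) := measure_union_le _ _
    _ ≤ 0 + ∫⁻ u in univ, ENNReal.ofReal (g u ^ 4) := by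
        rw [area_singleton]; gcongr
    _ = ∫⁻ u : E 2, ENNReal.ofReal 4 * ENNReal.ofReal (1 / ((1 : ℝ) ^ 2 + ‖u‖ ^ 2) ^ 2) := by
        rw [zero_add, Measure.restrict_univ]
        congr 1
        funext u
        rw [← ENNReal.ofReal_mul (by norm_num)]
        congr 1
        simp only [hg, mul_one]
        rw [show (4 : ℕ) = 2 * 2 by norm_num, pow_mul, Real.sq_sqrt (by positivity)]
        field_simp
        norm_num
    _ = ENNReal.ofReal (4 * Real.pi) := by
        rw [lintegral_const_mul' _ _ (by simp), lintegral_plane_kernel one_pos,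
          ← ENNReal.ofReal_mul (by norm_num)]
        simp

/-- A set in a ball that is almost orthogonal, in all its chords, to two almost orthogonal unit
vectors has at most about the area of a plane disk. -/
theorem area_le_of_flat {X : Set (E 4)} {z e₁ e₂ : E 4} {ρ ε : ℝ} (hρ : 0 ≤ ρ) (hε0 : 0 ≤ ε)
    (hε : ε ≤ 1 / 5) (hX : X ⊆ closedBall z ρ) (h1 : ‖e₁‖ = 1) (h2 : ‖e₂‖ = 1)
    (h12 : |inner ℝ e₁ e₂| ≤ ε)
    (hX1 : ∀ x ∈ X, ∀ y ∈ X, |inner ℝ (x - y) e₁| ≤ ε * ‖x - y‖)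
    (hX2 : ∀ x ∈ X, ∀ y ∈ X, |inner ℝ (x - y) e₂| ≤ ε * ‖x - y‖) :
    μHE[2] X ≤ ENNReal.ofReal (1 / (1 - 5 / 2 * ε ^ 2) * (Real.pi * ρ ^ 2)) := by
  have hli := linearIndependent_pair_of_abs_inner_lt h1 h2 (by linarith)
  obtain ⟨ι, hι⟩ := exists_isometry_orthogonal hli
  set V := Submodule.span ℝ {e₁, e₂} with hV
  have hpar : ∀ x : E 4, ∃ u : E 2, ι u = Vᗮ.starProjection x := by
    intro x
    have hr : ∀ y, y ∈ Vᗮ → ∃ u, ι u = y := by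
      intro y hy
      rw [← hι] at hy
      exact hy
    exact hr _ (Submodule.starProjection_apply_mem _ _)
  choose p hp using hpar
  have hsplit : ∀ x : E 4, ‖x‖ ^ 2 = ‖V.starProjection x‖ ^ 2 + ‖Vᗮ.starProjection x‖ ^ 2 := by
    intro x
    exact V.norm_sq_eq_add_norm_sq_starProjection x
  have hpd : ∀ x y, dist (p x) (p y) = ‖Vᗮ.starProjection (x - y)‖ := by
    intro x y
    rw [← ι.dist_map, hp, hp, dist_eq_norm, map_sub]
  set δ := 1 - 5 / 2 * ε ^ 2 with hδ
  have hδ0 : 0 < δ := by rw [hδ]; nlinarith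
  have hbound : ∀ w : E 4, |inner ℝ w e₁| ≤ ε * ‖w‖ → |inner ℝ w e₂| ≤ ε * ‖w‖ →
      δ * ‖w‖ ^ 2 ≤ ‖Vᗮ.starProjection w‖ ^ 2 := by
    intro w hw1 hw2
    have hm : V.starProjection w ∈ V := Submodule.starProjection_apply_mem _ _
    obtain ⟨a, b, hab⟩ := Submodule.mem_span_pair.1 (hV ▸ hm)
    have hsq : ‖V.starProjection w‖ ^ 2 = a * inner ℝ w e₁ + b * inner ℝ w e₂ := by
      have h3 : inner ℝ w (V.starProjection w) = ‖V.starProjection w‖ ^ 2 := by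
        have hdec : w = V.starProjection w + Vᗮ.starProjection w := by
          rw [Submodule.starProjection_orthogonal]; simp
        conv_lhs => rw [hdec]
        rw [inner_add_left]
        rw [← real_inner_self_eq_norm_sq]
        have hh : inner ℝ (Vᗮ.starProjection w) (V.starProjection w) = 0 :=
          Submodule.inner_left_of_mem_orthogonal hm (Submodule.starProjection_apply_mem _ _)
        rw [← hdec, hh, add_zero]
      rw [← h3, ← hab, inner_add_right, inner_smul_right, inner_smul_right]
    have hexp : ‖V.starProjection w‖ ^ 2 = a ^ 2 + b ^ 2 + 2 * (a * b) * inner ℝ e₁ e₂ := by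
      rw [← hab, norm_add_sq_real, norm_smul, norm_smul, h1, h2, inner_smul_left,
        inner_smul_right]
      simp only [conj_trivial, mul_one, Real.norm_eq_abs, sq_abs]
      ring
    set P := ‖V.starProjection w‖ ^ 2 with hP
    set s := |a| + |b| with hs
    have hs0 : 0 ≤ s := by positivity
    have hb1 : P ≤ s * (ε * ‖w‖) := by
      rw [hsq]
      calc a * inner ℝ w e₁ + b * inner ℝ w e₂ ≤ |a * inner ℝ w e₁| + |b * inner ℝ w e₂| :=
            add_le_add (le_abs_self _) (le_abs_self _)
        _ ≤ |a| * (ε * ‖w‖) + |b| * (ε * ‖w‖) := by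
            rw [abs_mul, abs_mul]; gcongr
        _ = s * (ε * ‖w‖) := by rw [hs]; ring
    -- Near-orthogonality of `e₁` and `e₂` bounds the coefficients by the norm of the projection.
    -- The constant `2/5` is exact for `ε = 1/5`, and `5/2` in the conclusion is its inverse.
    have hb2 : (2 / 5) * s ^ 2 ≤ P := by
      have h3 : -(|a| * |b| * ε) ≤ (a * b) * inner ℝ e₁ e₂ := by
        have : |(a * b) * inner ℝ e₁ e₂| ≤ |a| * |b| * ε := by
          rw [abs_mul, abs_mul]; gcongr
        exact (abs_le.1 this).1
      have h4 : |a| * |b| * ε ≤ |a| * |b| * (1 / 5) := by gcongr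
      rw [hexp, hs]
      nlinarith [sq_abs a, sq_abs b, sq_nonneg (|a| - |b|), mul_nonneg (abs_nonneg a) (abs_nonneg b)]
    have hb3 : P ≤ 5 / 2 * ε ^ 2 * ‖w‖ ^ 2 := by
      have h5 : s ≤ 5 / 2 * (ε * ‖w‖) := by
        by_contra hcon
        push Not at hcon
        have hpos : 0 < s := lt_of_le_of_lt (by positivity) hcon
        nlinarith
      have : s * (ε * ‖w‖) ≤ 5 / 2 * (ε * ‖w‖) * (ε * ‖w‖) := by
        gcongr
      nlinarith
    have := hsplit w
    rw [hδ]
    nlinarith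
  have hexpand : ∀ x ∈ X, ∀ y ∈ X, dist x y ≤ √(1 / δ) * dist (p x) (p y) := by
    intro x hx y hy
    rw [hpd, dist_eq_norm]
    refine abs_le_of_sq_le_sq' ?_ (by positivity) |>.2
    rw [mul_pow, Real.sq_sqrt (by positivity)]
    have := hbound (x - y) (hX1 x hx y hy) (hX2 x hx y hy)
    rw [div_mul_eq_mul_div, one_mul, le_div_iff₀ hδ0]
    linarith
  have himg : p '' X ⊆ closedBall (p z) ρ := by
    rintro _ ⟨x, hx, rfl⟩
    rw [mem_closedBall, hpd]
    have h3 : ‖x - z‖ ≤ ρ := by rw [← dist_eq_norm]; exact hX hx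
    exact (Submodule.norm_starProjection_apply_le _ _).trans h3
  calc μHE[2] X ≤ ENNReal.ofReal ((√(1 / δ)) ^ 2) * μHE[2] (p '' X) :=
        area_le_of_expanding (Real.sqrt_nonneg _) hexpand
    _ ≤ ENNReal.ofReal (1 / δ) * ENNReal.ofReal (Real.pi * ρ ^ 2) := by
        rw [Real.sq_sqrt (by positivity), ← area_closedBall_plane hρ]
        gcongr
    _ = ENNReal.ofReal (1 / δ * (Real.pi * ρ ^ 2)) := by
        rw [← ENNReal.ofReal_mul (by positivity)]

/-! ### Level sets of the distance on the sphere -/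

/-- The points of `𝕊³` at geodesic distance `arccos c` from `M`. -/
def level (M : Set (E 4)) (c : ℝ) : Set (E 4) :=
  {x | ‖x‖ = 1 ∧ (∀ y ∈ M, inner ℝ x y ≤ c) ∧ ∃ y ∈ M, inner ℝ x y = c}

theorem inner_sub_self_of_unit {x x' : E 4} (hx : ‖x‖ = 1) (hx' : ‖x'‖ = 1) :
    inner ℝ (x' - x) x = -(‖x' - x‖ ^ 2 / 2) := by
  rw [norm_sub_sq_real, inner_sub_left, real_inner_self_eq_norm_sq, hx, hx']
  ring

theorem norm_sub_sq_of_unit {x y : E 4} (hx : ‖x‖ = 1) (hy : ‖y‖ = 1) :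
    ‖x - y‖ ^ 2 = 2 - 2 * inner ℝ x y := by
  rw [norm_sub_sq_real, hx, hy]; ring

/-- Equal norms make `x' - x` orthogonal to `x' + x`, and `z` is within `ρ` of the midpoint. This
supplies the radial direction as one of the two normals in `area_le_of_flat`. -/
theorem abs_inner_sub_le_of_unit {x x' z : E 4} {ρ : ℝ} (hx : ‖x‖ = 1) (hx' : ‖x'‖ = 1)
    (h : ‖x - z‖ ≤ ρ) (h' : ‖x' - z‖ ≤ ρ) : |inner ℝ (x' - x) z| ≤ ρ * ‖x' - x‖ := by
  have h0 : inner ℝ (x' - x) (x' + x) = 0 := by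
    rw [inner_sub_left, inner_add_right, inner_add_right, real_inner_self_eq_norm_sq,
      real_inner_self_eq_norm_sq, hx, hx', real_inner_comm]; ring
  have h1 : inner ℝ (x' - x) z =
      -(inner ℝ (x' - x) (x' - z) / 2 + inner ℝ (x' - x) (x - z) / 2) := by
    simp only [inner_sub_right]
    rw [inner_add_right] at h0
    linarith
  rw [h1, abs_neg]
  have a1 := abs_real_inner_le_norm (x' - x) (x' - z)
  have a2 := abs_real_inner_le_norm (x' - x) (x - z)
  have b1 : ‖x' - x‖ * ‖x' - z‖ ≤ ‖x' - x‖ * ρ := by gcongr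
  have b2 : ‖x' - x‖ * ‖x - z‖ ≤ ‖x' - x‖ * ρ := by gcongr
  rw [abs_le] at *
  constructor <;> linarith [a1.1, a1.2, a2.1, a2.2]

/-- The point `x'` is no closer to `y` than `x` is, since `y` realizes the distance from `x` to `M`.
All chord estimates for level sets start from this one-sided inequality, applied once from each
endpoint. -/
theorem inner_sub_foot_nonpos {M : Set (E 4)} {c : ℝ} {x x' y : E 4} (hx' : x' ∈ level M c)
    (hy : y ∈ M) (hxy : inner ℝ x y = c) : inner ℝ (x' - x) y ≤ 0 := by
  rw [inner_sub_left, hxy]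
  linarith [hx'.2.1 y hy]

theorem abs_inner_le_of_le {x x' e : E 4} {a : ℝ} (h1 : inner ℝ (x' - x) e ≤ a * ‖x' - x‖)
    (h2 : inner ℝ (x - x') e ≤ a * ‖x - x'‖) : |inner ℝ (x' - x) e| ≤ a * ‖x' - x‖ := by
  rw [abs_le]
  refine ⟨?_, h1⟩
  rw [← neg_sub x' x, inner_neg_left, norm_neg] at h2
  linarith

theorem inner_sub_le_of_near {x x' e f : E 4} {a b : ℝ} (h : inner ℝ (x' - x) e ≤ a * ‖x' - x‖)
    (hef : ‖e - f‖ ≤ b) : inner ℝ (x' - x) f ≤ (a + b) * ‖x' - x‖ := by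
  have h1 : inner ℝ (x' - x) f = inner ℝ (x' - x) e - inner ℝ (x' - x) (e - f) := by
    rw [inner_sub_right]; ring
  have h2 := (abs_le.1 (abs_real_inner_le_norm (x' - x) (e - f))).1
  have h3 : ‖x' - x‖ * ‖e - f‖ ≤ ‖x' - x‖ * b := by gcongr
  rw [h1]; linarith

/-- Level sets of the distance to an arbitrary set have quadratic area growth. -/
theorem exists_area_level_le : ∃ C : ℝ, 0 < C ∧ ∀ (M X : Set (E 4)) (c s ρ : ℝ) (z : E 4),
    (∀ y ∈ M, ‖y‖ = 1) → 0 < s → c ^ 2 + s ^ 2 = 1 → 0 < ρ → ρ ≤ 1 / 40 → c * ρ ≤ s / 40 →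
    X ⊆ level M c → X ⊆ closedBall z ρ → μHE[2] X ≤ ENNReal.ofReal (C * ρ ^ 2) := by
  -- A finite net of candidate normals: points whose foot direction is near the same net element
  -- form one almost flat piece, and the number of pieces is absolute.
  obtain ⟨T, hTs, hTf, hT⟩ := (isCompact_sphere (0 : E 4) 1).finite_cover_balls
    (e := 1 / 20) (by norm_num)
  lift T to Finset (E 4) using hTf
  refine ⟨5 * Real.pi * (T.card + 1), by positivity, ?_⟩
  intro M X c s ρ z hM hs hcs hρ hρ' hcρ hX hXz
  rcases X.eq_empty_or_nonempty with rfl | ⟨x0, hx0⟩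
  · simp
  have hX0 : ∀ x ∈ X, ‖x - x0‖ ≤ 2 * ρ := by
    intro x hx
    have h1 := hXz hx
    have h2 := hXz hx0
    rw [mem_closedBall] at h1 h2
    rw [← dist_eq_norm]
    linarith [dist_triangle_right x x0 z]
  -- The unit tangent vector at `x` pointing along the geodesic towards the foot `y`.
  set g : E 4 → E 4 → E 4 := fun x y => (1 / s) • (y - c • x) with hg
  have hg1 : ∀ x ∈ X, ∀ y ∈ M, inner ℝ x y = c → ‖g x y‖ = 1 ∧ inner ℝ (g x y) x = 0 := by
    intro x hx y hy hxy
    have hxn := (hX hx).1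
    have e1 : ‖y - c • x‖ ^ 2 = s ^ 2 := by
      rw [norm_sub_sq_real, norm_smul, inner_smul_right, real_inner_comm, hxy, hM y hy, hxn]
      simp only [Real.norm_eq_abs, mul_one, sq_abs]
      linarith
    have e2 : ‖y - c • x‖ = s := by
      rwa [sq_eq_sq₀ (norm_nonneg _) hs.le] at e1
    constructor
    · rw [hg]
      simp only
      rw [norm_smul, e2, Real.norm_eq_abs, abs_of_pos (by positivity)]
      field_simp
    · simp only [hg]
      rw [inner_smul_left, inner_sub_left, real_inner_comm, hxy, inner_smul_left,
        real_inner_self_eq_norm_sq, hxn]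
      simp
  set Xf : E 4 → Set (E 4) := fun f => {x ∈ X | ∃ y ∈ M, inner ℝ x y = c ∧ ‖g x y - f‖ ≤ 1 / 20}
    with hXf
  have hcover : X ⊆ ⋃ f ∈ T, Xf f := by
    intro x hx
    obtain ⟨y, hy, hxy⟩ := (hX hx).2.2
    have : g x y ∈ sphere (0 : E 4) 1 := by simpa using (hg1 x hx y hy hxy).1
    have := hT this
    simp only [mem_iUnion, mem_ball, exists_prop] at this ⊢
    obtain ⟨f, hf, hd⟩ := this
    refine ⟨f, hf, hx, y, hy, hxy, ?_⟩
    rw [← dist_eq_norm]; exact hd.le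
  have hone : ∀ f ∈ T, μHE[2] (Xf f) ≤ ENNReal.ofReal (5 * Real.pi * ρ ^ 2) := by
    intro f hf
    rcases (Xf f).eq_empty_or_nonempty with h0 | ⟨x1, hx1, y1, hy1, hxy1, hf1⟩
    · rw [h0]; simp
    have hfn : ‖f‖ = 1 := by simpa using hTs hf
    have hf0 : |inner ℝ f x0| ≤ 1 / 10 := by
      have e : inner ℝ f x0 = -inner ℝ (g x1 y1 - f) x0 - inner ℝ (g x1 y1) (x1 - x0) := by
        rw [inner_sub_left, inner_sub_right, (hg1 x1 hx1 y1 hy1 hxy1).2]; ring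
      have a1 := abs_real_inner_le_norm (g x1 y1 - f) x0
      have a2 := abs_real_inner_le_norm (g x1 y1) (x1 - x0)
      rw [(hX hx0).1, mul_one] at a1
      rw [(hg1 x1 hx1 y1 hy1 hxy1).1, one_mul] at a2
      have a3 := hX0 x1 hx1
      rw [e]
      rw [abs_le] at *
      constructor <;> linarith [a1.1, a1.2, a2.1, a2.2]
    have hside : ∀ x ∈ Xf f, ∀ x' ∈ Xf f, inner ℝ (x' - x) f ≤ 1 / 10 * ‖x' - x‖ := by
      rintro x ⟨hx, y, hy, hxy, hgf⟩ x' ⟨hx', -⟩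
      have hd : ‖x' - x‖ ≤ 4 * ρ := by
        have := norm_sub_le_norm_sub_add_norm_sub x' x0 x
        rw [norm_sub_rev x0 x] at this
        linarith [hX0 x hx, hX0 x' hx']
      have h1 : inner ℝ (x' - x) (g x y) ≤ 1 / 20 * ‖x' - x‖ := by
        simp only [hg]
        rw [inner_smul_right, inner_sub_right, inner_smul_right,
          inner_sub_self_of_unit (hX hx).1 (hX hx').1]
        have h2 := inner_sub_foot_nonpos (hX hx') hy hxy
        -- The curvature of the sphere contributes `c ‖x' - x‖² / 2` against the normalization `s`;
        -- the hypothesis `c * ρ ≤ s / 40` makes it negligible. Nothing is needed when `c ≤ 0`.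
        have h3 : c * ‖x' - x‖ ≤ s / 10 := by
          rcases le_or_gt c 0 with hc | hc
          · have := mul_nonpos_of_nonpos_of_nonneg hc (norm_nonneg (x' - x))
            linarith
          · have : c * ‖x' - x‖ ≤ c * (4 * ρ) := by gcongr
            linarith
        have h4 : inner ℝ (x' - x) y - c * -(‖x' - x‖ ^ 2 / 2) ≤ s * (1 / 20 * ‖x' - x‖) := by
          nlinarith [norm_nonneg (x' - x)]
        rw [div_mul_eq_mul_div, one_mul, div_le_iff₀ hs]
        linarith
      have := inner_sub_le_of_near h1 hgf
      linarith
    have harea := area_le_of_flat (X := Xf f) (z := x0) (e₁ := f) (e₂ := x0) (ρ := 2 * ρ)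
      (ε := 1 / 10) (by positivity) (by norm_num) (by norm_num)
      (fun x hx => by rw [mem_closedBall, dist_eq_norm]; exact hX0 x hx.1) hfn (hX hx0).1 hf0
      (fun x hx x' hx' => abs_inner_le_of_le (hside x' hx' x hx) (hside x hx x' hx'))
      (fun x hx x' hx' => ?_)
    · refine harea.trans (ENNReal.ofReal_le_ofReal ?_)
      have : 0 ≤ Real.pi * ρ ^ 2 := by positivity
      norm_num
      nlinarith
    · have := abs_inner_sub_le_of_unit (hX hx'.1).1 (hX hx.1).1 (hX0 x' hx'.1) (hX0 x hx.1)
      refine this.trans ?_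
      gcongr
      linarith
  calc μHE[2] X ≤ μHE[2] (⋃ f ∈ T, Xf f) := measure_mono hcover
    _ ≤ ∑ f ∈ T, μHE[2] (Xf f) := measure_biUnion_finset_le _ _
    _ ≤ ∑ f ∈ T, ENNReal.ofReal (5 * Real.pi * ρ ^ 2) := Finset.sum_le_sum hone
    _ = ENNReal.ofReal (T.card * (5 * Real.pi * ρ ^ 2)) := by
      rw [Finset.sum_const, nsmul_eq_mul, ENNReal.ofReal_mul (Nat.cast_nonneg _),
        ENNReal.ofReal_natCast]
    _ ≤ ENNReal.ofReal (5 * Real.pi * (T.card + 1) * ρ ^ 2) := by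
      apply ENNReal.ofReal_le_ofReal
      have : 0 ≤ Real.pi * ρ ^ 2 := by positivity
      nlinarith

/-- A ball of radius `L s` is covered by a number, depending only on `L`, of balls of radius `s /
40`, and at that radius the smallness conditions of the crude bound hold automatically. -/
theorem exists_area_level_le_of_scale (L : ℝ) : ∃ C : ℝ, 0 < C ∧
    ∀ (M X : Set (E 4)) (c s : ℝ) (z : E 4),
    (∀ y ∈ M, ‖y‖ = 1) → 0 < s → c ^ 2 + s ^ 2 = 1 →
    X ⊆ level M c → X ⊆ closedBall z (L * s) → μHE[2] X ≤ ENNReal.ofReal (C * s ^ 2) := by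
  obtain ⟨C, hC, h⟩ := exists_area_level_le
  obtain ⟨T, -, hTf, hT⟩ := (isCompact_closedBall (0 : E 4) L).finite_cover_balls
    (e := 1 / 40) (by norm_num)
  lift T to Finset (E 4) using hTf
  refine ⟨C * (T.card + 1), by positivity, ?_⟩
  intro M X c s z hM hs hcs hX hXz
  have hs1 : s ≤ 1 := by nlinarith [sq_nonneg c]
  have hc1 : c ≤ 1 := by nlinarith [sq_nonneg s]
  have hcover : X ⊆ ⋃ t ∈ T, X ∩ closedBall (z + s • t) (s / 40) := by
    intro x hx
    have h1 : (1 / s) • (x - z) ∈ closedBall (0 : E 4) L := by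
      have := hXz hx
      rw [mem_closedBall, dist_eq_norm] at this
      rw [mem_closedBall, dist_zero_right, norm_smul, Real.norm_eq_abs,
        abs_of_pos (by positivity), div_mul_eq_mul_div, one_mul, div_le_iff₀ hs]
      exact this
    have := hT h1
    simp only [mem_iUnion, mem_ball, exists_prop, mem_inter_iff] at this ⊢
    obtain ⟨t, ht, hd⟩ := this
    refine ⟨t, ht, hx, ?_⟩
    rw [mem_closedBall, dist_eq_norm]
    rw [dist_eq_norm] at hd
    have e : x - (z + s • t) = s • ((1 / s) • (x - z) - t) := by
      rw [smul_sub, smul_smul, mul_one_div_cancel hs.ne', one_smul]; abel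
    rw [e, norm_smul, Real.norm_eq_abs, abs_of_pos hs]
    nlinarith
  calc μHE[2] X ≤ μHE[2] (⋃ t ∈ T, X ∩ closedBall (z + s • t) (s / 40)) := measure_mono hcover
    _ ≤ ∑ t ∈ T, μHE[2] (X ∩ closedBall (z + s • t) (s / 40)) := measure_biUnion_finset_le _ _
    _ ≤ ∑ t ∈ T, ENNReal.ofReal (C * (s / 40) ^ 2) := by
      refine Finset.sum_le_sum fun t _ => ?_
      refine h M _ c s (s / 40) _ hM hs hcs (by positivity) (by linarith) ?_
        (inter_subset_left.trans hX) inter_subset_right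
      nlinarith
    _ = ENNReal.ofReal (T.card * (C * (s / 40) ^ 2)) := by
      rw [Finset.sum_const, nsmul_eq_mul, ENNReal.ofReal_mul (Nat.cast_nonneg _),
        ENNReal.ofReal_natCast]
    _ ≤ ENNReal.ofReal (C * (T.card + 1) * s ^ 2) := by
      apply ENNReal.ofReal_le_ofReal
      have : 0 ≤ C * s ^ 2 := by positivity
      have : 0 ≤ T.card * (C * s ^ 2) := by positivity
      nlinarith

/-- Double counting of pairs at distance less than `R`. -/
theorem mul_measure_le_of_ball {F : Type*} [MetricSpace F] [SecondCountableTopology F]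
    [MeasurableSpace F] [BorelSpace F] (μ : Measure F) {X M : Set F} (hX : MeasurableSet X)
    (hM : MeasurableSet M) (hXf : μ X ≠ ⊤) (hMf : μ M ≠ ⊤) {R : ℝ} {a b : ℝ≥0∞}
    (ha : ∀ x ∈ X, a ≤ μ (M ∩ ball x R)) (hb : ∀ y ∈ M, μ (X ∩ ball y R) ≤ b) :
    a * μ X ≤ b * μ M := by
  have : IsFiniteMeasure (μ.restrict X) := ⟨by simpa using hXf.lt_top⟩
  have : IsFiniteMeasure (μ.restrict M) := ⟨by simpa using hMf.lt_top⟩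
  have hms : MeasurableSet {p : F × F | dist p.1 p.2 < R} :=
    measurableSet_lt (by fun_prop) measurable_const
  have hf : Measurable (Function.uncurry fun x y : F =>
      ({p : F × F | dist p.1 p.2 < R}).indicator (fun _ => (1 : ℝ≥0∞)) (x, y)) :=
    measurable_const.indicator hms
  have hsw := lintegral_lintegral_swap (μ := μ.restrict X) (ν := μ.restrict M) hf.aemeasurable
  have e1 : ∀ x, ∫⁻ y in M, ({p : F × F | dist p.1 p.2 < R}).indicator (fun _ => (1 : ℝ≥0∞)) (x, y)
      ∂μ = μ (M ∩ ball x R) := by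
    intro x
    have : (fun y => ({p : F × F | dist p.1 p.2 < R}).indicator (fun _ => (1 : ℝ≥0∞)) (x, y)) =
        (ball x R).indicator (fun _ => 1) := by
      funext y
      simp [indicator, dist_comm]
    rw [this, lintegral_indicator measurableSet_ball, setLIntegral_one,
      Measure.restrict_apply measurableSet_ball, inter_comm]
  have e2 : ∀ y, ∫⁻ x in X, ({p : F × F | dist p.1 p.2 < R}).indicator (fun _ => (1 : ℝ≥0∞)) (x, y)
      ∂μ = μ (X ∩ ball y R) := by
    intro y
    have : (fun x => ({p : F × F | dist p.1 p.2 < R}).indicator (fun _ => (1 : ℝ≥0∞)) (x, y)) =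
        (ball y R).indicator (fun _ => 1) := by
      funext x
      simp [indicator]
    rw [this, lintegral_indicator measurableSet_ball, setLIntegral_one,
      Measure.restrict_apply measurableSet_ball, inter_comm]
  simp only [e1, e2] at hsw
  calc a * μ X = ∫⁻ _ in X, a ∂μ := by rw [setLIntegral_const]
    _ ≤ ∫⁻ x in X, μ (M ∩ ball x R) ∂μ := setLIntegral_mono' hX ha
    _ = ∫⁻ y in M, μ (X ∩ ball y R) ∂μ := hsw
    _ ≤ ∫⁻ _ in M, b ∂μ := setLIntegral_mono' hM hb
    _ = b * μ M := by rw [setLIntegral_const]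

/-! ### Level sets of the distance to a set close to a round sphere -/

theorem norm_sub_inner_smul_sq {x n : E 4} (hx : ‖x‖ = 1) (hn : ‖n‖ = 1) :
    ‖x - (inner ℝ x n) • n‖ ^ 2 = 1 - (inner ℝ x n) ^ 2 := by
  rw [norm_sub_sq_real, norm_smul, inner_smul_right, hx, hn]
  simp only [Real.norm_eq_abs, mul_one, sq_abs]
  ring

theorem abs_sub_le_sqrt_of_sq {p q a : ℝ} (hp : 0 ≤ p) (hq : 0 ≤ q) (ha : 0 ≤ a)
    (h : |p ^ 2 - q ^ 2| ≤ a ^ 2) : |p - q| ≤ a := by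
  rw [abs_le] at *
  constructor <;> nlinarith

set_option maxHeartbeats 800000 in
/-- The position of a point of a level set relative to its foot point, when `M` is close to the
round sphere `{z | ⟪z, n⟫ = b}`. -/
theorem level_near_round_foot {M : Set (E 4)} {n x : E 4} {b c e d : ℝ}
    (hM : ∀ y ∈ M, ‖y‖ = 1) (hn : ‖n‖ = 1) (hb : |b| ≤ 1) (he : 0 < e) (he1 : e ≤ 1)
    (h1 : ∀ y ∈ M, |inner ℝ y n - b| ≤ e ^ 2)
    (h2 : ∀ z : E 4, ‖z‖ = 1 → inner ℝ z n = b → ∃ w ∈ M, ‖w - z‖ ≤ e ^ 2)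
    (hx : x ∈ level M c) (hd : 0 < d) (hxd : d ≤ ‖x - (inner ℝ x n) • n‖) :
    ∃ b' p' G S : ℝ, |b' - b| ≤ e ^ 2 ∧ 0 ≤ p' ∧ p' ≤ 1 ∧ |b'| ≤ 1 ∧ |p' - √(1 - b ^ 2)| ≤ 2 * e ∧
      c ≤ G ∧ G ≤ c + 5 * e ∧ S ^ 2 + G ^ 2 = 1 ∧ inner ℝ x n = G * b' - S * p' ∧
      S * (‖x - (inner ℝ x n) • n‖ + p') = (b' - inner ℝ x n) * (1 + G) ∧
      ∀ x' ∈ level M c, S * (inner ℝ x' n - inner ℝ x n) ≤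
        ‖x' - x‖ ^ 2 / 2 + √(10 * e / d) * ‖x' - x‖ := by
  obtain ⟨hxn, hxle, y, hy, hxy⟩ := hx
  have hyn := hM y hy
  set a := inner ℝ x n with ha
  set X := x - a • n with hX
  set p := ‖X‖ with hp
  have hp0 : 0 < p := lt_of_lt_of_le hd hxd
  have hp2 : p ^ 2 = 1 - a ^ 2 := norm_sub_inner_smul_sq hxn hn
  have hp1 : p ≤ 1 := by nlinarith [sq_nonneg a]
  set b' := inner ℝ y n with hb'
  set Y := y - b' • n with hY
  set p' := ‖Y‖ with hp'
  have hp'2 : p' ^ 2 = 1 - b' ^ 2 := norm_sub_inner_smul_sq hyn hn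
  have hp'0 : 0 ≤ p' := norm_nonneg _
  have hp'1 : p' ≤ 1 := by nlinarith [sq_nonneg b']
  have hb'1 : |b'| ≤ 1 := by rw [← sq_le_one_iff_abs_le_one]; nlinarith [sq_nonneg p']
  have ha1 : |a| ≤ 1 := by rw [← sq_le_one_iff_abs_le_one]; nlinarith [sq_nonneg p]
  have hXn : inner ℝ X n = 0 := by
    rw [hX, inner_sub_left, inner_smul_left, real_inner_self_eq_norm_sq, hn]; simp [ha]
  have hYn : inner ℝ Y n = 0 := by
    rw [hY, inner_sub_left, inner_smul_left, real_inner_self_eq_norm_sq, hn]; simp [hb']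
  have hxX : x = a • n + X := by rw [hX]; abel
  have hyY : y = b' • n + Y := by rw [hY]; abel
  have hnn : inner ℝ n n = (1 : ℝ) := by rw [real_inner_self_eq_norm_sq, hn]; norm_num
  have hnX : inner ℝ n X = (0 : ℝ) := by rw [real_inner_comm, hXn]
  have hnY : inner ℝ n Y = (0 : ℝ) := by rw [real_inner_comm, hYn]
  have hxy' : c = a * b' + inner ℝ X Y := by
    rw [← hxy, hxX, hyY]
    simp only [inner_add_left, inner_add_right, inner_smul_left, inner_smul_right, hXn, hnY, hnn,
      conj_trivial]
    ring
  have hXY : inner ℝ X Y ≤ p * p' := real_inner_le_norm X Y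
  set β := √(1 - b ^ 2) with hβ
  have hb2 : b ^ 2 ≤ 1 := by rwa [sq_le_one_iff_abs_le_one]
  have hβ2 : β ^ 2 = 1 - b ^ 2 := Real.sq_sqrt (by linarith)
  have hβ0 : 0 ≤ β := Real.sqrt_nonneg _
  have hb'b := h1 y hy
  have hp'β : |p' - β| ≤ 2 * e := by
    refine abs_sub_le_sqrt_of_sq hp'0 hβ0 (by positivity) ?_
    have : p' ^ 2 - β ^ 2 = -((b' - b) * (b' + b)) := by rw [hp'2, hβ2]; ring
    rw [this, abs_neg, abs_mul]
    have h3 : |b' + b| ≤ 2 := (abs_add_le _ _).trans (by linarith)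
    calc |b' - b| * |b' + b| ≤ e ^ 2 * 2 := by gcongr
      _ ≤ (2 * e) ^ 2 := by nlinarith [sq_nonneg e]
  -- the point of the round sphere nearest to `x`
  have hopt : a * b + β * p ≤ c + e ^ 2 := by
    set z := b • n + (β / p) • X with hz
    have hz1 : inner ℝ z n = b := by
      rw [hz, inner_add_left, inner_smul_left, inner_smul_left, hXn, hnn]; simp
    have hz2 : ‖z‖ = 1 := by
      have : ‖z‖ ^ 2 = 1 := by
        rw [hz, norm_add_sq_real, norm_smul, norm_smul, inner_smul_left, inner_smul_right, hnX, hn,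
          ← hp]
        simp only [Real.norm_eq_abs, mul_one, sq_abs, conj_trivial, mul_zero, add_zero, mul_pow,
          div_pow]
        rw [hβ2]
        field_simp
        ring
      exact (pow_eq_one_iff_of_nonneg (norm_nonneg z) two_ne_zero).1 this
    obtain ⟨w, hw, hwz⟩ := h2 z hz2 hz1
    have h4 : inner ℝ x z = a * b + β * p := by
      rw [hz, hxX]
      simp only [inner_add_left, inner_add_right, inner_smul_left, inner_smul_right, hXn, hnX, hnn,
        conj_trivial, real_inner_self_eq_norm_sq, ← hp]
      field_simp
      ring
    have h5 : inner ℝ x z ≤ inner ℝ x w + e ^ 2 := by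
      have : inner ℝ x z = inner ℝ x w - inner ℝ x (w - z) := by rw [inner_sub_right]; ring
      have h6 := (abs_le.1 (abs_real_inner_le_norm x (w - z))).1
      rw [hxn, one_mul] at h6
      linarith
    linarith [hxle w hw]
  set G := a * b' + p * p' with hG
  set S := b' * p - a * p' with hS
  have hGc : c ≤ G := by rw [hxy', hG]; linarith
  have hGc' : G ≤ c + 5 * e := by
    have h3 : a * b' ≤ a * b + e ^ 2 := by
      have : |a * (b' - b)| ≤ 1 * e ^ 2 := by rw [abs_mul]; gcongr
      linarith [(abs_le.1 this).2]
    have h4 : p * p' ≤ p * β + 2 * e := by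
      have : p * (p' - β) ≤ 1 * (2 * e) := by
        have := (abs_le.1 hp'β).2
        nlinarith
      linarith
    rw [hG]
    nlinarith
  have hSG : S ^ 2 + G ^ 2 = 1 := by
    have : S ^ 2 + G ^ 2 = (a ^ 2 + p ^ 2) * (b' ^ 2 + p' ^ 2) := by rw [hS, hG]; ring
    rw [this, hp2, hp'2]; ring
  refine ⟨b', p', G, S, hb'b, hp'0, hp'1, hb'1, hp'β, hGc, hGc', hSG, ?_, ?_, ?_⟩
  · rw [hG, hS]; linear_combination (-a) * hp'2
  · rw [hG, hS]; linear_combination b' * hp2 - a * hp'2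
  intro x' hx'
  have hfoot := inner_sub_foot_nonpos hx' hy hxy
  -- The failure of `x` and its foot to lie on one meridian. It has size of order `√(e / d)`, which
  -- is why the closeness hypotheses are stated with `e ^ 2` and points near the poles are excluded
  -- by `d`.
  set er := Y - (p' / p) • X with her
  have herr : ‖er‖ ^ 2 ≤ 10 * e / d := by
    have h3 : ‖er‖ ^ 2 = 2 * (p' / p) * (p * p' - inner ℝ X Y) := by
      rw [her, norm_sub_sq_real, norm_smul, inner_smul_right, ← hp, ← hp', real_inner_comm]
      simp only [Real.norm_eq_abs, mul_pow, sq_abs]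
      field_simp
      ring
    have h4 : p * p' - inner ℝ X Y ≤ 5 * e := by linarith
    have h5 : p' / p ≤ 1 / d := by gcongr
    have h6 : 0 ≤ p * p' - inner ℝ X Y := by linarith
    rw [h3]
    calc 2 * (p' / p) * (p * p' - inner ℝ X Y) ≤ 2 * (1 / d) * (5 * e) := by gcongr
      _ = 10 * e / d := by ring
  have herr' : ‖er‖ ≤ √(10 * e / d) := Real.le_sqrt_of_sq_le herr
  have hdec : y = (S / p) • n + (p' / p) • x + er := by
    rw [her]
    have h3 : (S / p) • n = b' • n - ((p' / p) * a) • n := by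
      rw [← sub_smul]; congr 1; rw [hS]; field_simp
    rw [h3, hyY, hX, smul_sub, smul_smul]; abel
  rw [hdec, inner_add_right, inner_add_right, inner_smul_right, inner_smul_right,
    inner_sub_self_of_unit hxn hx'.1, inner_sub_left x' x n, ← ha] at hfoot
  have h7 := (abs_le.1 (abs_real_inner_le_norm (x' - x) er)).1
  have h8 : ‖x' - x‖ * ‖er‖ ≤ ‖x' - x‖ * √(10 * e / d) := by gcongr
  have h9 : S / p * (inner ℝ x' n - a) ≤ p' / p * (‖x' - x‖ ^ 2 / 2) +
      ‖x' - x‖ * √(10 * e / d) := by linarith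
  have h10 : S * (inner ℝ x' n - a) ≤ p' * (‖x' - x‖ ^ 2 / 2) +
      p * (‖x' - x‖ * √(10 * e / d)) := by
    have := mul_le_mul_of_nonneg_left h9 hp0.le
    have e1 : p * (S / p * (inner ℝ x' n - a)) = S * (inner ℝ x' n - a) := by field_simp
    have e2 : p * (p' / p * (‖x' - x‖ ^ 2 / 2) + ‖x' - x‖ * √(10 * e / d)) =
      p' * (‖x' - x‖ ^ 2 / 2) + p * (‖x' - x‖ * √(10 * e / d)) := by field_simp
    rwa [e1, e2] at this
  have h11 : p' * (‖x' - x‖ ^ 2 / 2) ≤ 1 * (‖x' - x‖ ^ 2 / 2) := by gcongr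
  have h12 : p * (‖x' - x‖ * √(10 * e / d)) ≤ 1 * (‖x' - x‖ * √(10 * e / d)) := by gcongr
  linarith

/-- The size of `S` is known and only its sign is in doubt. A negative `S` would give `S * P ≤ -s₀ d
/ 2`, whereas `β * (1 + G) ≥ -4 e ≥ -s₀ d / 4`. Being on one side of the round sphere is what
provides the bound on `β`. -/
theorem half_le_of_sq_le {s₀ d P G S β e : ℝ} (hs₀ : 0 < s₀) (hd : 0 < d) (hP : d ≤ P)
    (hS : (s₀ / 2) ^ 2 ≤ S ^ 2) (hG : |G| ≤ 1) (he : 0 < e) (hed : 16 * e ≤ s₀ * d)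
    (hid : S * P = β * (1 + G)) (hβ : -(2 * e) ≤ β) : s₀ / 2 ≤ S := by
  rw [abs_le] at hG
  by_contra hcon
  push Not at hcon
  have hS' : S ≤ -(s₀ / 2) := by
    have := sq_le_sq.1 hS
    rw [abs_of_pos (by positivity)] at this
    rcases le_abs.1 this with h | h <;> linarith
  have h4 : -(2 * e) * (1 + G) ≤ β * (1 + G) := by gcongr; linarith
  have h4' : -(4 * e) ≤ -(2 * e) * (1 + G) := by nlinarith
  have h5 : S * P ≤ -(s₀ / 2) * P := by gcongr; linarith
  have h6 : s₀ * d ≤ s₀ * P := by gcongr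
  linarith

theorem abs_le_of_mul_le {S S' k B u : ℝ} (hk : 0 < k) (hB : 0 ≤ B) (hS : k ≤ S) (hS' : k ≤ S')
    (h : S * u ≤ k * B) (h' : S' * (-u) ≤ k * B) : |u| ≤ B := by
  rw [abs_le]
  constructor
  · by_contra hcon
    push Not at hcon
    nlinarith
  · by_contra hcon
    push Not at hcon
    nlinarith

set_option maxHeartbeats 800000 in
/-- Heights of points of a level set on one side of a set close to a round sphere. -/
theorem exists_height_lipschitz {s₀ d l : ℝ} (hs₀ : 0 < s₀) (hs₁ : s₀ ≤ 1) (hd : 0 < d)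
    (hl : 0 < l) :
    ∃ ε : ℝ, 0 < ε ∧ ∀ (M X : Set (E 4)) (n : E 4) (b c s : ℝ),
    (∀ y ∈ M, ‖y‖ = 1) → ‖n‖ = 1 → |b| ≤ 1 → s₀ ≤ s → c ^ 2 + s ^ 2 = 1 →
    (∀ y ∈ M, |inner ℝ y n - b| ≤ ε) →
    (∀ z : E 4, ‖z‖ = 1 → inner ℝ z n = b → ∃ w ∈ M, ‖w - z‖ ≤ ε) →
    X ⊆ level M c → ((∀ x ∈ X, inner ℝ x n ≤ b + ε) ∨ (∀ x ∈ X, b - ε ≤ inner ℝ x n)) →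
    (∀ x ∈ X, d ≤ ‖x - (inner ℝ x n) • n‖) →
    ∀ x ∈ X, ∀ x' ∈ X, |inner ℝ x' n - inner ℝ x n| ≤ l * ‖x' - x‖ := by
  set r := s₀ * l / 2 with hr
  have hr0 : 0 < r := by positivity
  -- The conditions serve, in turn, the lower bound for `|S|`, the error term of nearby pairs, the
  -- height difference of distant pairs, and the sign of `S`.
  obtain ⟨e, he0, he1, he2, he3, he4, he5⟩ : ∃ e : ℝ, 0 < e ∧ e ≤ 1 ∧ 10 * e ≤ s₀ ^ 2 / 2 ∧
      10 * e / d ≤ (r / 2) ^ 2 ∧ 40 * e / s₀ ≤ l * r ∧ 16 * e ≤ s₀ * d := by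
    refine ⟨min (min 1 (s₀ ^ 2 / 20)) (min (d * (r / 2) ^ 2 / 10)
      (min (l * r * s₀ / 40) (s₀ * d / 16))), by positivity, ?_, ?_, ?_, ?_, ?_⟩
    · exact (min_le_left _ _).trans (min_le_left _ _)
    · have : min (min 1 (s₀ ^ 2 / 20)) (min (d * (r / 2) ^ 2 / 10)
        (min (l * r * s₀ / 40) (s₀ * d / 16))) ≤ s₀ ^ 2 / 20 :=
        (min_le_left _ _).trans (min_le_right _ _)
      linarith
    · have : min (min 1 (s₀ ^ 2 / 20)) (min (d * (r / 2) ^ 2 / 10)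
        (min (l * r * s₀ / 40) (s₀ * d / 16))) ≤ d * (r / 2) ^ 2 / 10 :=
        (min_le_right _ _).trans (min_le_left _ _)
      rw [div_le_iff₀ hd]; linarith
    · have : min (min 1 (s₀ ^ 2 / 20)) (min (d * (r / 2) ^ 2 / 10)
        (min (l * r * s₀ / 40) (s₀ * d / 16))) ≤ l * r * s₀ / 40 :=
        (min_le_right _ _).trans ((min_le_right _ _).trans (min_le_left _ _))
      rw [div_le_iff₀ hs₀]; linarith
    · have : min (min 1 (s₀ ^ 2 / 20)) (min (d * (r / 2) ^ 2 / 10)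
        (min (l * r * s₀ / 40) (s₀ * d / 16))) ≤ s₀ * d / 16 :=
        (min_le_right _ _).trans ((min_le_right _ _).trans (min_le_right _ _))
      linarith
  refine ⟨e ^ 2, by positivity, ?_⟩
  intro M X n b c s hM hn hb hs hcs h1 h2 hX hside hXd
  have hee : e ^ 2 ≤ e := by nlinarith
  have hc : |c| ≤ 1 := by rw [← sq_le_one_iff_abs_le_one]; nlinarith [sq_nonneg s]
  have hs2 : s₀ ^ 2 ≤ s ^ 2 := by gcongr
  -- `|S|` is bounded below
  have hSlow : ∀ G S : ℝ, c ≤ G → G ≤ c + 5 * e → S ^ 2 + G ^ 2 = 1 →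
      (s₀ / 2) ^ 2 ≤ S ^ 2 ∧ |S ^ 2 - s ^ 2| ≤ 10 * e ∧ |G| ≤ 1 := by
    intro G S hG1 hG2 hSG
    have hG : |G| ≤ 1 := by rw [← sq_le_one_iff_abs_le_one]; nlinarith [sq_nonneg S]
    have h3 : |S ^ 2 - s ^ 2| ≤ 10 * e := by
      have : S ^ 2 - s ^ 2 = -((G - c) * (G + c)) := by linear_combination hSG - hcs
      rw [this, abs_neg, abs_mul]
      have a1 : |G - c| ≤ 5 * e := by rw [abs_le]; constructor <;> linarith
      have a2 : |G + c| ≤ 2 := (abs_add_le _ _).trans (by linarith)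
      calc |G - c| * |G + c| ≤ 5 * e * 2 := by gcongr
        _ = 10 * e := by ring
    refine ⟨?_, h3, hG⟩
    nlinarith [(abs_le.1 h3).1]
  have hsgn : ∀ x ∈ X, ∀ b' p' G S : ℝ, |b' - b| ≤ e ^ 2 → 0 ≤ p' → p' ≤ 1 →
      (s₀ / 2) ^ 2 ≤ S ^ 2 → |G| ≤ 1 →
      S * (‖x - (inner ℝ x n) • n‖ + p') = (b' - inner ℝ x n) * (1 + G) →
      ((inner ℝ x n ≤ b + e ^ 2 → s₀ / 2 ≤ S) ∧ (b - e ^ 2 ≤ inner ℝ x n → S ≤ -(s₀ / 2))) := by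
    intro x hx b' p' G S hbb hp0 hp1 hSl hG hid
    rw [abs_le] at hbb
    have hP := hXd x hx
    constructor
    · intro hle
      exact half_le_of_sq_le hs₀ hd (by linarith) hSl hG he0 he5 hid (by linarith)
    · intro hle
      have := half_le_of_sq_le (S := -S) (β := inner ℝ x n - b') hs₀ hd
        (show d ≤ ‖x - (inner ℝ x n) • n‖ + p' by linarith) (by rwa [neg_sq]) hG he0 he5
        (by linear_combination -hid) (by linarith)
      linarith
  -- local Lipschitz bound in one direction
  have hsqrt : √(10 * e / d) ≤ r / 2 := by
    rw [Real.sqrt_le_left (by positivity)]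
    exact he3
  intro x hx x' hx'
  obtain ⟨b₁, p₁, G₁, S₁, hb₁, hp₁, hp₁', hb₁', hpβ₁, hG₁, hG₁', hSG₁, hid₁, hs₁', hL₁⟩ :=
    level_near_round_foot hM hn hb he0 he1 h1 h2 (hX hx) hd (hXd x hx)
  obtain ⟨b₂, p₂, G₂, S₂, hb₂, hp₂, hp₂', hb₂', hpβ₂, hG₂, hG₂', hSG₂, hid₂, hs₂', hL₂⟩ :=
    level_near_round_foot hM hn hb he0 he1 h1 h2 (hX hx') hd (hXd x' hx')
  obtain ⟨hl₁, hq₁, hg₁⟩ := hSlow G₁ S₁ hG₁ hG₁' hSG₁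
  obtain ⟨hl₂, hq₂, hg₂⟩ := hSlow G₂ S₂ hG₂ hG₂' hSG₂
  have hs1 := hsgn x hx b₁ p₁ G₁ S₁ hb₁ hp₁ hp₁' hl₁ hg₁ hs₁'
  have hs2 := hsgn x' hx' b₂ p₂ G₂ S₂ hb₂ hp₂ hp₂' hl₂ hg₂ hs₂'
  have hL1 := hL₁ x' (hX hx')
  have hL2 := hL₂ x (hX hx)
  rw [norm_sub_rev x x'] at hL2
  set t := ‖x' - x‖ with ht
  have ht0 : 0 ≤ t := norm_nonneg _
  have hSsum : |S₁ - S₂| ≤ 20 * e / s₀ := by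
    have h3 : |S₁ ^ 2 - S₂ ^ 2| ≤ 20 * e := by
      rw [abs_le] at *
      constructor <;> linarith [hq₁.1, hq₁.2, hq₂.1, hq₂.2]
    have h4 : s₀ ≤ |S₁ + S₂| := by
      rcases hside with h | h
      · have := hs1.1 (h x hx)
        have := hs2.1 (h x' hx')
        exact le_trans (by linarith) (le_abs_self _)
      · have := hs1.2 (h x hx)
        have := hs2.2 (h x' hx')
        exact le_trans (by linarith) (neg_le_abs _)
    rw [le_div_iff₀ hs₀]
    calc |S₁ - S₂| * s₀ ≤ |S₁ - S₂| * |S₁ + S₂| := by gcongr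
      _ = |S₁ ^ 2 - S₂ ^ 2| := by rw [← abs_mul]; congr 1; ring
      _ ≤ 20 * e := h3
  -- Nearby pairs use the foot inequality, whose quadratic term is absorbed for `t ≤ r`. For distant
  -- pairs the formula `G * b' - S * p'` shows that all heights agree up to `40 e / s₀ ≤ l r`.
  rcases le_or_gt t r with htr | htr
  · have hb1 : t ^ 2 / 2 + √(10 * e / d) * t ≤ (s₀ / 2) * (l * t) := by
      have m1 : t * t ≤ r * t := by gcongr
      have m2 : √(10 * e / d) * t ≤ r / 2 * t := by gcongr
      have m3 : (s₀ / 2) * (l * t) = r * t := by rw [hr]; ring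
      rw [m3, sq]
      linarith only [m1, m2]
    have hlt : 0 ≤ l * t := by positivity
    rcases hside with h | h
    · exact abs_le_of_mul_le (half_pos hs₀) hlt (hs1.1 (h x hx)) (hs2.1 (h x' hx'))
        (hL1.trans hb1) (le_trans (le_of_eq (by ring)) (hL2.trans hb1))
    · have a1 := hs1.2 (h x hx)
      have a2 := hs2.2 (h x' hx')
      rw [abs_sub_comm]
      exact abs_le_of_mul_le (S := -S₁) (S' := -S₂) (half_pos hs₀) hlt (by linarith only [a1])
        (by linarith only [a2]) (le_trans (le_of_eq (by ring)) (hL1.trans hb1))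
        (le_trans (le_of_eq (by ring)) (hL2.trans hb1))
  · have e1 : inner ℝ x' n - inner ℝ x n = (G₂ - G₁) * b₂ + G₁ * (b₂ - b₁) - (S₂ - S₁) * p₂
        - S₁ * (p₂ - p₁) := by rw [hid₁, hid₂]; ring
    have f1 : |(G₂ - G₁) * b₂| ≤ 5 * e * 1 := by
      rw [abs_mul]; gcongr; rw [abs_le]; constructor <;> linarith
    have f2 : |G₁ * (b₂ - b₁)| ≤ 1 * (2 * e) := by
      rw [abs_mul]; gcongr
      rw [abs_le] at *
      constructor <;> linarith [hb₁.1, hb₁.2, hb₂.1, hb₂.2]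
    have f3 : |(S₂ - S₁) * p₂| ≤ 20 * e / s₀ * 1 := by
      rw [abs_mul, abs_sub_comm, abs_of_nonneg hp₂]; gcongr
    have f4 : |S₁ * (p₂ - p₁)| ≤ 1 * (4 * e) := by
      rw [abs_mul]; gcongr
      · rw [← sq_le_one_iff_abs_le_one]; nlinarith [sq_nonneg G₁]
      · rw [abs_le] at *
        constructor <;> linarith [hpβ₁.1, hpβ₁.2, hpβ₂.1, hpβ₂.2]
    have f5 : e ≤ e / s₀ := by rw [le_div_iff₀ hs₀]; nlinarith
    have f6 : |inner ℝ x' n - inner ℝ x n| ≤ 40 * e / s₀ := by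
      have e3 : 40 * e / s₀ = 40 * (e / s₀) := by ring
      have e4 : 20 * e / s₀ = 20 * (e / s₀) := by ring
      rw [e4] at f3
      rw [e1, e3]
      rw [abs_le] at f1 f2 f3 f4 ⊢
      constructor <;> linarith [f1.1, f1.2, f2.1, f2.2, f3.1, f3.2, f4.1, f4.2]
    calc |inner ℝ x' n - inner ℝ x n| ≤ l * r := f6.trans he4
      _ ≤ l * t := by gcongr

set_option maxHeartbeats 800000 in
/-- Level sets on one side of a set that is close to a round sphere have area close to at most
`4π`. -/
theorem exists_area_level_near_round_le {s₀ : ℝ} (hs₀ : 0 < s₀) (hs₁ : s₀ ≤ 1) :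
    ∃ ε : ℝ, 0 < ε ∧ ∀ (M X : Set (E 4)) (n : E 4) (b c s : ℝ),
    (∀ y ∈ M, ‖y‖ = 1) → ‖n‖ = 1 → |b| ≤ 1 → s₀ ≤ s → c ^ 2 + s ^ 2 = 1 →
    (∀ y ∈ M, |inner ℝ y n - b| ≤ ε) →
    (∀ z : E 4, ‖z‖ = 1 → inner ℝ z n = b → ∃ w ∈ M, ‖w - z‖ ≤ ε) →
    X ⊆ level M c → ((∀ x ∈ X, inner ℝ x n ≤ b + ε) ∨ (∀ x ∈ X, b - ε ≤ inner ℝ x n)) →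
    μHE[2] X ≤ ENNReal.ofReal (5 * Real.pi) := by
  obtain ⟨C, hC, hcrude⟩ := exists_area_level_le
  -- Radius of the polar caps, where latitude does not control position. By the crude bound each
  -- costs at most `1/4`; the rest costs `49/48 · 4π`, and the sum stays below `5π`.
  obtain ⟨δ, hδ0, hδ1, hδ2, hδ3⟩ : ∃ δ : ℝ, 0 < δ ∧ δ ≤ 1 / 40 ∧ δ ≤ s₀ / 40 ∧ C * δ ^ 2 ≤ 1 / 4 := by
    refine ⟨min (1 / 40) (min (s₀ / 40) (1 / (4 * (C + 1)))), by positivity, min_le_left _ _,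
      (min_le_right _ _).trans (min_le_left _ _), ?_⟩
    set m := min (1 / 40) (min (s₀ / 40) (1 / (4 * (C + 1))))
    have h0 : 0 < m := by positivity
    have h1 : m ≤ 1 / 40 := min_le_left _ _
    have h2 : m ≤ 1 / (4 * (C + 1)) := (min_le_right _ _).trans (min_le_right _ _)
    rw [le_div_iff₀ (by positivity)] at h2
    nlinarith
  set d := δ / 2 with hd
  have hd0 : 0 < d := by positivity
  have hd1 : d ≤ 1 := by rw [hd]; linarith
  obtain ⟨ε, hε, hlip⟩ := exists_height_lipschitz hs₀ hs₁ hd0 (l := d / 10) (by positivity)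
  refine ⟨ε, hε, ?_⟩
  intro M X n b c s hM hn hb hs hcs h1 h2 hX hside
  have hs0 : 0 < s := lt_of_lt_of_le hs₀ hs
  have hc1 : c ≤ 1 := by nlinarith [sq_nonneg s]
  have hcδ : c * δ ≤ s / 40 := by nlinarith
  set X₀ := {x ∈ X | d ≤ ‖x - (inner ℝ x n) • n‖} with hX₀
  have hsplit : X ⊆ X₀ ∪ (X ∩ closedBall n δ ∪ X ∩ closedBall (-n) δ) := by
    intro x hx
    by_cases h : d ≤ ‖x - (inner ℝ x n) • n‖
    · exact Or.inl ⟨hx, h⟩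
    right
    push Not at h
    have hxn := (hX hx).1
    have hsq := norm_sub_inner_smul_sq hxn hn
    set a := inner ℝ x n with ha
    have hlt : 1 - a ^ 2 < d ^ 2 := by
      rw [← hsq]; gcongr
    rcases le_or_gt 0 a with h0 | h0
    · left
      refine ⟨hx, ?_⟩
      rw [mem_closedBall, dist_eq_norm]
      have := norm_sub_sq_of_unit hxn hn
      refine abs_le_of_sq_le_sq' ?_ hδ0.le |>.2
      rw [this, ← ha]
      nlinarith
    · right
      refine ⟨hx, ?_⟩
      rw [mem_closedBall, dist_eq_norm]
      have := norm_sub_sq_of_unit hxn (y := -n) (by rw [norm_neg, hn])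
      refine abs_le_of_sq_le_sq' ?_ hδ0.le |>.2
      rw [this, inner_neg_right, ← ha]
      nlinarith
  have hpole : ∀ z, μHE[2] (X ∩ closedBall z δ) ≤ ENNReal.ofReal (1 / 4) := by
    intro z
    refine (hcrude M _ c s δ z hM hs0 hcs hδ0 hδ1 hcδ (inter_subset_left.trans hX)
      inter_subset_right).trans (ENNReal.ofReal_le_ofReal hδ3)
  have hmain : μHE[2] X₀ ≤ ENNReal.ofReal (49 / 48 * (4 * Real.pi)) := by
    have hL := hlip M X₀ n b c s hM hn hb hs hcs h1 h2 (fun x hx => hX hx.1)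
      (hside.imp (fun h x hx => h x hx.1) (fun h x hx => h x hx.1)) (fun x hx => hx.2)
    -- Projection along meridians onto the equator. A height Lipschitz constant `d / 10` bounds both
    -- the latitude part and the radius part of a chord by a tenth of its length, so chords shrink
    -- by a factor of at most `√(49/48)`.
    set w : E 4 → E 4 := fun x =>
      (1 / ‖x - (inner ℝ x n) • n‖) • (x - (inner ℝ x n) • n) with hw
    have hexp : ∀ x ∈ X₀, ∀ x' ∈ X₀, dist x x' ≤ √(49 / 48) * dist (w x) (w x') := by
      intro x hx x' hx'
      have hl := hL x' hx' x hx
      have hsq := norm_sub_inner_smul_sq (hX hx.1).1 hn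
      have hsq' := norm_sub_inner_smul_sq (hX hx'.1).1 hn
      have hdx := hx.2
      have hdx' := hx'.2
      rw [dist_eq_norm, dist_eq_norm]
      simp only [hw]
      set a := inner ℝ x n with ha
      set a' := inner ℝ x' n with ha'
      set Y := x - a • n with hY
      set Y' := x' - a' • n with hY'
      have hYn : inner ℝ (Y - Y') n = 0 := by
        simp only [hY, hY', inner_sub_left, inner_smul_left, real_inner_self_eq_norm_sq, hn]
        simp [ha, ha']
      have hxx : ‖x - x'‖ ^ 2 = (a - a') ^ 2 + ‖Y - Y'‖ ^ 2 := by
        have : x - x' = (Y - Y') + (a - a') • n := by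
          rw [hY, hY', sub_smul]; abel
        rw [this, norm_add_sq_real, inner_smul_right, hYn, norm_smul, hn]
        simp only [Real.norm_eq_abs, mul_one, sq_abs]
        ring
      set p := ‖Y‖
      set p' := ‖Y'‖
      have hp0 : 0 < p := lt_of_lt_of_le hd0 hdx
      have hp'0 : 0 < p' := lt_of_lt_of_le hd0 hdx'
      set v := (1 / p) • Y - (1 / p') • Y' with hv
      have hvn : ‖v‖ ^ 2 = 2 - 2 * inner ℝ Y Y' / (p * p') := by
        rw [hv, norm_sub_sq_real, norm_smul, norm_smul, inner_smul_left, inner_smul_right]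
        simp only [Real.norm_eq_abs, mul_pow, sq_abs, conj_trivial]
        change (1 / p) ^ 2 * p ^ 2 - 2 * (1 / p * (1 / p' * inner ℝ Y Y')) + (1 / p') ^ 2 * p' ^ 2 = _
        field_simp
        ring
      have hYY : ‖Y - Y'‖ ^ 2 = (p - p') ^ 2 + p * p' * ‖v‖ ^ 2 := by
        rw [hvn, norm_sub_sq_real]
        change p ^ 2 - 2 * inner ℝ Y Y' + p' ^ 2 = _
        field_simp
        ring
      have hp1 : p ≤ 1 := (sq_le_one_iff₀ hp0.le).1 (by linarith [sq_nonneg a])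
      have hp'1 : p' ≤ 1 := (sq_le_one_iff₀ hp'0.le).1 (by linarith [sq_nonneg a'])
      have hpp : p * p' ≤ 1 := mul_le_one₀ hp1 hp'0.le hp'1
      have hdp : d * |p - p'| ≤ |a - a'| := by
        have e1 : (p - p') * (p + p') = -((a - a') * (a + a')) := by
          linear_combination hsq - hsq'
        have e2 : |p - p'| * (p + p') = |a - a'| * |a + a'| := by
          rw [← abs_of_pos (show 0 < p + p' by linarith), ← abs_mul, ← abs_mul, e1, abs_neg]
        have e3 : |a + a'| ≤ 2 := by
          have b1 : |a| ≤ 1 := by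
            rw [← sq_le_one_iff_abs_le_one]; linarith [sq_nonneg p]
          have b2 : |a'| ≤ 1 := by
            rw [← sq_le_one_iff_abs_le_one]; linarith [sq_nonneg p']
          exact (abs_add_le _ _).trans (by linarith)
        have e4 : |p - p'| * (2 * d) ≤ |p - p'| * (p + p') := by gcongr; linarith
        have e5 : |a - a'| * |a + a'| ≤ |a - a'| * 2 := by gcongr
        linarith
      refine abs_le_of_sq_le_sq' ?_ (by positivity) |>.2
      rw [mul_pow, Real.sq_sqrt (by norm_num)]
      set t := ‖x - x'‖ with ht
      have g1 : (a - a') ^ 2 ≤ (d / 10 * t) ^ 2 := by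
        rw [← sq_abs (a - a')]; gcongr
      have g2 : (p - p') ^ 2 ≤ (1 / 10 * t) ^ 2 := by
        rw [← sq_abs (p - p')]
        gcongr
        have : d * |p - p'| ≤ d * (1 / 10 * t) := by linarith
        exact le_of_mul_le_mul_left this hd0
      have g3 : (d / 10 * t) ^ 2 ≤ (1 / 10 * t) ^ 2 := by
        gcongr
      have g4 : p * p' * ‖v‖ ^ 2 ≤ 1 * ‖v‖ ^ 2 := by gcongr
      nlinarith
    refine (area_le_of_expanding (Real.sqrt_nonneg _) hexp).trans ?_
    rw [Real.sq_sqrt (by norm_num), ENNReal.ofReal_mul (by norm_num)]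
    gcongr
    refine le_trans (measure_mono ?_) (area_equator_le hn)
    rintro _ ⟨x, hx, rfl⟩
    have hp0 : 0 < ‖x - (inner ℝ x n) • n‖ := lt_of_lt_of_le hd0 hx.2
    constructor
    · simp only [hw]
      rw [norm_smul, Real.norm_eq_abs, abs_of_pos (by positivity)]
      field_simp
    · simp only [hw]
      rw [inner_smul_left, inner_sub_left, inner_smul_left, real_inner_self_eq_norm_sq, hn]
      simp
  calc μHE[2] X ≤ μHE[2] (X₀ ∪ (X ∩ closedBall n δ ∪ X ∩ closedBall (-n) δ)) :=
        measure_mono hsplit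
    _ ≤ μHE[2] X₀ + (μHE[2] (X ∩ closedBall n δ) + μHE[2] (X ∩ closedBall (-n) δ)) :=
        (measure_union_le _ _).trans (by gcongr; exact measure_union_le _ _)
    _ ≤ ENNReal.ofReal (49 / 48 * (4 * Real.pi)) +
        (ENNReal.ofReal (1 / 4) + ENNReal.ofReal (1 / 4)) := by
        gcongr
        · exact hpole n
        · exact hpole (-n)
    _ ≤ ENNReal.ofReal (5 * Real.pi) := by
        rw [← ENNReal.ofReal_add (by norm_num) (by norm_num),
          ← ENNReal.ofReal_add (by positivity) (by norm_num)]
        apply ENNReal.ofReal_le_ofReal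
        linarith [Real.pi_gt_three]

/-! ### The conformal maps `F_v` -/

section Conf

variable {v x x' : E 4}

theorem one_sub_norm_le_norm_sub (hx : ‖x‖ = 1) : 1 - ‖v‖ ≤ ‖x - v‖ := by
  have := norm_sub_norm_le x v
  rwa [hx] at this

theorem norm_sub_pos_of_unit (hv : ‖v‖ < 1) (hx : ‖x‖ = 1) : 0 < ‖x - v‖ := by
  have := one_sub_norm_le_norm_sub (v := v) hx
  linarith

theorem one_sub_norm_sq_pos (hv : ‖v‖ < 1) : 0 < 1 - ‖v‖ ^ 2 := by
  nlinarith [norm_nonneg v]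

theorem conf_add_self (v x : E 4) :
    conf v x + v = ((1 - ‖v‖ ^ 2) / ‖x - v‖ ^ 2) • (x - v) := by
  rw [conf, sub_add_cancel]

theorem norm_conf_add_self (hv : ‖v‖ < 1) (hx : ‖x‖ = 1) :
    ‖conf v x + v‖ = (1 - ‖v‖ ^ 2) / ‖x - v‖ := by
  have h := norm_sub_pos_of_unit hv hx
  have hq := one_sub_norm_sq_pos hv
  rw [conf_add_self, norm_smul, Real.norm_eq_abs, abs_of_nonneg (by positivity)]
  field_simp

theorem norm_conf (hv : ‖v‖ < 1) (hx : ‖x‖ = 1) : ‖conf v x‖ = 1 := by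
  have h := norm_sub_pos_of_unit hv hx
  have hq := one_sub_norm_sq_pos hv
  have h1 : ‖x - v‖ ^ 2 = 1 - 2 * inner ℝ x v + ‖v‖ ^ 2 := by
    rw [norm_sub_sq_real, hx]; ring
  have h2 : inner ℝ (x - v) v = inner ℝ x v - ‖v‖ ^ 2 := by
    rw [inner_sub_left, real_inner_self_eq_norm_sq]
  have : ‖conf v x‖ ^ 2 = 1 := by
    rw [conf, norm_sub_sq_real, norm_smul, inner_smul_left, h2]
    simp only [Real.norm_eq_abs, mul_pow, sq_abs, conj_trivial, div_pow]
    field_simp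
    rw [h1]
    ring
  exact (pow_eq_one_iff_of_nonneg (norm_nonneg _) two_ne_zero).1 this

/-- Up to a translation `conf v` is an inversion centred at `v`, so this is an exact chord formula.
It replaces differential calculus in all later area estimates. -/
theorem norm_conf_sub (hv : ‖v‖ < 1) (hx : ‖x‖ = 1) (hx' : ‖x'‖ = 1) :
    ‖conf v x - conf v x'‖ = (1 - ‖v‖ ^ 2) * ‖x - x'‖ / (‖x - v‖ * ‖x' - v‖) := by
  have h := norm_sub_pos_of_unit hv hx
  have h' := norm_sub_pos_of_unit hv hx'
  have hq := one_sub_norm_sq_pos hv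
  have e : conf v x - conf v x' = (1 - ‖v‖ ^ 2) •
      ((1 / ‖x - v‖ ^ 2) • (x - v) - (1 / ‖x' - v‖ ^ 2) • (x' - v)) := by
    rw [conf, conf, sub_sub_sub_cancel_right, smul_sub (1 - ‖v‖ ^ 2), smul_smul, smul_smul,
      mul_one_div, mul_one_div]
  rw [e, norm_smul, norm_inversion_sub (norm_pos_iff.1 h) (norm_pos_iff.1 h'),
    sub_sub_sub_cancel_right, Real.norm_eq_abs, abs_of_pos hq]
  ring

theorem conf_neg_conf (hv : ‖v‖ < 1) (hx : ‖x‖ = 1) : conf (-v) (conf v x) = x := by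
  have h := norm_sub_pos_of_unit hv hx
  have hq := one_sub_norm_sq_pos hv
  rw [conf, norm_neg, sub_neg_eq_add, sub_neg_eq_add, norm_conf_add_self hv hx, conf_add_self,
    smul_smul]
  have : (1 - ‖v‖ ^ 2) / ((1 - ‖v‖ ^ 2) / ‖x - v‖) ^ 2 * ((1 - ‖v‖ ^ 2) / ‖x - v‖ ^ 2) = 1 := by
    field_simp
  rw [this, one_smul, sub_add_cancel]

theorem conf_conf_neg (hv : ‖v‖ < 1) (hx : ‖x‖ = 1) : conf v (conf (-v) x) = x := by
  have := conf_neg_conf (v := -v) (by rwa [norm_neg]) hx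
  rwa [neg_neg] at this

theorem continuousOn_conf (hv : ‖v‖ < 1) : ContinuousOn (conf v) S3 := by
  have : ∀ x ∈ S3, ‖x - v‖ ^ 2 ≠ 0 := fun x hx =>
    (pow_pos (norm_sub_pos_of_unit hv (by simpa using hx)) 2).ne'
  unfold conf
  fun_prop (disch := assumption)

/-- The unit normal `m` at `x` transported by the differential of `F_v`. -/
noncomputable def confNormal (v x m : E 4) : E 4 := m - (2 * inner ℝ (x - v) m / ‖x - v‖ ^ 2) • (x - v)

theorem norm_confNormal {m : E 4} (hv : ‖v‖ < 1) (hx : ‖x‖ = 1) (hm : ‖m‖ = 1) :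
    ‖confNormal v x m‖ = 1 := by
  have h := norm_sub_pos_of_unit hv hx
  have : ‖confNormal v x m‖ ^ 2 = 1 := by
    rw [confNormal, norm_sub_sq_real, norm_smul, inner_smul_right, hm, real_inner_comm]
    simp only [Real.norm_eq_abs, mul_pow, sq_abs, div_pow]
    field_simp
    ring
  exact (pow_eq_one_iff_of_nonneg (norm_nonneg _) two_ne_zero).1 this

theorem inner_confNormal_conf {m : E 4} (hv : ‖v‖ < 1) (hx : ‖x‖ = 1) (hxm : inner ℝ x m = 0) :
    inner ℝ (conf v x) (confNormal v x m) = 0 := by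
  have h := norm_sub_pos_of_unit hv hx
  have h1 : ‖x - v‖ ^ 2 = 1 - 2 * inner ℝ x v + ‖v‖ ^ 2 := by
    rw [norm_sub_sq_real, hx]; ring
  have h2 : inner ℝ (x - v) (x - v) = ‖x - v‖ ^ 2 := real_inner_self_eq_norm_sq _
  have h3 : inner ℝ v (x - v) = inner ℝ x v - ‖v‖ ^ 2 := by
    rw [inner_sub_right, real_inner_self_eq_norm_sq, real_inner_comm]
  have h4 : inner ℝ (x - v) m = - inner ℝ v m := by rw [inner_sub_left, hxm]; ring
  rw [conf, confNormal, inner_sub_left, inner_sub_right, inner_sub_right, inner_smul_left,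
    inner_smul_left, inner_smul_right, inner_smul_right, h2, h3, h4]
  simp only [conj_trivial]
  field_simp
  rw [h1]
  ring

/-- Heights over the hyperplane with normal `m` are multiplied by a conformal factor, up to a
quadratic term coming from the curvature of the image of that hyperplane. At scales small against
the scale of the map the quadratic term is an error. -/
theorem inner_conf_sub_confNormal {m : E 4} (hv : ‖v‖ < 1) (hx : ‖x‖ = 1) (hx' : ‖x'‖ = 1) :
    inner ℝ (conf v x' - conf v x) (confNormal v x m) =
      (1 - ‖v‖ ^ 2) * inner ℝ (x' - x) m / ‖x' - v‖ ^ 2 +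
      inner ℝ (x - v) m / (1 - ‖v‖ ^ 2) * ‖conf v x' - conf v x‖ ^ 2 := by
  have h := norm_sub_pos_of_unit hv hx
  have h' := norm_sub_pos_of_unit hv hx'
  have hq := one_sub_norm_sq_pos hv
  rw [norm_conf_sub hv hx' hx, confNormal]
  have e : conf v x' - conf v x = ((1 - ‖v‖ ^ 2) / ‖x' - v‖ ^ 2) • (x' - v) -
      ((1 - ‖v‖ ^ 2) / ‖x - v‖ ^ 2) • (x - v) := by
    rw [conf, conf, sub_sub_sub_cancel_right]
  have e1 : x' - x = (x' - v) - (x - v) := by abel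
  rw [e, e1]
  clear e e1
  generalize x - v = p at *
  generalize x' - v = p' at *
  have hd : ‖p' - p‖ ^ 2 = ‖p'‖ ^ 2 - 2 * inner ℝ p' p + ‖p‖ ^ 2 := norm_sub_sq_real _ _
  rw [inner_sub_left, inner_sub_right, inner_sub_right, inner_smul_left, inner_smul_left,
    inner_smul_left, inner_smul_left, inner_smul_right, inner_smul_right, inner_sub_left,
    real_inner_self_eq_norm_sq]
  simp only [conj_trivial]
  rw [div_pow, mul_pow, hd]
  field_simp
  ring

/-- `F_v` maps the hyperplane section through `x` with normal `m` to a hyperplane section. -/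
theorem inner_conf_normal {m : E 4} (hv : ‖v‖ < 1) (hx' : ‖x'‖ = 1) (hxm : inner ℝ x m = 0) :
    inner ℝ (conf v x') ((1 - ‖v‖ ^ 2) • m - (2 * inner ℝ (x - v) m) • v) =
      2 * inner ℝ (x - v) m + inner ℝ x' m * ‖conf v x' + v‖ ^ 2 := by
  have h' := norm_sub_pos_of_unit hv hx'
  have hq := one_sub_norm_sq_pos hv
  rw [norm_conf_add_self hv hx']
  have h1 : ‖x' - v‖ ^ 2 = 1 - 2 * inner ℝ x' v + ‖v‖ ^ 2 := by
    rw [norm_sub_sq_real, hx']; ring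
  have h4 : inner ℝ (x - v) m = - inner ℝ v m := by rw [inner_sub_left, hxm]; ring
  rw [h4, conf, inner_sub_left, inner_sub_right, inner_sub_right, inner_smul_left, inner_smul_left,
    inner_smul_right, inner_smul_right, inner_smul_right, inner_smul_right, inner_sub_left,
    inner_sub_left, real_inner_self_eq_norm_sq, div_pow]
  simp only [conj_trivial]
  field_simp
  rw [h1]
  ring

theorem norm_sq_conf_normal {m : E 4} (hm : ‖m‖ = 1) (hxm : inner ℝ x m = 0) :
    ‖(1 - ‖v‖ ^ 2) • m - (2 * inner ℝ (x - v) m) • v‖ ^ 2 =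
      (1 - ‖v‖ ^ 2) ^ 2 + 4 * (inner ℝ (x - v) m) ^ 2 := by
  have h4 : inner ℝ (x - v) m = - inner ℝ v m := by rw [inner_sub_left, hxm]; ring
  rw [norm_sub_sq_real, norm_smul, norm_smul, inner_smul_left, inner_smul_right, hm, h4,
    real_inner_comm]
  simp only [Real.norm_eq_abs, mul_pow, sq_abs, conj_trivial]
  ring

end Conf

/-! ### Flatness of regular surfaces -/

/-- Near `x` at scale `r`, `S` is `ε r`-close, in both directions, to the great sphere with unit
normal `m`. -/
structure FlatAt (S : Set (E 4)) (x : E 4) (r ε : ℝ) (m : E 4) : Prop where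
  norm_normal : ‖m‖ = 1
  inner_normal : inner ℝ x m = 0
  flat : ∀ w ∈ S, ‖w - x‖ < r → |inner ℝ w m| ≤ ε * r
  dense : ∀ z : E 4, ‖z‖ = 1 → ‖z - x‖ < r → ∃ w ∈ S, ‖w - z‖ ≤ |inner ℝ z m| + ε * r

/-- The points on the `m`-side of `S` near `x` lie in `A`, those on the other side do not. -/
def Splits (A : Set (E 4)) (x : E 4) (r ε : ℝ) (m : E 4) : Prop :=
  (∀ z : E 4, ‖z‖ = 1 → ‖z - x‖ < r → ε * r < inner ℝ z m → z ∈ A) ∧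
  (∀ z : E 4, ‖z‖ = 1 → ‖z - x‖ < r → inner ℝ z m < -(ε * r) → z ∉ A)

theorem IsRegularParam.mono {n : ℕ} {S : Set (E n)} {γ γ' r : ℝ} {x : E n}
    {σ : E 2 →ᵃⁱ[ℝ] E n} {φ : E 2 → E n} (h : IsRegularParam S γ r x σ φ) (hγ : γ ≤ γ')
    (hr : 0 < r) : IsRegularParam S γ' r x σ φ where
  center_plane := h.center_plane
  center := h.center
  conformal := h.conformal
  subset_image := h.subset_image
  image_subset := h.image_subset.trans (inter_subset_inter_right _ (ball_subset_ball (by gcongr)))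
  close := fun τ hτ => (h.close τ hτ).trans (by gcongr)
  lower := fun τ₁ h₁ τ₂ h₂ => le_trans (by gcongr) (h.lower τ₁ h₁ τ₂ h₂)
  upper := fun τ₁ h₁ τ₂ h₂ => (h.upper τ₁ h₁ τ₂ h₂).trans (by gcongr)

theorem IsRegular.mono {n : ℕ} {S : Set (E n)} {γ γ' r₀ : ℝ} (h : IsRegular γ r₀ S)
    (hγ : γ ≤ γ') : IsRegular γ' r₀ S := fun x hx r hr hr' => by
  obtain ⟨σ, φ, hφ⟩ := h x hx r hr hr'
  exact ⟨σ, φ, hφ.mono hγ hr⟩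

theorem AffineIsometry.apply_eq_add {n : ℕ} (σ : E 2 →ᵃⁱ[ℝ] E n) (τ : E 2) :
    σ τ = σ 0 + σ.linearIsometry τ := by
  have := σ.map_vadd 0 τ
  simp only [vadd_eq_add, add_zero] at this
  rw [this, add_comm]

/-- The normal is a unit vector orthogonal to both the parametrizing plane and `x`. Since `φ` stays
on the sphere, the plane is almost tangent to it, so the remaining orthogonal direction `e` is close
to radial and displacements along it are controlled by the equation of the sphere. The hypothesis `r
≤ γ` turns quadratic sphere errors `r²` into `γ r`. -/
theorem IsRegularParam.exists_flatAt {S : Set (E 4)} (hS : S ⊆ S3) {γ r : ℝ} {x : E 4}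
    {σ : E 2 →ᵃⁱ[ℝ] E 4} {φ : E 2 → E 4} (h : IsRegularParam S γ r x σ φ) (hx : ‖x‖ = 1)
    (hr : 0 < r) (hrγ : r ≤ γ) (hγ : γ ≤ 1 / 100) :
    ∃ m, FlatAt S x r (20 * γ) m := by
  have hγ0 : 0 < γ := lt_of_lt_of_le hr hrγ
  set L := σ.linearIsometry with hL
  have hσ : ∀ τ, σ τ = x + L τ := fun τ => by
    rw [AffineIsometry.apply_eq_add, h.center_plane]
  set a₀ := L (EuclideanSpace.single 0 1) with ha₀
  set a₁ := L (EuclideanSpace.single 1 1) with ha₁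
  have hLτ : ∀ τ : E 2, L τ = τ 0 • a₀ + τ 1 • a₁ := by
    intro τ
    have : τ = τ 0 • EuclideanSpace.single 0 (1 : ℝ) + τ 1 • EuclideanSpace.single 1 (1 : ℝ) := by
      ext i
      fin_cases i <;> simp
    conv_lhs => rw [this]
    rw [map_add, map_smul, map_smul]
  have hn0 : ‖a₀‖ = 1 := by rw [ha₀, L.norm_map]; simp
  have hn1 : ‖a₁‖ = 1 := by rw [ha₁, L.norm_map]; simp
  have h01 : inner ℝ a₀ a₁ = 0 := by
    rw [ha₀, ha₁, L.inner_map_map, EuclideanSpace.inner_single_left]; simp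
  obtain ⟨m, hm, hm0, hm1, hmx⟩ := exists_unit_orthogonal a₀ a₁ x
  obtain ⟨e, he, he0, he1, hem⟩ := exists_unit_orthogonal a₀ a₁ m
  have hort : Orthonormal ℝ ![a₀, a₁, m, e] := by
    rw [orthonormal_iff_ite]
    intro i j
    fin_cases i <;> fin_cases j <;>
      simp [hn0, hn1, hm, he, h01, hm0, hm1, he0, he1, hem, real_inner_comm]
    all_goals first
      | exact (real_inner_comm _ _).trans h01
      | exact (real_inner_comm _ _).trans hm0
      | exact (real_inner_comm _ _).trans hm1
      | exact (real_inner_comm _ _).trans he0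
      | exact (real_inner_comm _ _).trans he1
      | exact (real_inner_comm _ _).trans hem
  obtain ⟨B, hB⟩ := Orthonormal.exists_orthonormalBasis_extension_of_card_eq (ι := Fin 4)
    (𝕜 := ℝ) (E := E 4) (by simp) (v := ![a₀, a₁, m, e]) (s := univ)
    (by
      exact hort.comp _ Subtype.val_injective)
  have hexp : ∀ w : E 4, w = inner ℝ w a₀ • a₀ + inner ℝ w a₁ • a₁ + inner ℝ w m • m +
      inner ℝ w e • e := by
    intro w
    have := (B.sum_repr w).symm
    simp only [Fin.sum_univ_four, B.repr_apply_apply, hB _ (mem_univ _)] at this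
    simpa [real_inner_comm] using this
  have hmL : ∀ τ, inner ℝ (L τ) m = 0 := by
    intro τ
    rw [hLτ, inner_add_left, inner_smul_left, inner_smul_left, real_inner_comm, hm0,
      real_inner_comm, hm1]; simp
  have hxm : inner ℝ x m = 0 := by rw [real_inner_comm, hmx]
  have hφS : ∀ τ ∈ ball (0 : E 2) r, φ τ ∈ S ∧ ‖φ τ - x‖ ≤ 2 * r := by
    intro τ hτ
    have := h.image_subset ⟨τ, hτ, rfl⟩
    refine ⟨this.1, ?_⟩
    have h2 := this.2
    rw [mem_ball, dist_eq_norm] at h2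
    nlinarith
  -- the tangential plane is almost orthogonal to `x`
  set u : E 2 := !₂[inner ℝ x a₀, inner ℝ x a₁] with hu
  have hxu : x = L u + inner ℝ x e • e := by
    have := hexp x
    rw [hxm, zero_smul, add_zero] at this
    rw [hLτ]
    simpa [hu] using this
  have heL : ∀ τ, inner ℝ e (L τ) = 0 := by
    intro τ
    rw [hLτ, inner_add_right, inner_smul_right, inner_smul_right, he0, he1]; simp
  have hLe : ∀ τ, inner ℝ (L τ) e = 0 := fun τ => by rw [real_inner_comm, heL]
  have hinner : ∀ τ, inner ℝ (L τ) x = inner ℝ τ u := by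
    intro τ
    rw [hxu, inner_add_right, inner_smul_right, hLe, L.inner_map_map]; simp
  have hsmall : ∀ τ ∈ ball (0 : E 2) r, |inner ℝ τ u| ≤ 3 * γ * r := by
    intro τ hτ
    obtain ⟨h1, h2⟩ := hφS τ hτ
    have h3 : ‖φ τ‖ = 1 := by simpa using hS h1
    have h4 := inner_sub_self_of_unit hx h3
    have h5 : inner ℝ τ u = inner ℝ (φ τ - x) x - inner ℝ (φ τ - σ τ) x := by
      rw [← hinner, hσ, ← inner_sub_left]; congr 1; abel
    have h6 := abs_real_inner_le_norm (φ τ - σ τ) x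
    rw [hx, mul_one] at h6
    have h7 := h.close τ hτ
    rw [h5, h4]
    have h8 : ‖φ τ - x‖ ^ 2 ≤ (2 * r) ^ 2 := by gcongr
    have h9 : r * r ≤ γ * r := by gcongr
    rw [abs_le] at h6 ⊢
    constructor <;> nlinarith [sq_nonneg ‖φ τ - x‖, h6.1, h6.2]
  have hu6 : ‖u‖ ≤ 6 * γ := by
    rcases eq_or_ne u 0 with h0 | h0
    · rw [h0, norm_zero]; positivity
    have hu0 : 0 < ‖u‖ := norm_pos_iff.2 h0
    have := hsmall ((r / (2 * ‖u‖)) • u) (by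
      rw [mem_ball, dist_zero_right, norm_smul, Real.norm_eq_abs, abs_of_pos (by positivity)]
      field_simp
      linarith)
    rw [inner_smul_left, real_inner_self_eq_norm_sq] at this
    simp only [conj_trivial] at this
    have e1 : r / (2 * ‖u‖) * ‖u‖ ^ 2 = r * ‖u‖ / 2 := by field_simp
    rw [e1, abs_of_pos (by positivity)] at this
    nlinarith
  have hxe : 1 / 2 ≤ |inner ℝ x e| := by
    have h1 : ‖x‖ ≤ ‖L u‖ + ‖inner ℝ x e • e‖ := by
      conv_lhs => rw [hxu]
      exact norm_add_le _ _
    rw [hx, L.norm_map, norm_smul, he, mul_one, Real.norm_eq_abs] at h1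
    linarith
  refine ⟨m, hm, hxm, ?_, ?_⟩
  · intro w hw hwr
    obtain ⟨τ, hτ, rfl⟩ := h.subset_image ⟨hw, by rwa [mem_ball, dist_eq_norm]⟩
    have e1 : inner ℝ (φ τ) m = inner ℝ (φ τ - σ τ) m := by
      rw [inner_sub_left, hσ, inner_add_left, hxm, hmL]; ring
    rw [e1]
    have h1 := abs_real_inner_le_norm (φ τ - σ τ) m
    rw [hm, mul_one] at h1
    have := h.close τ hτ
    have : 0 ≤ γ * r := by positivity
    linarith
  · intro z hz hzr
    set ξ := z - x with hξ
    set τ : E 2 := !₂[inner ℝ ξ a₀, inner ℝ ξ a₁] with hτ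
    have hξm : inner ℝ ξ m = inner ℝ z m := by rw [hξ, inner_sub_left, hxm, sub_zero]
    have hξd : ξ = L τ + inner ℝ z m • m + inner ℝ ξ e • e := by
      have := hexp ξ
      rw [hξm] at this
      rw [hLτ]
      simpa [hτ] using this
    have hτr : ‖τ‖ ≤ ‖ξ‖ := by
      rw [← L.norm_map]
      have h1 : inner ℝ (L τ) ξ = ‖L τ‖ ^ 2 := by
        conv_lhs => rw [hξd]
        rw [inner_add_right, inner_add_right, inner_smul_right, inner_smul_right, hmL,
          hLe, real_inner_self_eq_norm_sq]; ring
      have h2 := real_inner_le_norm (L τ) ξ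
      rw [h1, sq] at h2
      rcases (norm_nonneg (L τ)).eq_or_lt with h3 | h3
      · rw [← h3]; positivity
      · exact le_of_mul_le_mul_left h2 h3
    have hτb : τ ∈ ball (0 : E 2) r := by
      rw [mem_ball, dist_zero_right]; linarith
    -- Both `z` and `x` are unit vectors, so `ξ` is orthogonal to `x` up to `r² / 2`; dividing by
    -- `⟨x, e⟩ ≥ 1/2` isolates the `e`-component.
    have hξe : |inner ℝ ξ e| ≤ 9 * γ * r * (3 / 2) := by
      have h1 : inner ℝ ξ x = inner ℝ τ u + inner ℝ ξ e * inner ℝ x e := by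
        have e1 : inner ℝ m x = 0 := hmx
        conv_lhs => rw [hξd]
        rw [inner_add_left, inner_add_left, inner_smul_left, inner_smul_left, hinner, e1,
          real_inner_comm x e]
        simp
      rw [inner_sub_self_of_unit hx hz] at h1
      have h2 : |inner ℝ ξ e| * |inner ℝ x e| ≤ r ^ 2 / 2 + r * (6 * γ) := by
        rw [← abs_mul]
        have h3 : inner ℝ ξ e * inner ℝ x e = -(‖ξ‖ ^ 2 / 2) - inner ℝ τ u := by linarith
        have h4 : |inner ℝ τ u| ≤ r * (6 * γ) :=
          (abs_real_inner_le_norm τ u).trans (by gcongr; linarith)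
        have h5 : ‖ξ‖ ^ 2 ≤ r ^ 2 := by gcongr
        rw [h3]
        rw [abs_le] at h4 ⊢
        constructor <;> linarith [h4.1, h4.2, sq_nonneg ‖ξ‖]
      have h6 : |inner ℝ ξ e| * (1 / 2) ≤ |inner ℝ ξ e| * |inner ℝ x e| := by gcongr
      have h7 : r ^ 2 ≤ γ * r := by rw [sq]; gcongr
      nlinarith
    refine ⟨φ τ, (hφS τ hτb).1, ?_⟩
    have e1 : φ τ - z = (φ τ - σ τ) - (inner ℝ z m • m + inner ℝ ξ e • e) := by
      have hz' : z = x + (L τ + inner ℝ z m • m + inner ℝ ξ e • e) := by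
        rw [← hξd, hξ]; abel
      calc φ τ - z = φ τ - (x + (L τ + inner ℝ z m • m + inner ℝ ξ e • e)) := by rw [← hz']
        _ = _ := by rw [hσ]; abel
    have h1 : ‖inner ℝ z m • m + inner ℝ ξ e • e‖ ≤ |inner ℝ z m| + |inner ℝ ξ e| := by
      refine (norm_add_le _ _).trans ?_
      rw [norm_smul, norm_smul, hm, he, Real.norm_eq_abs, Real.norm_eq_abs, mul_one, mul_one]
    have h2 := h.close τ hτb
    have h3 : 0 ≤ γ * r := by positivity
    rw [e1]
    refine (norm_sub_le _ _).trans ?_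
    linarith

/-! ### The two sides of a flat surface -/

/-- Caps of the sphere cut by an orthogonal half-space are connected. -/
theorem isPreconnected_cap {x m : E 4} {r β : ℝ} (hx : ‖x‖ = 1) (hr : 0 < r) (hr1 : r ≤ 1)
    (hβ : 0 < β) : IsPreconnected {z : E 4 | ‖z‖ = 1 ∧ ‖z - x‖ < r ∧ β < inner ℝ z m} := by
  set α := 1 - r ^ 2 / 2 with hα
  have hα0 : 0 < α := by rw [hα]; nlinarith
  -- The cap is the radial image of a convex cone: both constraints become convex after
  -- homogenization because `α` and `β` are positive.
  set K : Set (E 4) := {z | α * ‖z‖ - inner ℝ z x < 0} ∩ {z | β * ‖z‖ - inner ℝ z m < 0} with hK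
  have hconv : ∀ (a : ℝ) (w : E 4), 0 < a → Convex ℝ {z : E 4 | a * ‖z‖ - inner ℝ z w < 0} := by
    intro a w ha
    have h1 : ConvexOn ℝ univ (fun z : E 4 => a * ‖z‖ - inner ℝ z w) := by
      refine ConvexOn.sub ?_ ?_
      · exact (convexOn_norm convex_univ).smul ha.le
      · refine ⟨convex_univ, fun y _ z _ s t _ _ _ => ?_⟩
        simp [inner_add_left, inner_smul_left]
    simpa using h1.convex_lt 0
  have hKc : IsPreconnected K := ((hconv α x hα0).inter (hconv β m hβ)).isPreconnected
  have hK0 : ∀ z ∈ K, ‖z‖ ≠ 0 := by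
    intro z hz h0
    have := hz.1
    rw [norm_eq_zero] at h0
    simp [h0] at this
  have himg : {z : E 4 | ‖z‖ = 1 ∧ ‖z - x‖ < r ∧ β < inner ℝ z m} =
      (fun z : E 4 => (1 / ‖z‖) • z) '' K := by
    have hiff : ∀ z : E 4, ‖z‖ = 1 → (‖z - x‖ < r ↔ α < inner ℝ z x) := by
      intro z hz
      rw [← sq_lt_sq₀ (norm_nonneg _) hr.le, norm_sub_sq_of_unit hz hx, hα]
      constructor <;> intro h <;> linarith
    ext z
    constructor
    · rintro ⟨h1, h2, h3⟩
      refine ⟨z, ⟨?_, ?_⟩, by simp [h1]⟩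
      · have := (hiff z h1).1 h2
        simp only [mem_ofPred_eq, h1, mul_one]
        linarith
      · simp only [mem_ofPred_eq, h1, mul_one]
        linarith
    · rintro ⟨z, hz, rfl⟩
      have h0 := hK0 z hz
      have hp : 0 < ‖z‖ := lt_of_le_of_ne (norm_nonneg _) h0.symm
      have hn : ‖(1 / ‖z‖) • z‖ = 1 := by
        rw [norm_smul]; simp [h0]
      have h1 : α * ‖z‖ - inner ℝ z x < 0 := hz.1
      have h2 : β * ‖z‖ - inner ℝ z m < 0 := hz.2
      refine ⟨hn, (hiff _ hn).2 ?_, ?_⟩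
      · rw [inner_smul_left]
        simp only [conj_trivial]
        rw [div_mul_eq_mul_div, one_mul, lt_div_iff₀ hp]
        linarith
      · rw [inner_smul_left]
        simp only [conj_trivial]
        rw [div_mul_eq_mul_div, one_mul, lt_div_iff₀ hp]
        linarith
  rw [himg]
  refine hKc.image _ ?_
  fun_prop (disch := exact hK0)

theorem subset_side_or_disjoint {S A U : Set (E 4)} (hA : IsSide S A) (hU : IsPreconnected U)
    (hUS : U ⊆ S3 \ S) : U ⊆ A ∨ Disjoint U A := by
  obtain ⟨x₀, hx₀, rfl⟩ := hA
  rw [or_iff_not_imp_right, not_disjoint_iff]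
  rintro ⟨y, hyU, hyA⟩
  rw [connectedComponentIn_eq hyA]
  exact hU.subset_connectedComponentIn hyU hUS

theorem FlatAt.neg {S : Set (E 4)} {x m : E 4} {r ε : ℝ} (h : FlatAt S x r ε m) :
    FlatAt S x r ε (-m) where
  norm_normal := by rw [norm_neg, h.norm_normal]
  inner_normal := by rw [inner_neg_right, h.inner_normal, neg_zero]
  flat := fun w hw hwr => by rw [inner_neg_right, abs_neg]; exact h.flat w hw hwr
  dense := fun z hz hzr => by rw [inner_neg_right, abs_neg]; exact h.dense z hz hzr

/-- If two points on opposite sides of a flat piece are separated by `A`, then so are the sides. -/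
theorem FlatAt.splits_or {S A : Set (E 4)} {x m z z' : E 4} {r ε : ℝ} (h : FlatAt S x r ε m)
    (hx : ‖x‖ = 1) (hA : IsSide S A) (hr : 0 < r) (hr1 : r ≤ 1) (hε : 0 < ε) (hz : ‖z‖ = 1)
    (hz' : ‖z'‖ = 1) (hzx : ‖z - x‖ < r) (hzx' : ‖z' - x‖ < r)
    (hop : (ε * r < inner ℝ z m ∧ inner ℝ z' m < -(ε * r)) ∨
      (inner ℝ z m < -(ε * r) ∧ ε * r < inner ℝ z' m))
    (hzA : z ∈ A) (hzA' : z' ∉ A) : Splits A x r ε m ∨ Splits A x r ε (-m) := by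
  have hβ : 0 < ε * r := by positivity
  have main : ∀ m, FlatAt S x r ε m → ε * r < inner ℝ z m → inner ℝ z' m < -(ε * r) →
      Splits A x r ε m := by
    intro m h h1 h2
    have hcap : ∀ m', FlatAt S x r ε m' →
        {z : E 4 | ‖z‖ = 1 ∧ ‖z - x‖ < r ∧ ε * r < inner ℝ z m'} ⊆ A ∨
        Disjoint {z : E 4 | ‖z‖ = 1 ∧ ‖z - x‖ < r ∧ ε * r < inner ℝ z m'} A := by
      intro m' h'
      refine subset_side_or_disjoint hA (isPreconnected_cap hx hr hr1 hβ) ?_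
      rintro w ⟨hw1, hw2, hw3⟩
      refine ⟨by simpa using hw1, fun hwS => ?_⟩
      have := h'.flat w hwS hw2
      linarith [le_abs_self (inner ℝ w m')]
    constructor
    · intro w hw1 hw2 hw3
      rcases hcap m h with hc | hc
      · exact hc ⟨hw1, hw2, hw3⟩
      · exact absurd hzA (disjoint_left.1 hc ⟨hz, hzx, h1⟩)
    · intro w hw1 hw2 hw3 hwA
      rcases hcap (-m) h.neg with hc | hc
      · exact hzA' (hc ⟨hz', hzx', by rw [inner_neg_right]; linarith⟩)
      · exact disjoint_left.1 hc ⟨hw1, hw2, by rw [inner_neg_right]; linarith⟩ hwA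
  rcases hop with ⟨h1, h2⟩ | ⟨h1, h2⟩
  · exact Or.inl (main m h h1 h2)
  · exact Or.inr (main (-m) h.neg (by rw [inner_neg_right]; linarith)
      (by rw [inner_neg_right]; linarith))

/-- Points of the sphere near `x` in a prescribed tangential direction. -/
theorem exists_unit_near {x : E 4} (hx : ‖x‖ = 1) {s : ℝ} (hs : 0 ≤ s) (hs1 : s ≤ 1 / 2) :
    ∃ k : ℝ, ∀ e : E 4, ‖e‖ = 1 → inner ℝ x e = 0 →
      ‖k • x + s • e‖ = 1 ∧ ‖k • x + s • e - x‖ ≤ 3 / 2 * s ∧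
      ∀ g : E 4, inner ℝ x g = 0 → inner ℝ (k • x + s • e) g = s * inner ℝ e g := by
  have hs2 : s ^ 2 ≤ 1 / 4 := by nlinarith
  set k := √(1 - s ^ 2) with hk
  have hk2 : k ^ 2 = 1 - s ^ 2 := Real.sq_sqrt (by linarith)
  have hk0 : 0 ≤ k := Real.sqrt_nonneg _
  refine ⟨k, fun e he hxe => ?_⟩
  have h1 : ‖k • x + s • e‖ = 1 := by
    have : ‖k • x + s • e‖ ^ 2 = 1 := by
      rw [norm_add_sq_real, norm_smul, norm_smul, inner_smul_left, inner_smul_right, hxe, hx, he]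
      simp only [Real.norm_eq_abs, mul_one, sq_abs]
      linarith
    exact (pow_eq_one_iff_of_nonneg (norm_nonneg _) two_ne_zero).1 this
  refine ⟨h1, ?_, ?_⟩
  · refine abs_le_of_sq_le_sq' ?_ (by positivity) |>.2
    rw [norm_sub_sq_of_unit h1 hx, inner_add_left, inner_smul_left, inner_smul_left,
      real_inner_self_eq_norm_sq, hx, real_inner_comm, hxe]
    simp only [conj_trivial]
    nlinarith
  · intro g hg
    rw [inner_add_left, inner_smul_left, inner_smul_left, hg]; simp

/-- Two unit vectors orthogonal to `x` are almost parallel if everything orthogonal to one of them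
is almost orthogonal to the other. -/
theorem one_sub_sq_le_inner_sq {x m m' : E 4} {κ : ℝ} (hm : ‖m‖ = 1) (hm' : ‖m'‖ = 1)
    (hxm : inner ℝ x m = 0) (hxm' : inner ℝ x m' = 0)
    (h : ∀ e : E 4, ‖e‖ = 1 → inner ℝ x e = 0 → inner ℝ e m' = 0 → |inner ℝ e m| ≤ κ) :
    1 - κ ^ 2 ≤ (inner ℝ m m') ^ 2 := by
  set c := inner ℝ m m' with hc
  set u := m - c • m' with hu
  have hu2 : ‖u‖ ^ 2 = 1 - c ^ 2 := norm_sub_inner_smul_sq hm hm'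
  rcases eq_or_ne u 0 with h0 | h0
  · rw [h0, norm_zero] at hu2
    nlinarith [sq_nonneg κ]
  have hu0 : 0 < ‖u‖ := norm_pos_iff.2 h0
  have h1 := h ((1 / ‖u‖) • u) (by rw [norm_smul]; simp [hu0.ne'])
    (by rw [inner_smul_right, hu, inner_sub_right, inner_smul_right, hxm, hxm']; simp)
    (by
      rw [inner_smul_left, hu, inner_sub_left, inner_smul_left, real_inner_self_eq_norm_sq, hm']
      simp [hc])
  have h2 : inner ℝ u m = ‖u‖ ^ 2 := by
    rw [hu2, hu, inner_sub_left, inner_smul_left, real_inner_self_eq_norm_sq, hm,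
      real_inner_comm m m']
    simp only [conj_trivial, ← hc]
    ring
  rw [inner_smul_left, h2] at h1
  simp only [conj_trivial] at h1
  have e1 : 1 / ‖u‖ * ‖u‖ ^ 2 = ‖u‖ := by field_simp
  rw [e1, abs_of_pos hu0] at h1
  nlinarith

/-- Near `x` the set `A` is the positive side of a regular level set containing `S`. -/
def IsLocalSide (S A : Set (E 4)) (x : E 4) : Prop :=
  ∃ (G : E 4 → ℝ) (g : E 4), ‖g‖ = 1 ∧ inner ℝ x g = 0 ∧ G x = 0 ∧
    HasFDerivAt G (innerSL ℝ g) x ∧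
    ∀ᶠ z in nhds x, ‖z‖ = 1 → (z ∈ S → G z = 0) ∧ (0 < G z → z ∈ A) ∧ (G z < 0 → z ∉ A)

/-- The two sides of a smooth surface at small scales. -/
theorem exists_splits_of_small {S A : Set (E 4)} {x : E 4} {ε : ℝ} (hS : S ⊆ S3) (hx : ‖x‖ = 1)
    (hA : IsSide S A) (hloc : IsLocalSide S A x) (hε : 0 < ε) (hε1 : ε ≤ 1 / 100) :
    ∃ δ : ℝ, 0 < δ ∧ ∀ r m, 0 < r → r < δ → FlatAt S x r ε m →
      Splits A x r ε m ∨ Splits A x r ε (-m) := by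
  obtain ⟨G, g, hg, hxg, hGx, hG, hnear⟩ := hloc
  have hlin := hG.isLittleO.def (c := 1 / 100) (by norm_num)
  obtain ⟨δ, hδ, hball⟩ := Metric.eventually_nhds_iff_ball.1 (hlin.and hnear)
  have hest : ∀ z ∈ ball x δ, |G z - inner ℝ z g| ≤ 1 / 100 * ‖z - x‖ := by
    intro z hz
    have := (hball z hz).1
    rw [hGx, sub_zero, innerSL_apply_apply, inner_sub_right, real_inner_comm, real_inner_comm x g,
      hxg, sub_zero] at this
    exact this
  refine ⟨min (δ / 2) 1, by positivity, ?_⟩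
  intro r m hr hrδ hflat
  have hr1 : r < 1 := hrδ.trans_le (min_le_right _ _)
  have hr2 : r < δ / 2 := hrδ.trans_le (min_le_left _ _)
  obtain ⟨k, hk⟩ := exists_unit_near hx (s := r / 2) (by positivity) (by linarith)
  -- By density `S` has a point near `x` displaced along `e`, and `G` vanishes there, so `g` is
  -- almost orthogonal to `e`. Hence `m` is nearly `±g`, and moving along `±m` changes the sign of
  -- `G`.
  have hpar : ∀ e : E 4, ‖e‖ = 1 → inner ℝ x e = 0 → inner ℝ e m = 0 → |inner ℝ e g| ≤ 1 / 10 := by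
    intro e he hxe hem
    obtain ⟨h1, h2, h3⟩ := hk e he hxe
    set z := k • x + (r / 2) • e
    have hzr : ‖z - x‖ < r := by linarith
    obtain ⟨w, hw, hwz⟩ := hflat.dense z h1 hzr
    rw [h3 m hflat.inner_normal, hem, mul_zero, abs_zero, zero_add] at hwz
    have hwx : ‖w - x‖ ≤ 2 * r := by
      have : w - x = (w - z) + (z - x) := by abel
      rw [this]
      refine (norm_add_le _ _).trans ?_
      nlinarith
    have hwb : w ∈ ball x δ := by rw [mem_ball, dist_eq_norm]; linarith
    have hw0 : G w = 0 := by
      exact ((hball w hwb).2 (by simpa using hS hw)).1 hw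
    have h4 := hest w hwb
    rw [hw0, zero_sub, abs_neg] at h4
    have h5 : inner ℝ z g = inner ℝ w g - inner ℝ (w - z) g := by rw [inner_sub_left]; ring
    have h6 := abs_real_inner_le_norm (w - z) g
    rw [hg, mul_one] at h6
    rw [h3 g hxg] at h5
    have h7 : |r / 2 * inner ℝ e g| ≤ 1 / 50 * r + 1 / 100 * r := by
      rw [h5]
      refine (abs_sub _ _).trans ?_
      nlinarith
    rw [abs_mul, abs_of_pos (by positivity)] at h7
    nlinarith
  have hc2 := one_sub_sq_le_inner_sq hg hflat.norm_normal hxg hflat.inner_normal hpar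
  have hmn := hflat.norm_normal
  have hxm := hflat.inner_normal
  obtain ⟨p1, p2, p3⟩ := hk m hmn hxm
  obtain ⟨q1, q2, q3⟩ := hk (-m) (by rwa [norm_neg]) (by rw [inner_neg_right, hxm, neg_zero])
  have p4 := p3 m hxm
  have q4 := q3 m hxm
  have p5 := p3 g hxg
  have q5 := q3 g hxg
  rw [inner_neg_left, real_inner_self_eq_norm_sq, hmn] at q4
  rw [real_inner_self_eq_norm_sq, hmn] at p4
  rw [inner_neg_left] at q5
  set z := k • x + (r / 2) • m
  set z' := k • x + (r / 2) • -m
  have hzb : z ∈ ball x δ := by rw [mem_ball, dist_eq_norm]; linarith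
  have hzb' : z' ∈ ball x δ := by rw [mem_ball, dist_eq_norm]; linarith
  have p6 := abs_le.1 (hest z hzb)
  have q6 := abs_le.1 (hest z' hzb')
  obtain ⟨-, p7, p8⟩ := (hball z hzb).2 p1
  obtain ⟨-, q7, q8⟩ := (hball z' hzb').2 q1
  rw [real_inner_comm g m] at p5 q5
  set c := inner ℝ g m with hc
  have hcabs : 9 / 10 ≤ |c| := by
    refine abs_le_of_sq_le_sq' ?_ (abs_nonneg c) |>.2
    rw [sq_abs]
    linarith
  have hεr : ε * r ≤ 1 / 100 * r := by gcongr
  rcases le_abs'.1 hcabs with h | h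
  · have hcr : r / 2 * c ≤ r / 2 * (-(9 / 10)) := by gcongr
    refine hflat.splits_or hx hA hr hr1.le hε q1 p1 (by linarith) (by linarith)
      (Or.inr ⟨by rw [q4]; linarith, by rw [p4]; linarith⟩) (q7 ?_) (p8 ?_)
    · linarith [q6.1]
    · linarith [p6.2]
  · have hcr : r / 2 * (9 / 10) ≤ r / 2 * c := by gcongr
    refine hflat.splits_or hx hA hr hr1.le hε p1 q1 (by linarith) (by linarith)
      (Or.inl ⟨by rw [p4]; linarith, by rw [q4]; linarith⟩) (p7 ?_) (q8 ?_)
    · linarith [p6.1]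
    · linarith [q6.2]

/-- Density at scale `r / 2` and flatness at scale `r` force the two normals to be nearly parallel.
Points at distance about `r / 4` along `±m'`, whose sides are known, then lie in the two caps at
scale `r` and transfer the splitting. -/
theorem FlatAt.splits_of_half {S A : Set (E 4)} {x m m' : E 4} {r ε : ℝ}
    (h : FlatAt S x r ε m) (h' : FlatAt S x (r / 2) ε m') (hs : Splits A x (r / 2) ε m')
    (hx : ‖x‖ = 1) (hA : IsSide S A) (hr : 0 < r) (hr1 : r ≤ 1) (hε : 0 < ε) (hε1 : ε ≤ 1 / 100) :
    Splits A x r ε m ∨ Splits A x r ε (-m) := by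
  obtain ⟨k, hk⟩ := exists_unit_near hx (s := r / 4) (by positivity) (by linarith)
  have hxm := h.inner_normal
  have hxm' := h'.inner_normal
  have hmn' := h'.norm_normal
  have hεr : ε * r ≤ 1 / 100 * r := by gcongr
  have hpar : ∀ e : E 4, ‖e‖ = 1 → inner ℝ x e = 0 → inner ℝ e m' = 0 → |inner ℝ e m| ≤ 1 / 10 := by
    intro e he hxe hem
    obtain ⟨h1, h2, h3⟩ := hk e he hxe
    set z := k • x + (r / 4) • e
    obtain ⟨w, hw, hwz⟩ := h'.dense z h1 (by linarith)
    rw [h3 m' hxm', hem, mul_zero, abs_zero, zero_add] at hwz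
    have hwx : ‖w - x‖ < r := by
      have : w - x = (w - z) + (z - x) := by abel
      rw [this]
      refine (norm_add_le _ _).trans_lt ?_
      nlinarith
    have h4 := h.flat w hw hwx
    have h5 : inner ℝ z m = inner ℝ w m - inner ℝ (w - z) m := by rw [inner_sub_left]; ring
    have h6 := abs_real_inner_le_norm (w - z) m
    rw [h.norm_normal, mul_one] at h6
    rw [h3 m hxm] at h5
    have h7 : |r / 4 * inner ℝ e m| ≤ 3 / 200 * r := by
      rw [h5]
      refine (abs_sub _ _).trans ?_
      linarith
    rw [abs_mul, abs_of_pos (by positivity)] at h7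
    nlinarith
  have hc2 := one_sub_sq_le_inner_sq h.norm_normal hmn' hxm hxm' hpar
  obtain ⟨p1, p2, p3⟩ := hk m' hmn' hxm'
  obtain ⟨q1, q2, q3⟩ := hk (-m') (by rwa [norm_neg]) (by rw [inner_neg_right, hxm', neg_zero])
  have p4 := p3 m' hxm'
  have q4 := q3 m' hxm'
  have p5 := p3 m hxm
  have q5 := q3 m hxm
  rw [inner_neg_left, real_inner_self_eq_norm_sq, hmn'] at q4
  rw [real_inner_self_eq_norm_sq, hmn'] at p4
  rw [inner_neg_left] at q5
  set z := k • x + (r / 4) • m'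
  set z' := k • x + (r / 4) • -m'
  have hzA : z ∈ A := hs.1 z p1 (by linarith) (by rw [p4]; linarith)
  have hzA' : z' ∉ A := hs.2 z' q1 (by linarith) (by rw [q4]; linarith)
  rw [real_inner_comm m' m] at hc2
  set c := inner ℝ m' m with hc
  have hcabs : 9 / 10 ≤ |c| := by
    refine abs_le_of_sq_le_sq' ?_ (abs_nonneg c) |>.2
    rw [sq_abs]
    linarith
  refine h.splits_or hx hA hr hr1 hε p1 q1 (by linarith) (by linarith) ?_ hzA hzA'
  rcases le_abs'.1 hcabs with h | h
  · have hcr : r / 4 * c ≤ r / 4 * (-(9 / 10)) := by gcongr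
    exact Or.inr ⟨by rw [p5]; linarith, by rw [q5]; linarith⟩
  · have hcr : r / 4 * (9 / 10) ≤ r / 4 * c := by gcongr
    exact Or.inl ⟨by rw [p5]; linarith, by rw [q5]; linarith⟩

/-- A surface that is flat at all small scales is two-sided at all these scales. -/
theorem exists_flatAt_splits {S A : Set (E 4)} {x : E 4} {ε r₁ : ℝ} (hS : S ⊆ S3) (hx : ‖x‖ = 1)
    (hA : IsSide S A) (hloc : IsLocalSide S A x) (hε : 0 < ε) (hε1 : ε ≤ 1 / 100) (hr₁ : r₁ ≤ 1)
    (hflat : ∀ r, 0 < r → r < r₁ → ∃ m, FlatAt S x r ε m) :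
    ∀ r, 0 < r → r < r₁ → ∃ m, FlatAt S x r ε m ∧ Splits A x r ε m := by
  obtain ⟨δ, hδ, hsmall⟩ := exists_splits_of_small hS hx hA hloc hε hε1
  -- Smoothness gives the splitting only below some `δ` that depends on the surface. Doubling
  -- reaches every scale below `r₁`, so the range does not depend on `δ`.
  have main : ∀ n : ℕ, ∀ r, 0 < r → r < r₁ → r < 2 ^ n * δ →
      ∃ m, FlatAt S x r ε m ∧ Splits A x r ε m := by
    intro n
    induction n with
    | zero =>
      intro r hr hr' hrδ
      obtain ⟨m, hm⟩ := hflat r hr hr'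
      rcases hsmall r m hr (by simpa using hrδ) hm with h | h
      · exact ⟨m, hm, h⟩
      · exact ⟨-m, hm.neg, h⟩
    | succ n ih =>
      intro r hr hr' hrδ
      obtain ⟨m', hm', hs'⟩ := ih (r / 2) (by positivity) (by linarith)
        (by rw [pow_succ] at hrδ; linarith)
      obtain ⟨m, hm⟩ := hflat r hr hr'
      rcases hm.splits_of_half hm' hs' hx hA hr (by linarith) hε hε1 with h | h
      · exact ⟨m, hm, h⟩
      · exact ⟨-m, hm.neg, h⟩
  intro r hr hr'
  obtain ⟨n, hn⟩ := pow_unbounded_of_one_lt (r / δ) (one_lt_two (α := ℝ))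
  exact main n r hr hr' (by rwa [div_lt_iff₀ hδ] at hn)

/-! ### Local straightening of a closed surface -/

/-- A defining function `G` near `x`, with differential `⟨ν, ·⟩`, of the cone over `S`. -/
structure IsStraightening (S : Set (E 4)) (x : E 4) (G : E 4 → ℝ) (ν : E 4) : Prop where
  norm_normal : ‖ν‖ = 1
  inner_normal : inner ℝ x ν = 0
  hasFDerivAt : HasFDerivAt G (innerSL ℝ ν) x
  exists_nhds : ∀ N ∈ nhds x, ∃ N' ⊆ N, IsOpen N' ∧ x ∈ N' ∧ ContinuousOn G N' ∧
    (∀ z ∈ N', (‖z‖⁻¹ • z ∈ S ↔ G z = 0)) ∧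
    IsPreconnected (N' ∩ {z | 0 < G z}) ∧ IsPreconnected (N' ∩ {z | G z < 0}) ∧
    N' ∩ {z | G z = 0} ⊆ closure (N' ∩ {z | 0 < G z}) ∧
    N' ∩ {z | G z = 0} ⊆ closure (N' ∩ {z | G z < 0})

/-- The map `(u, t, l) ↦ (1 + l) φ u + t ν` is a local diffeomorphism, because `φ` is orthogonal to
its derivatives. `G` is the `t`-coordinate of the inverse; the cone over `S` is locally `t = 0`.
Neighbourhoods are images of balls in the parameter space, whose two halves are convex, hence
connected. -/
theorem exists_isStraightening {S : Set (E 4)} (hS : IsClosedSurface S) {x : E 4} (hx : x ∈ S) :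
    ∃ G ν, IsStraightening S x G ν := by
  obtain ⟨φ, V, hφ, u₀, hu₀, rfl⟩ := hS.exists_param x hx
  have hnorm : ∀ u ∈ V, ‖φ u‖ = 1 := by
    intro u hu
    obtain ⟨U, -, hU⟩ := hφ.isOpen_image V subset_rfl hφ.isOpen
    have : φ u ∈ S ∩ U := hU ▸ mem_image_of_mem φ hu
    simpa using hS.subset_sphere this.1
  have hVn : V ∈ nhds u₀ := hφ.isOpen.mem_nhds hu₀
  have hC : ContDiffAt ℝ ∞ φ u₀ := hφ.smooth.contDiffAt hVn
  set dφ := fderiv ℝ φ u₀ with hdφ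
  have hD : HasStrictFDerivAt φ dφ u₀ := hC.hasStrictFDerivAt (by simp)
  have hx1 : ‖φ u₀‖ = 1 := hnorm u₀ hu₀
  have horth : ∀ h, inner ℝ (φ u₀) (dφ h) = 0 := by
    intro h
    have h1 : HasFDerivAt (fun u => ‖φ u‖ ^ 2) (2 • (innerSL ℝ (φ u₀)).comp dφ) u₀ :=
      hD.hasFDerivAt.norm_sq
    have h2 : HasFDerivAt (fun u => ‖φ u‖ ^ 2) (0 : E 2 →L[ℝ] ℝ) u₀ := by
      refine (hasFDerivAt_const (1 : ℝ) u₀).congr_of_eventuallyEq ?_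
      filter_upwards [hVn] with u hu
      simp [hnorm u hu]
    have h3 := DFunLike.congr_fun (h1.unique h2) h
    simpa using h3
  obtain ⟨ν, hν, hνx, hν0, hν1⟩ := exists_unit_orthogonal (φ u₀)
    (dφ (EuclideanSpace.single 0 1)) (dφ (EuclideanSpace.single 1 1))
  have hνφ : ∀ h, inner ℝ ν (dφ h) = 0 := by
    intro h
    have : h = h 0 • EuclideanSpace.single 0 (1 : ℝ) + h 1 • EuclideanSpace.single 1 (1 : ℝ) := by
      ext i; fin_cases i <;> simp
    rw [this, map_add, map_smul, map_smul, inner_add_right, inner_smul_right, inner_smul_right,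
      hν0, hν1]
    simp
  have hνν : inner ℝ ν ν = (1 : ℝ) := by rw [real_inner_self_eq_norm_sq, hν]; norm_num
  have hxx : inner ℝ (φ u₀) (φ u₀) = (1 : ℝ) := by rw [real_inner_self_eq_norm_sq, hx1]; norm_num
  have hxν : inner ℝ (φ u₀) ν = 0 := by rw [real_inner_comm]; exact hνx
  set Φ : E 2 × ℝ × ℝ → E 4 := fun p => (1 + p.2.2) • φ p.1 + p.2.1 • ν with hΦ
  set L : E 2 × ℝ × ℝ →L[ℝ] E 4 :=
    dφ.comp (ContinuousLinearMap.fst ℝ _ _) +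
      ((ContinuousLinearMap.snd ℝ ℝ ℝ).comp (ContinuousLinearMap.snd ℝ (E 2) (ℝ × ℝ))).smulRight
        (φ u₀) +
      ((ContinuousLinearMap.fst ℝ ℝ ℝ).comp (ContinuousLinearMap.snd ℝ (E 2) (ℝ × ℝ))).smulRight ν
    with hL
  have hLa : ∀ p, L p = dφ p.1 + p.2.2 • φ u₀ + p.2.1 • ν := by intro p; simp [hL]
  have hνL : ∀ p, inner ℝ ν (L p) = p.2.1 := by
    intro p
    rw [hLa, inner_add_right, inner_add_right, inner_smul_right, inner_smul_right, hνφ, hνν, hνx]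
    simp
  have hxL : ∀ p, inner ℝ (φ u₀) (L p) = p.2.2 := by
    intro p
    rw [hLa, inner_add_right, inner_add_right, inner_smul_right, inner_smul_right, horth, hxx, hxν]
    simp
  have hinj : Function.Injective L := by
    rw [injective_iff_map_eq_zero]
    intro p hp
    have h1 : p.2.1 = 0 := by rw [← hνL, hp, inner_zero_right]
    have h2 : p.2.2 = 0 := by rw [← hxL, hp, inner_zero_right]
    have h3 : dφ p.1 = 0 := by
      have := hLa p
      rw [hp, h1, h2] at this
      simpa using this.symm
    have h4 : p.1 = 0 := hφ.immersion u₀ hu₀ (by rw [map_zero]; exact h3)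
    exact Prod.ext h4 (Prod.ext h1 h2)
  have hdim : Module.finrank ℝ (E 2 × ℝ × ℝ) = Module.finrank ℝ (E 4) := by simp
  set e : (E 2 × ℝ × ℝ) ≃L[ℝ] E 4 :=
    (LinearEquiv.ofInjectiveOfFinrankEq L.toLinearMap hinj hdim).toContinuousLinearEquiv with he
  have heL : (e : E 2 × ℝ × ℝ →L[ℝ] E 4) = L := by
    exact ContinuousLinearMap.ext fun p => rfl
  have hΦD : HasStrictFDerivAt Φ (e : E 2 × ℝ × ℝ →L[ℝ] E 4) (u₀, 0, 0) := by
    rw [heL]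
    have hf : HasStrictFDerivAt (fun p : E 2 × ℝ × ℝ => φ p.1)
        (dφ.comp (ContinuousLinearMap.fst ℝ _ _)) (u₀, 0, 0) :=
      HasStrictFDerivAt.comp (u₀, (0 : ℝ), (0 : ℝ)) hD hasStrictFDerivAt_fst
    have h21 : HasStrictFDerivAt (fun p : E 2 × ℝ × ℝ => p.2.1)
        ((ContinuousLinearMap.fst ℝ ℝ ℝ).comp (ContinuousLinearMap.snd ℝ (E 2) (ℝ × ℝ)))
        (u₀, 0, 0) := ((ContinuousLinearMap.fst ℝ ℝ ℝ).comp
          (ContinuousLinearMap.snd ℝ (E 2) (ℝ × ℝ))).hasStrictFDerivAt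
    have h22 : HasStrictFDerivAt (fun p : E 2 × ℝ × ℝ => p.2.2)
        ((ContinuousLinearMap.snd ℝ ℝ ℝ).comp (ContinuousLinearMap.snd ℝ (E 2) (ℝ × ℝ)))
        (u₀, 0, 0) := ((ContinuousLinearMap.snd ℝ ℝ ℝ).comp
          (ContinuousLinearMap.snd ℝ (E 2) (ℝ × ℝ))).hasStrictFDerivAt
    refine (((h22.const_add 1).smul hf).add
      (h21.smul (hasStrictFDerivAt_const ν _))).congr_fderiv (ContinuousLinearMap.ext fun p => ?_)
    rw [hLa]
    simp
  set ψ := hΦD.toOpenPartialHomeomorph Φ with hψ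
  have hψΦ : ∀ p, ψ p = Φ p := fun p => rfl
  have hsrc : ((u₀, 0, 0) : E 2 × ℝ × ℝ) ∈ ψ.source := hΦD.mem_toOpenPartialHomeomorph_source
  have hΦ0 : Φ (u₀, 0, 0) = φ u₀ := by simp [hΦ]
  refine ⟨fun z => (ψ.symm z).2.1, ν, hν, hxν, ?_, ?_⟩
  · have h1 : HasStrictFDerivAt ψ.symm (e.symm : E 4 →L[ℝ] E 2 × ℝ × ℝ) (Φ (u₀, 0, 0)) :=
      hΦD.to_localInverse
    rw [hΦ0] at h1
    have h2 : HasFDerivAt (fun z => (ψ.symm z).2.1)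
        (((ContinuousLinearMap.fst ℝ ℝ ℝ).comp (ContinuousLinearMap.snd ℝ (E 2) (ℝ × ℝ))).comp
          (e.symm : E 4 →L[ℝ] E 2 × ℝ × ℝ)) (φ u₀) :=
      ((ContinuousLinearMap.fst ℝ ℝ ℝ).comp
        (ContinuousLinearMap.snd ℝ (E 2) (ℝ × ℝ))).hasFDerivAt.comp _ h1.hasFDerivAt
    refine h2.congr_fderiv (ContinuousLinearMap.ext fun y => ?_)
    obtain ⟨p, rfl⟩ := e.surjective y
    have : e p = L p := by rw [← heL]; rfl
    simp only [ContinuousLinearMap.comp_apply, ContinuousLinearEquiv.coe_coe,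
      ContinuousLinearEquiv.symm_apply_apply, ContinuousLinearMap.coe_fst',
      ContinuousLinearMap.coe_snd', innerSL_apply_apply]
    rw [this, hνL]
  · intro N hN
    have hVp : Prod.fst ⁻¹' V ∈ nhds ((u₀, 0, 0) : E 2 × ℝ × ℝ) :=
      (hφ.isOpen.preimage continuous_fst).mem_nhds hu₀
    obtain ⟨δ, hδ, hδs⟩ := Metric.mem_nhds_iff.1
      (Filter.inter_mem (ψ.open_source.mem_nhds hsrc) hVp)
    have hδV : ball u₀ δ ⊆ V := by
      intro u hu
      have : ((u, 0, 0) : E 2 × ℝ × ℝ) ∈ ball ((u₀, 0, 0) : E 2 × ℝ × ℝ) δ := by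
        rw [Metric.mem_ball, Prod.dist_eq, Prod.dist_eq]
        exact max_lt hu (max_lt (by simpa using hδ) (by simpa using hδ))
      exact (hδs this).2
    -- Embeddedness: inside `U` the surface consists only of this parametrized sheet, so a
    -- normalized point of `S` has the coordinate `t = 0`.
    obtain ⟨U, hU, hUS⟩ := hφ.isOpen_image (ball u₀ δ) hδV isOpen_ball
    have hxU : φ u₀ ∈ U := by
      have : φ u₀ ∈ S ∩ U := hUS ▸ mem_image_of_mem φ (mem_ball_self hδ)
      exact this.2
    have hx0 : ‖φ u₀‖ ≠ 0 := by rw [hx1]; norm_num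
    have hr : ContinuousAt (fun z : E 4 => ‖z‖⁻¹ • z) (φ u₀) :=
      (continuousAt_id.norm.inv₀ hx0).smul continuousAt_id
    have hrU : ∀ᶠ z in nhds (φ u₀), ‖z‖⁻¹ • z ∈ U := by
      apply hr.eventually_mem
      refine hU.mem_nhds ?_
      simpa [hx1] using hxU
    have hnm : ∀ᶠ z in nhds (φ u₀), |‖z‖ - 1| < min δ 1 := by
      have : ContinuousAt (fun z : E 4 => |‖z‖ - 1|) (φ u₀) := by fun_prop
      refine this.eventually_lt continuousAt_const ?_
      simp [hx1, hδ]
    have hΦc : ContinuousAt Φ (u₀, 0, 0) := hΦD.hasFDerivAt.continuousAt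
    have hpre : Φ ⁻¹' (N ∩ {z | ‖z‖⁻¹ • z ∈ U} ∩ {z | |‖z‖ - 1| < min δ 1}) ∈
        nhds ((u₀, 0, 0) : E 2 × ℝ × ℝ) := by
      apply hΦc.preimage_mem_nhds
      rw [hΦ0]
      exact Filter.inter_mem (Filter.inter_mem hN hrU) hnm
    obtain ⟨δ', hδ', hδ's⟩ := Metric.mem_nhds_iff.1
      (Filter.inter_mem hpre (Metric.ball_mem_nhds ((u₀, 0, 0) : E 2 × ℝ × ℝ) (lt_min hδ one_pos)))
    set B := ball ((u₀, 0, 0) : E 2 × ℝ × ℝ) δ' with hB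
    have hBsrc : B ⊆ ψ.source := fun p hp =>
      (hδs (ball_subset_ball (min_le_left _ _) (hδ's hp).2)).1
    have hB1 : ∀ p ∈ B, -1 < p.2.2 := by
      intro p hp
      have h1 := (hδ's hp).2
      rw [Metric.mem_ball, Prod.dist_eq, Prod.dist_eq] at h1
      have h2 : dist p.2.2 0 < 1 := lt_of_le_of_lt ((le_max_right _ _).trans (le_max_right _ _))
        (h1.trans_le (min_le_right _ _))
      rw [Real.dist_eq, sub_zero] at h2
      linarith [(abs_lt.1 h2).1]
    have hBV : ∀ p ∈ B, p.1 ∈ ball u₀ δ := by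
      intro p hp
      have h1 := (hδ's hp).2
      rw [Metric.mem_ball, Prod.dist_eq] at h1
      exact lt_of_le_of_lt (le_max_left _ _) (h1.trans_le (min_le_left _ _))
    have hG : ∀ p ∈ B, (ψ.symm (Φ p)).2.1 = p.2.1 := by
      intro p hp
      rw [← hψΦ, ψ.left_inv (hBsrc hp)]
    have hcontB : ContinuousOn Φ B := ψ.continuousOn.mono hBsrc
    have hopen : IsOpen (Φ '' B) := ψ.isOpen_image_of_subset_source isOpen_ball hBsrc
    have hpos : Φ '' B ∩ {z | 0 < (ψ.symm z).2.1} = Φ '' (B ∩ {p | 0 < p.2.1}) := by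
      ext z; constructor
      · rintro ⟨⟨p, hp, rfl⟩, hz⟩
        exact ⟨p, ⟨hp, by simpa [hG p hp] using hz⟩, rfl⟩
      · rintro ⟨p, ⟨hp, hp'⟩, rfl⟩
        exact ⟨⟨p, hp, rfl⟩, by simpa [hG p hp] using hp'⟩
    have hneg : Φ '' B ∩ {z | (ψ.symm z).2.1 < 0} = Φ '' (B ∩ {p | p.2.1 < 0}) := by
      ext z; constructor
      · rintro ⟨⟨p, hp, rfl⟩, hz⟩
        exact ⟨p, ⟨hp, by simpa [hG p hp] using hz⟩, rfl⟩
      · rintro ⟨p, ⟨hp, hp'⟩, rfl⟩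
        exact ⟨⟨p, hp, rfl⟩, by simpa [hG p hp] using hp'⟩
    have hlin : IsLinearMap ℝ (fun p : E 2 × ℝ × ℝ => p.2.1) := ⟨fun _ _ => rfl, fun _ _ => rfl⟩
    have hcl : ∀ σ : ℝ, σ ≠ 0 → ∀ p ∈ B, p.2.1 = 0 →
        Φ p ∈ closure (Φ '' (B ∩ {p | ∃ t, 0 < t ∧ p.2.1 = t * σ})) := by
      intro σ hσ p hp hp0
      have hc : Continuous (fun t : ℝ => ((p.1, t * σ, p.2.2) : E 2 × ℝ × ℝ)) := by fun_prop
      have hlim : Filter.Tendsto (fun t : ℝ => ((p.1, t * σ, p.2.2) : E 2 × ℝ × ℝ))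
          (nhdsWithin 0 (Ioi 0)) (nhds p) := by
        have := (hc.tendsto 0).mono_left (nhdsWithin_le_nhds (s := Ioi 0))
        have h0 : ((p.1, 0 * σ, p.2.2) : E 2 × ℝ × ℝ) = p := by
          rw [zero_mul, ← hp0]
        rwa [h0] at this
      have hmem : p ∈ closure (B ∩ {p | ∃ t, 0 < t ∧ p.2.1 = t * σ}) := by
        refine mem_closure_of_tendsto hlim ?_
        filter_upwards [hlim.eventually (isOpen_ball.mem_nhds hp), self_mem_nhdsWithin] with t ht ht'
        exact ⟨ht, t, ht', rfl⟩
      exact ((hcontB p hp).mono inter_subset_left).mem_closure_image hmem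
    refine ⟨Φ '' B, ?_, hopen, ⟨_, mem_ball_self hδ', hΦ0⟩, ?_, ?_, ?_, ?_, ?_, ?_⟩
    · rintro _ ⟨p, hp, rfl⟩
      exact (hδ's hp).1.1.1
    · have : ContinuousOn ψ.symm (Φ '' B) := by
        refine ψ.symm.continuousOn.mono ?_
        rintro _ ⟨p, hp, rfl⟩
        exact ψ.map_source (hBsrc hp)
      exact (continuous_fst.comp continuous_snd).comp_continuousOn this
    · rintro _ ⟨p, hp, rfl⟩
      rw [hG p hp]
      constructor
      · intro hz
        have h1 : ‖Φ p‖⁻¹ • Φ p ∈ φ '' ball u₀ δ := by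
          rw [hUS]; exact ⟨hz, (hδ's hp).1.1.2⟩
        obtain ⟨u', hu', hu'e⟩ := h1
        have h2 : |‖Φ p‖ - 1| < min δ 1 := (hδ's hp).1.2
        have h3 : ‖Φ p‖ ≠ 0 := by
          intro h0
          rw [h0] at h2
          have := h2.trans_le (min_le_right _ _)
          norm_num at this
        have h4 : Φ (u', 0, ‖Φ p‖ - 1) = Φ p := by
          have : Φ (u', 0, ‖Φ p‖ - 1) = ‖Φ p‖ • φ u' := by simp [hΦ]
          rw [this, hu'e, smul_smul, mul_inv_cancel₀ h3, one_smul]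
        have h5 : ((u', 0, ‖Φ p‖ - 1) : E 2 × ℝ × ℝ) ∈ ψ.source := by
          refine (hδs ?_).1
          rw [Metric.mem_ball, Prod.dist_eq, Prod.dist_eq]
          refine max_lt hu' (max_lt (by simpa using hδ) ?_)
          simpa [Real.dist_eq] using h2.trans_le (min_le_left _ _)
        have h6 := ψ.injOn h5 (hBsrc hp) h4
        rw [← h6]
      · intro h0
        have hu : p.1 ∈ ball u₀ δ := hBV p hp
        have h1 : Φ p = (1 + p.2.2) • φ p.1 := by simp [hΦ, h0]
        have h2 : 0 < 1 + p.2.2 := by linarith [hB1 p hp]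
        have h3 : ‖Φ p‖ = 1 + p.2.2 := by
          rw [h1, norm_smul, hnorm _ (hδV hu), mul_one, Real.norm_of_nonneg h2.le]
        rw [h3, h1, smul_smul, inv_mul_cancel₀ h2.ne', one_smul]
        have : φ p.1 ∈ S ∩ U := hUS ▸ mem_image_of_mem φ hu
        exact this.1
    · rw [hpos]
      refine IsPreconnected.image ?_ _ (hcontB.mono inter_subset_left)
      exact ((convex_ball _ _).inter (convex_halfSpace_gt hlin 0)).isPreconnected
    · rw [hneg]
      refine IsPreconnected.image ?_ _ (hcontB.mono inter_subset_left)
      exact ((convex_ball _ _).inter (convex_halfSpace_lt hlin 0)).isPreconnected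
    · rintro _ ⟨⟨p, hp, rfl⟩, hz⟩
      rw [hpos]
      refine closure_mono (image_mono ?_) (hcl 1 one_ne_zero p hp (by simpa [hG p hp] using hz))
      rintro p' ⟨h1, t, ht, h2⟩
      exact ⟨h1, by simp [h2, ht]⟩
    · rintro _ ⟨⟨p, hp, rfl⟩, hz⟩
      rw [hneg]
      refine closure_mono (image_mono ?_) (hcl (-1) (by norm_num) p hp (by simpa [hG p hp] using hz))
      rintro p' ⟨h1, t, ht, h2⟩
      exact ⟨h1, by simp [h2, ht]⟩

/-! ### Gluing functions that are defined locally up to a constant factor -/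

section Glue

variable {X : Type*} [TopologicalSpace X] {Γ : Type*} [CommGroup Γ]

/-- Off `T` and near `w`, the functions `f` and `g` agree up to a constant factor. -/
def Agree (T : Set X) (f g : X → Γ) (w : X) : Prop :=
  ∃ ε : Γ, ∀ᶠ z in nhds w, z ∉ T → f z = ε * g z

theorem Agree.refl (T : Set X) (f : X → Γ) (w : X) : Agree T f f w :=
  ⟨1, Filter.Eventually.of_forall fun _ _ => (one_mul _).symm⟩

theorem Agree.symm {T : Set X} {f g : X → Γ} {w : X} (h : Agree T f g w) : Agree T g f w := by
  obtain ⟨ε, h⟩ := h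
  refine ⟨ε⁻¹, h.mono fun z hz hzT => ?_⟩
  rw [hz hzT, inv_mul_cancel_left]

theorem Agree.trans {T : Set X} {f g k : X → Γ} {w : X} (h : Agree T f g w) (h' : Agree T g k w) :
    Agree T f k w := by
  obtain ⟨ε, h⟩ := h
  obtain ⟨ε', h'⟩ := h'
  refine ⟨ε * ε', ?_⟩
  filter_upwards [h, h'] with z hz hz' hzT
  rw [hz hzT, hz' hzT, mul_assoc]

/-- Each factor is valid on an open set, and different factors have disjoint such sets because `Tᶜ`
is dense. A connected set therefore sees a single factor. -/
theorem exists_const_of_agree {T : Set X} (hT : Dense Tᶜ) {f g : X → Γ} {K : Set X}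
    (hK : IsPreconnected K) (h : ∀ w ∈ K, Agree T f g w) :
    ∃ ε : Γ, ∀ w ∈ K, ∀ᶠ z in nhds w, z ∉ T → f z = ε * g z := by
  rcases K.eq_empty_or_nonempty with rfl | ⟨w₀, hw₀⟩
  · exact ⟨1, by simp⟩
  obtain ⟨ε, hε⟩ := h w₀ hw₀
  refine ⟨ε, ?_⟩
  have hopen : ∀ δ : Γ, IsOpen {w | ∀ᶠ z in nhds w, z ∉ T → f z = δ * g z} := fun δ =>
    isOpen_iff_mem_nhds.2 fun w hw => eventually_eventually_nhds.2 hw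
  have hU := hopen ε
  have hV : IsOpen (⋃ δ ∈ {δ | δ ≠ ε}, {w | ∀ᶠ z in nhds w, z ∉ T → f z = δ * g z}) :=
    isOpen_biUnion fun δ _ => hopen δ
  have hdisj : Disjoint {w | ∀ᶠ z in nhds w, z ∉ T → f z = ε * g z}
      (⋃ δ ∈ {δ | δ ≠ ε}, {w | ∀ᶠ z in nhds w, z ∉ T → f z = δ * g z}) := by
    rw [Set.disjoint_left]
    intro w hw hw'
    simp only [mem_iUnion] at hw'
    obtain ⟨δ, hδ, hw'⟩ := hw'
    obtain ⟨O, hO, hOo, hwO⟩ := eventually_nhds_iff.1 (Filter.Eventually.and hw hw')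
    obtain ⟨z, hzO, hzT⟩ := hT.inter_open_nonempty O hOo ⟨w, hwO⟩
    have := (hO z hzO).1 hzT
    rw [(hO z hzO).2 hzT] at this
    exact hδ (mul_right_cancel this)
  refine IsPreconnected.subset_left_of_subset_union hU hV hdisj ?_ ⟨w₀, hw₀, hε⟩ hK
  intro w hw
  obtain ⟨δ, hδ⟩ := h w hw
  by_cases hδε : δ = ε
  · left; rw [← hδε]; exact hδ
  · right; exact mem_biUnion (show δ ∈ {δ | δ ≠ ε} from hδε) hδ

/-- On the connected interface the two solutions differ by one constant; multiplying one of them by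
it makes them match. -/
theorem exists_glue {T : Set X} (hT : Dense Tᶜ) {p : X → ℝ} (hp : Continuous p) {c : ℝ}
    {s : X → X → Γ} {K : Set X} (hK : IsPreconnected (K ∩ {w | p w = c})) {f₁ f₂ : X → Γ}
    (h₁ : ∀ w ∈ K, p w ≤ c → Agree T f₁ (s w) w) (h₂ : ∀ w ∈ K, c ≤ p w → Agree T f₂ (s w) w) :
    ∃ f : X → Γ, ∀ w ∈ K, Agree T f (s w) w := by
  classical
  obtain ⟨ε, hε⟩ := exists_const_of_agree hT hK (f := f₁) (g := f₂)
    (fun w hw => (h₁ w hw.1 (le_of_eq hw.2)).trans (h₂ w hw.1 (le_of_eq hw.2.symm)).symm)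
  refine ⟨fun z => if p z ≤ c then f₁ z else ε * f₂ z, fun w hw => ?_⟩
  rcases lt_trichotomy (p w) c with hlt | heq | hgt
  · refine Agree.trans ⟨1, ?_⟩ (h₁ w hw hlt.le)
    filter_upwards [hp.continuousAt.eventually_lt continuousAt_const hlt] with z hz _
    rw [if_pos hz.le, one_mul]
  · refine Agree.trans ⟨1, ?_⟩ (h₁ w hw heq.le)
    filter_upwards [hε w ⟨hw, heq⟩] with z hz hzT
    rw [one_mul]
    split_ifs
    · rfl
    · exact (hz hzT).symm
  · refine Agree.trans ⟨ε, ?_⟩ (h₂ w hw hgt.le)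
    filter_upwards [continuousAt_const.eventually_lt hp.continuousAt hgt] with z hz _
    rw [if_neg (not_le.2 hz)]

/-- Vanishing of monodromy on a convex set, by subdivision: on boxes below the Lebesgue number one
local function works, and doubling one side of a box glues along a convex slice. -/
theorem exists_glue_of_compact {T : Set (E 3)} (hT : Dense Tᶜ) {s : E 3 → E 3 → Γ}
    (hs : ∀ w, ∀ᶠ w' in nhds w, Agree T (s w) (s w') w') {K : Set (E 3)} (hK : IsCompact K)
    (hKc : Convex ℝ K) : ∃ f : E 3 → Γ, ∀ w ∈ K, Agree T f (s w) w := by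
  classical
  let box : (Fin 3 → ℝ) → (Fin 3 → ℝ) → Set (E 3) := fun a b => {w | ∀ i, a i ≤ w i ∧ w i ≤ b i}
  have hcoord : ∀ i, IsLinearMap ℝ (fun w : E 3 => w i) := fun i => ⟨fun _ _ => rfl, fun _ _ => rfl⟩
  have hconv : ∀ a b, Convex ℝ (box a b) := by
    intro a b
    have : box a b = ⋂ i, ({w : E 3 | a i ≤ w i} ∩ {w | w i ≤ b i}) := by
      ext w; simp [box]
    rw [this]
    exact convex_iInter fun i =>
      (convex_halfSpace_ge (hcoord i) _).inter (convex_halfSpace_le (hcoord i) _)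
  let Good : (Fin 3 → ℝ) → Prop := fun L => ∀ a b, (∀ i, b i - a i ≤ L i) →
    ∃ f : E 3 → Γ, ∀ w ∈ box a b ∩ K, Agree T f (s w) w
  have hdouble : ∀ L i, Good L → Good (Function.update L i (2 * L i)) := by
    intro L i hL a b hab
    set c := (a i + b i) / 2 with hc
    have hi : b i - a i ≤ 2 * L i := by simpa using hab i
    obtain ⟨f₁, h₁⟩ := hL a (Function.update b i c) (by
      intro j
      by_cases hj : j = i
      · subst hj; simp only [Function.update_self]; linarith
      · simpa [Function.update_of_ne hj] using hab j)
    obtain ⟨f₂, h₂⟩ := hL (Function.update a i c) b (by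
      intro j
      by_cases hj : j = i
      · subst hj; simp only [Function.update_self]; linarith
      · simpa [Function.update_of_ne hj] using hab j)
    refine exists_glue hT (p := fun w : E 3 => w i) (c := c) (by fun_prop) ?_
      (f₁ := f₁) (f₂ := f₂) ?_ ?_
    · refine Convex.isPreconnected (((hconv a b).inter hKc).inter ?_)
      exact convex_hyperplane (hcoord i) c
    · rintro w ⟨hw, hwK⟩ hwc
      refine h₁ w ⟨fun j => ?_, hwK⟩
      by_cases hj : j = i
      · subst hj; simpa using ⟨(hw j).1, hwc⟩
      · simpa [Function.update_of_ne hj] using hw j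
    · rintro w ⟨hw, hwK⟩ hwc
      refine h₂ w ⟨fun j => ?_, hwK⟩
      by_cases hj : j = i
      · subst hj; simpa using ⟨hwc, (hw j).2⟩
      · simpa [Function.update_of_ne hj] using hw j
  have hstep : ∀ ℓ : ℝ, Good (fun _ => ℓ) → Good (fun _ => 2 * ℓ) := by
    intro ℓ h
    have h3 := hdouble _ 2 (hdouble _ 1 (hdouble _ 0 h))
    convert h3 using 1
    funext i
    fin_cases i <;> simp [Function.update]
  obtain ⟨δ, hδ, hδs⟩ := lebesgue_number_lemma_of_metric (s := K)
    (c := fun w : E 3 => interior {w' | Agree T (s w) (s w') w'}) hK (fun _ => isOpen_interior)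
    (fun w _ => mem_iUnion.2 ⟨w, mem_interior_iff_mem_nhds.2 (hs w)⟩)
  have hbase : Good (fun _ => δ / 2) := by
    intro a b hab
    rcases (box a b ∩ K).eq_empty_or_nonempty with h0 | ⟨x, hx, hxK⟩
    · rw [h0]; exact ⟨fun _ => 1, by simp⟩
    obtain ⟨w, hw⟩ := hδs x hxK
    refine ⟨s w, ?_⟩
    rintro w' ⟨hw', -⟩
    have hball : w' ∈ ball x δ → Agree T (s w) (s w') w' := fun h =>
      interior_subset (s := {w' | Agree T (s w) (s w') w'}) (hw h)
    apply hball
    rw [Metric.mem_ball, EuclideanSpace.dist_eq]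
    have hle : ∀ i, dist (w' i) (x i) ^ 2 ≤ (δ / 2) ^ 2 := by
      intro i
      rw [Real.dist_eq, sq_le_sq, abs_abs, abs_of_pos (half_pos hδ), abs_le]
      constructor <;> linarith [hab i, (hw' i).1, (hw' i).2, (hx i).1, (hx i).2]
    have hsum : ∑ i, dist (w' i) (x i) ^ 2 < δ ^ 2 := by
      rw [Fin.sum_univ_three]
      nlinarith [hle 0, hle 1, hle 2]
    calc √(∑ i, dist (w' i) (x i) ^ 2) < √(δ ^ 2) :=
          Real.sqrt_lt_sqrt (Finset.sum_nonneg fun _ _ => sq_nonneg _) hsum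
      _ = δ := Real.sqrt_sq hδ.le
  have hpow : ∀ n : ℕ, Good (fun _ => 2 ^ n * (δ / 2)) := by
    intro n
    induction n with
    | zero => simpa using hbase
    | succ n ih =>
      have := hstep _ ih
      rwa [← mul_assoc, ← pow_succ'] at this
  obtain ⟨R, hR⟩ := hK.isBounded.subset_closedBall 0
  obtain ⟨n, hn⟩ := pow_unbounded_of_one_lt (2 * R / (δ / 2)) (one_lt_two : (1 : ℝ) < 2)
  rw [div_lt_iff₀ (half_pos hδ)] at hn
  obtain ⟨f, hf⟩ := hpow n (fun _ => -R) (fun _ => R) (fun i => by linarith)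
  refine ⟨f, fun w hw => hf w ⟨fun i => ?_, hw⟩⟩
  have h1 : ‖w i‖ ≤ ‖w‖ := PiLp.norm_apply_le w i
  have h2 : ‖w‖ ≤ R := by simpa using hR hw
  rw [Real.norm_eq_abs] at h1
  exact abs_le.1 (h1.trans h2)

end Glue

/-! ### A closed surface has two sides -/

/-- Stereographic projection from `q`, with `ρ` extended radially off the sphere so that it can be
composed with open neighbourhoods in `ℝ⁴`. -/
theorem exists_sphere_chart {q : E 4} (hq : ‖q‖ = 1) :
    ∃ (β : E 3 → E 4) (ρ : E 4 → E 3), Continuous β ∧ (∀ w, ‖β w‖ = 1) ∧ (∀ w, ρ (β w) = w) ∧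
      (∀ w, β w ≠ q) ∧
      ∀ z, z ≠ 0 → ‖z‖⁻¹ • z ≠ q → ContinuousAt ρ z ∧ β (ρ z) = ‖z‖⁻¹ • z := by
  classical
  let _ : Fact (Module.finrank ℝ (E 4) = 3 + 1) := ⟨by simp⟩
  let q' : sphere (0 : E 4) 1 := ⟨q, by simpa using hq⟩
  let st := stereographic' 3 q'
  have hsrc : st.source = {q'}ᶜ := stereographic'_source q'
  have htgt : st.target = univ := stereographic'_target q'
  let nz : E 4 → sphere (0 : E 4) 1 := fun z =>
    if h : z = 0 then q' else ⟨‖z‖⁻¹ • z, by simp [norm_smul, h]⟩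
  have hnz : ∀ z, z ≠ 0 → (nz z : E 4) = ‖z‖⁻¹ • z := fun z h => by simp [nz, h]
  refine ⟨fun w => (st.symm w : E 4), fun z => st (nz z), ?_, ?_, ?_, ?_, ?_⟩
  · have h1 : ContinuousOn st.symm univ := by rw [← htgt]; exact st.continuousOn_symm
    exact continuous_subtype_val.comp (continuousOn_univ.1 h1)
  · intro w
    simp
  · intro w
    have h1 : ‖(st.symm w : E 4)‖ = 1 := by simp
    have h0 : (st.symm w : E 4) ≠ 0 := by
      intro h; rw [h] at h1; simp at h1
    have h2 : nz (st.symm w : E 4) = st.symm w := by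
      apply Subtype.ext
      rw [hnz _ h0, h1, inv_one, one_smul]
    simp only [h2]
    exact st.right_inv (by rw [htgt]; trivial)
  · intro w hw
    have h1 : st.symm w ∈ st.source := st.map_target (by rw [htgt]; trivial)
    rw [hsrc] at h1
    exact h1 (Subtype.ext hw)
  · intro z hz hzq
    have hmem : nz z ∈ st.source := by
      rw [hsrc]
      intro h
      apply hzq
      rw [← hnz z hz, h]
    constructor
    · have h1 : ContinuousAt nz z := by
        rw [Topology.IsInducing.subtypeVal.continuousAt_iff]
        have : ContinuousAt (fun z : E 4 => ‖z‖⁻¹ • z) z :=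
          (continuousAt_id.norm.inv₀ (norm_ne_zero_iff.2 hz)).smul continuousAt_id
        refine this.congr ?_
        filter_upwards [isOpen_ne.mem_nhds hz] with y hy
        exact (hnz y hy).symm
      exact ContinuousAt.comp (g := st) (st.continuousAt hmem) h1
    · change ((st.symm (st (nz z)) : sphere (0 : E 4) 1) : E 4) = _
      rw [st.left_inv hmem, hnz z hz]

theorem pos_or_neg_of_isPreconnected {X : Type*} [TopologicalSpace X] {U : Set X} {G : X → ℝ}
    (hU : IsPreconnected U) (hG : ContinuousOn G U) (h0 : ∀ y ∈ U, G y ≠ 0) :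
    (∀ y ∈ U, 0 < G y) ∨ (∀ y ∈ U, G y < 0) := by
  by_contra hcon
  push Not at hcon
  obtain ⟨⟨a, ha, ha'⟩, b, hb, hb'⟩ := hcon
  obtain ⟨y, hy, hy0⟩ := hU.intermediate_value ha hb hG ⟨ha', hb'⟩
  exact h0 y hy hy0

/-- The zero set of `G` is locally a cone, so the radial segment from `z` to its normalization lies
either entirely in it or entirely off it, and `G` cannot change sign along it. -/
theorem IsStraightening.sign_normalized {S : Set (E 4)} {x ν : E 4} {G : E 4 → ℝ} (hx : ‖x‖ = 1)
    (h : IsStraightening S x G ν) :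
    ∀ᶠ z in nhds x, z ≠ 0 ∧ (0 < G z → 0 < G (‖z‖⁻¹ • z)) ∧ (G z < 0 → G (‖z‖⁻¹ • z) < 0) := by
  obtain ⟨N, -, hN, hxN, hG, hS, -⟩ := h.exists_nhds univ Filter.univ_mem
  obtain ⟨δ, hδ, hδN⟩ := Metric.mem_nhds_iff.1 (hN.mem_nhds hxN)
  have hx0 : x ≠ 0 := by intro h0; rw [h0] at hx; simp at hx
  have hr : ContinuousAt (fun z : E 4 => ‖z‖⁻¹ • z) x :=
    (continuousAt_id.norm.inv₀ (norm_ne_zero_iff.2 hx0)).smul continuousAt_id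
  have h1 : ∀ᶠ z in nhds x, ‖z‖⁻¹ • z ∈ ball x δ := by
    apply hr.eventually_mem
    simpa [hx] using ball_mem_nhds x hδ
  filter_upwards [h1, ball_mem_nhds x hδ, isOpen_ne.mem_nhds hx0] with z hz1 hz2 hz0
  refine ⟨hz0, ?_⟩
  have hzpos : 0 < ‖z‖ := norm_pos_iff.2 hz0
  have hseg : segment ℝ z (‖z‖⁻¹ • z) ⊆ N := ((convex_ball x δ).segment_subset hz2 hz1).trans hδN
  have hsc : ∀ y ∈ segment ℝ z (‖z‖⁻¹ • z), ‖y‖⁻¹ • y = ‖z‖⁻¹ • z := by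
    rintro y ⟨a, b, ha, hb, hab, rfl⟩
    have hpos : 0 < a + b * ‖z‖⁻¹ := by
      rcases ha.eq_or_lt with h0 | h0
      · have : 0 < b := by linarith
        positivity
      · positivity
    rw [smul_smul, ← add_smul, norm_smul, Real.norm_of_nonneg hpos.le, smul_smul]
    congr 1
    have : a * ‖z‖ + b ≠ 0 := by
      have h2 : (a + b * ‖z‖⁻¹) * ‖z‖ = a * ‖z‖ + b := by field_simp
      rw [← h2]
      positivity
    field_simp
  by_cases hzS : ‖z‖⁻¹ • z ∈ S
  · have : G z = 0 := (hS z (hδN hz2)).1 hzS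
    constructor <;> intro h0 <;> linarith
  · rcases pos_or_neg_of_isPreconnected (convex_segment z (‖z‖⁻¹ • z)).isPreconnected
      (hG.mono hseg) (fun y hy h0 => hzS (by rw [← hsc y hy]; exact (hS y (hseg hy)).2 h0))
      with h2 | h2
    · exact ⟨fun _ => h2 _ (right_mem_segment _ _ _),
        fun h0 => absurd (h2 _ (left_mem_segment _ _ _)) (not_lt.2 h0.le)⟩
    · exact ⟨fun h0 => absurd (h2 _ (left_mem_segment _ _ _)) (not_lt.2 h0.le),
        fun _ => h2 _ (right_mem_segment _ _ _)⟩

open Classical in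
/-- The sign of a nonzero real number. -/
noncomputable def unitSign (t : ℝ) : ℤˣ := if 0 < t then 1 else -1

theorem unitSign_of_pos {t : ℝ} (h : 0 < t) : unitSign t = 1 := if_pos h

theorem unitSign_of_neg {t : ℝ} (h : t < 0) : unitSign t = -1 := if_neg (not_lt.2 h.le)

open Classical in
/-- The local sign functions of the surface `S` with defining functions `G`. -/
noncomputable def localSign (S : Set (E 4)) (G : E 4 → E 4 → ℝ) (β : E 3 → E 4) (w z : E 3) : ℤˣ :=
  if β w ∈ S then unitSign (G (β w) (β z)) else 1

/-- Near a common point of `S`, two defining functions have the same zeros, and the halves cut by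
the second are connected. The first has a constant sign on each half, and the two signs differ
because both occur arbitrarily close to the point. Away from `S` the signs are locally constant. -/
theorem agree_localSign {S : Set (E 4)} (hS : IsClosed S) {G : E 4 → E 4 → ℝ}
    (hG : ∀ x ∈ S, ∃ ν, IsStraightening S x (G x) ν) {β : E 3 → E 4} (hβ : Continuous β)
    (hβ1 : ∀ w, ‖β w‖ = 1) (w : E 3) :
    ∀ᶠ w' in nhds w, Agree (β ⁻¹' S) (localSign S G β w) (localSign S G β w') w' := by
  have hrβ : ∀ w, ‖β w‖⁻¹ • β w = β w := fun w => by rw [hβ1, inv_one, one_smul]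
  by_cases hw : β w ∈ S
  · obtain ⟨ν, hν⟩ := hG _ hw
    obtain ⟨N, -, hN, hxN, hGN, hNS, -, -, hcp, hcn⟩ := hν.exists_nhds univ Filter.univ_mem
    filter_upwards [(hN.preimage hβ).mem_nhds hxN] with w' hw'
    have hsw : ∀ z, localSign S G β w z = unitSign (G (β w) (β z)) := fun z => if_pos hw
    by_cases hw'S : β w' ∈ S
    · obtain ⟨ν', hν'⟩ := hG _ hw'S
      have hsw' : ∀ z, localSign S G β w' z = unitSign (G (β w') (β z)) := fun z => if_pos hw'S
      obtain ⟨N', hN'N, hN', hxN', hGN', hN'S, hpp, hpn, -⟩ := hν'.exists_nhds N (hN.mem_nhds hw')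
      have hzero : G (β w) (β w') = 0 := (hNS _ hw').1 (by rwa [hrβ])
      have h0 : ∀ y ∈ N', G (β w') y ≠ 0 → G (β w) y ≠ 0 := fun y hy h h' =>
        h ((hN'S y hy).1 ((hNS y (hN'N hy)).2 h'))
      obtain ⟨y₁, hy₁⟩ := mem_closure_iff.1 (hcp ⟨hw', hzero⟩) N' hN' hxN'
      obtain ⟨y₂, hy₂⟩ := mem_closure_iff.1 (hcn ⟨hw', hzero⟩) N' hN' hxN'
      have hnz : ∀ y ∈ N', G (β w) y ≠ 0 → G (β w') y ≠ 0 := fun y hy h h' =>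
        h ((hNS y (hN'N hy)).1 ((hN'S y hy).2 h'))
      have hev : ∀ᶠ z in nhds w', β z ∈ N' := (hN'.preimage hβ).mem_nhds hxN'
      have hnT : ∀ z, β z ∈ N' → z ∉ β ⁻¹' S → G (β w') (β z) ≠ 0 := by
        intro z hz hzT h
        refine hzT ?_
        have := (hN'S _ hz).2 h
        rwa [hrβ] at this
      rcases pos_or_neg_of_isPreconnected hpp (hGN.mono (inter_subset_left.trans hN'N))
        (fun y hy => h0 y hy.1 (ne_of_gt hy.2)) with h1 | h1 <;>
      rcases pos_or_neg_of_isPreconnected hpn (hGN.mono (inter_subset_left.trans hN'N))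
        (fun y hy => h0 y hy.1 (ne_of_lt hy.2)) with h2 | h2
      · exfalso
        rcases lt_or_gt_of_ne (hnz y₂ hy₂.1 (ne_of_lt hy₂.2.2)) with h | h
        · exact absurd (h2 y₂ ⟨hy₂.1, h⟩) (not_lt.2 (le_of_lt hy₂.2.2))
        · exact absurd (h1 y₂ ⟨hy₂.1, h⟩) (not_lt.2 (le_of_lt hy₂.2.2))
      · refine ⟨1, hev.mono fun z hz hzT => ?_⟩
        rw [hsw, hsw', one_mul]
        rcases lt_or_gt_of_ne (hnT z hz hzT) with h | h
        · rw [unitSign_of_neg h, unitSign_of_neg (h2 _ ⟨hz, h⟩)]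
        · rw [unitSign_of_pos h, unitSign_of_pos (h1 _ ⟨hz, h⟩)]
      · refine ⟨-1, hev.mono fun z hz hzT => ?_⟩
        rw [hsw, hsw']
        rcases lt_or_gt_of_ne (hnT z hz hzT) with h | h
        · rw [unitSign_of_neg h, unitSign_of_pos (h2 _ ⟨hz, h⟩)]; rfl
        · rw [unitSign_of_pos h, unitSign_of_neg (h1 _ ⟨hz, h⟩)]; rfl
      · exfalso
        rcases lt_or_gt_of_ne (hnz y₁ hy₁.1 (ne_of_gt hy₁.2.2)) with h | h
        · exact absurd (h2 y₁ ⟨hy₁.1, h⟩) (not_lt.2 (le_of_lt hy₁.2.2))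
        · exact absurd (h1 y₁ ⟨hy₁.1, h⟩) (not_lt.2 (le_of_lt hy₁.2.2))
    · have hsw' : ∀ z, localSign S G β w' z = 1 := fun z => if_neg hw'S
      have hne : G (β w) (β w') ≠ 0 := fun h => hw'S (by
        have := (hNS _ hw').2 h
        rwa [hrβ] at this)
      have hc : ContinuousAt (fun z => G (β w) (β z)) w' :=
        ContinuousAt.comp (g := G (β w)) (hGN.continuousAt (hN.mem_nhds hw')) hβ.continuousAt
      rcases lt_or_gt_of_ne hne with h | h
      · refine ⟨-1, (hc.eventually_lt continuousAt_const h).mono fun z hz _ => ?_⟩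
        rw [hsw, hsw', unitSign_of_neg hz, mul_one]
      · refine ⟨1, (continuousAt_const.eventually_lt hc h).mono fun z hz _ => ?_⟩
        rw [hsw, hsw', unitSign_of_pos hz, mul_one]
  · filter_upwards [(hS.isOpen_compl.preimage hβ).mem_nhds hw] with w' hw'
    have : localSign S G β w = localSign S G β w' := by
      funext z
      rw [localSign, localSign, if_neg hw, if_neg hw']
    rw [this]
    exact Agree.refl _ _ _

theorem IsSide.subset {S A : Set (E 4)} (hA : IsSide S A) : A ⊆ S3 \ S := by
  obtain ⟨x, -, rfl⟩ := hA
  exact connectedComponentIn_subset _ _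

theorem IsSide.isConnected {S A : Set (E 4)} (hA : IsSide S A) : IsConnected A := by
  obtain ⟨x, hx, rfl⟩ := hA
  exact isConnected_connectedComponentIn_iff.2 hx

/-- A small spherical cap around `z` is connected and misses `S`, so a side that is adherent to `z`
contains it. -/
theorem IsSide.exists_ball {S A : Set (E 4)} (hS : IsClosed S) (hA : IsSide S A) {z : E 4}
    (hz : z ∈ closure A) (hz1 : ‖z‖ = 1) (hzS : z ∉ S) : ∃ r > 0, S3 ∩ ball z r ⊆ A := by
  obtain ⟨r, hr, hrS⟩ := Metric.isOpen_iff.1 hS.isOpen_compl z hzS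
  set r' := min r 1 with hr'
  have hr'0 : 0 < r' := lt_min hr one_pos
  have hcap := isPreconnected_cap (m := z) (β := 1 / 4) hz1 hr'0 (min_le_right _ _) (by norm_num)
  have hin : ∀ y, ‖y‖ = 1 → ‖y - z‖ < r' → 1 / 4 < inner ℝ y z := by
    intro y hy hyz
    have h1 := norm_sub_sq_of_unit hy hz1
    have h2 : ‖y - z‖ < 1 := hyz.trans_le (min_le_right _ _)
    nlinarith [norm_nonneg (y - z)]
  have hsub : {y | ‖y‖ = 1 ∧ ‖y - z‖ < r' ∧ 1 / 4 < inner ℝ y z} ⊆ S3 \ S := by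
    rintro y ⟨hy, hyz, -⟩
    refine ⟨by simpa using hy, hrS ?_⟩
    rw [Metric.mem_ball, dist_eq_norm]
    exact hyz.trans_le (min_le_left _ _)
  refine ⟨r', hr'0, ?_⟩
  rcases subset_side_or_disjoint hA hcap hsub with h | h
  · rintro y ⟨hy, hyz⟩
    have hy1 : ‖y‖ = 1 := by simpa using hy
    rw [Metric.mem_ball, dist_eq_norm] at hyz
    exact h ⟨hy1, hyz, hin y hy1 hyz⟩
  · exfalso
    obtain ⟨y, hyA, hyz⟩ := Metric.mem_closure_iff.1 hz r' hr'0
    rw [dist_comm, dist_eq_norm] at hyz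
    have hy1 : ‖y‖ = 1 := by simpa using (hA.subset hyA).1
    exact Set.disjoint_left.1 h ⟨hy1, hyz, hin y hy1 hyz⟩ hyA

theorem exists_mem_ne_of_isClosedSurface {S : Set (E 4)} (hS : IsClosedSurface S) (x : E 4) :
    ∃ q ∈ S, q ≠ x := by
  obtain ⟨p, hp⟩ := hS.isConnected.nonempty
  obtain ⟨φ, V, hφ, u, hu, rfl⟩ := hS.exists_param p hp
  have himg : ∀ u ∈ V, φ u ∈ S := by
    intro u hu
    obtain ⟨U, -, hU⟩ := hφ.isOpen_image V subset_rfl hφ.isOpen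
    have : φ u ∈ S ∩ U := hU ▸ mem_image_of_mem φ hu
    exact this.1
  obtain ⟨δ, hδ, hδV⟩ := Metric.isOpen_iff.1 hφ.isOpen u hu
  have hu' : u + EuclideanSpace.single 0 (δ / 2) ∈ V := by
    apply hδV
    rw [Metric.mem_ball, dist_eq_norm, add_sub_cancel_left, PiLp.norm_single,
      Real.norm_of_nonneg (half_pos hδ).le]
    exact half_lt_self hδ
  by_cases h : φ u = x
  · refine ⟨_, himg _ hu', fun h' => ?_⟩
    have := hφ.injOn hu' hu (h'.trans h.symm)
    rw [add_eq_left] at this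
    have h2 : ‖(EuclideanSpace.single 0 (δ / 2) : E 2)‖ = 0 := by rw [this, norm_zero]
    rw [PiLp.norm_single, Real.norm_of_nonneg (half_pos hδ).le] at h2
    linarith
  · exact ⟨_, hp, h⟩

theorem dense_compl_preimage {S : Set (E 4)} {G : E 4 → E 4 → ℝ}
    (hG : ∀ x ∈ S, ∃ ν, IsStraightening S x (G x) ν) {q : E 4} {β : E 3 → E 4} {ρ : E 4 → E 3}
    (hβ1 : ∀ w, ‖β w‖ = 1) (hβq : ∀ w, β w ≠ q) (hρβ : ∀ w, ρ (β w) = w)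
    (hρ : ∀ z, z ≠ 0 → ‖z‖⁻¹ • z ≠ q → ContinuousAt ρ z ∧ β (ρ z) = ‖z‖⁻¹ • z) :
    Dense (β ⁻¹' S)ᶜ := by
  rw [dense_iff_inter_open]
  rintro O hO ⟨w, hwO⟩
  by_cases hwT : w ∈ β ⁻¹' S
  · obtain ⟨ν', hν'⟩ := hG _ hwT
    have hw0 : β w ≠ 0 := by intro h0; have := hβ1 w; rw [h0] at this; simp at this
    have hrw : ‖β w‖⁻¹ • β w = β w := by rw [hβ1, inv_one, one_smul]
    have hwρ := hρ (β w) hw0 (by rw [hrw]; exact hβq w)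
    have h1 : ∀ᶠ z in nhds (β w), ρ z ∈ O := by
      apply hwρ.1.eventually_mem
      rw [hρβ]; exact hO.mem_nhds hwO
    have hrc : ContinuousAt (fun z : E 4 => ‖z‖⁻¹ • z) (β w) :=
      (continuousAt_id.norm.inv₀ (norm_ne_zero_iff.2 hw0)).smul continuousAt_id
    have h2 : ∀ᶠ z in nhds (β w), ‖z‖⁻¹ • z ∈ ({q}ᶜ : Set (E 4)) := by
      apply hrc.eventually_mem
      rw [hrw]
      exact isOpen_compl_singleton.mem_nhds (hβq w)
    obtain ⟨N', hN'N, hN', hwN', -, hN'S, -, -, hcp', -⟩ :=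
      hν'.exists_nhds _ (Filter.inter_mem h1 (Filter.inter_mem h2 (isOpen_ne.mem_nhds hw0)))
    obtain ⟨y, -, hyN', hy⟩ := mem_closure_iff.1
      (hcp' ⟨hwN', (hN'S _ hwN').1 (by rw [hrw]; exact hwT)⟩) N' hN' hwN'
    refine ⟨ρ y, (hN'N hyN').1, fun hyT => ?_⟩
    rw [mem_preimage, (hρ y (hN'N hyN').2.2 (hN'N hyN').2.1).2] at hyT
    exact (ne_of_gt hy) ((hN'S y hyN').1 hyT)
  · exact ⟨w, hwO, hwT⟩

/-- If `A` met both halves near `x`, a path in `A` would join them. The local signs glue to a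
function `f` on a large ball of the chart that is locally constant off `S`, hence constant along the
path and on each half. Yet `f` changes sign across `S` at `x`. -/
theorem not_mem_side_or_of_isStraightening {S A : Set (E 4)} (hS : IsClosedSurface S)
    (hA : IsSide S A) {G : E 4 → E 4 → ℝ} (hG : ∀ x ∈ S, ∃ ν, IsStraightening S x (G x) ν)
    {x : E 4} (hx : x ∈ S) : ∃ N ∈ nhds x, (∀ z ∈ N, ‖z‖ = 1 → 0 < G x z → z ∉ A) ∨
      (∀ z ∈ N, ‖z‖ = 1 → G x z < 0 → z ∉ A) := by
  obtain ⟨ν, hν⟩ := hG x hx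
  have hSc : IsClosed S := hS.isCompact.isClosed
  have hx1 : ‖x‖ = 1 := by simpa using hS.subset_sphere hx
  have hx0 : x ≠ 0 := by intro h0; rw [h0] at hx1; simp at hx1
  -- The projection pole is taken on `S`, so that no path in `A` meets it and the whole side is
  -- visible in the chart.
  obtain ⟨q, hqS, hqx⟩ := exists_mem_ne_of_isClosedSurface hS x
  have hq1 : ‖q‖ = 1 := by simpa using hS.subset_sphere hqS
  obtain ⟨β, ρ, hβ, hβ1, hρβ, hβq, hρ⟩ := exists_sphere_chart hq1
  have hrx : ‖x‖⁻¹ • x = x := by rw [hx1, inv_one, one_smul]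
  have hr : ContinuousAt (fun z : E 4 => ‖z‖⁻¹ • z) x :=
    (continuousAt_id.norm.inv₀ (norm_ne_zero_iff.2 hx0)).smul continuousAt_id
  have hxρ := hρ x hx0 (by rwa [hrx, ne_comm])
  have hβx : β (ρ x) = x := by rw [hxρ.2, hrx]
  have hN₁ : ∀ᶠ z in nhds x, z ≠ 0 ∧ ‖z‖⁻¹ • z ≠ q ∧ ρ z ∈ ball (ρ x) 1 := by
    have h1 : ∀ᶠ z in nhds x, ‖z‖⁻¹ • z ∈ ({q}ᶜ : Set (E 4)) := by
      apply hr.eventually_mem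
      rw [hrx]
      exact isOpen_compl_singleton.mem_nhds (Ne.symm hqx)
    filter_upwards [isOpen_ne.mem_nhds hx0, h1,
      hxρ.1.eventually_mem (ball_mem_nhds (ρ x) one_pos)] with z h1 h2 h3
    exact ⟨h1, h2, h3⟩
  obtain ⟨N, hNN₁, hN, hxN, hGN, hNS, hpp, hpn, hcp, hcn⟩ := hν.exists_nhds _ hN₁
  refine ⟨N, hN.mem_nhds hxN, ?_⟩
  by_contra hcon
  push Not at hcon
  obtain ⟨⟨a, haN, ha1, haG, haA⟩, b, hbN, hb1, hbG, hbA⟩ := hcon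
  have hnotT : ∀ z ∈ N, G x z ≠ 0 → ρ z ∉ β ⁻¹' S := by
    intro z hz h0 hzT
    rw [mem_preimage, (hρ z (hNN₁ hz).1 (hNN₁ hz).2.1).2] at hzT
    exact h0 ((hNS z hz).1 hzT)
  have hTd : Dense (β ⁻¹' S)ᶜ := dense_compl_preimage hG hβ1 hβq hρβ hρ
  have hρc : ∀ U ⊆ N, ContinuousOn ρ U := fun U hU z hz =>
    (hρ z (hNN₁ (hU hz)).1 (hNN₁ (hU hz)).2.1).1.continuousWithinAt
  -- a path in the side
  have hAq : ∀ z ∈ A, z ≠ 0 ∧ ‖z‖ = 1 ∧ ‖z‖⁻¹ • z ≠ q := by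
    intro z hz
    have h1 : ‖z‖ = 1 := by simpa using (hA.subset hz).1
    refine ⟨by intro h0; rw [h0] at h1; simp at h1, h1, ?_⟩
    rw [h1, inv_one, one_smul]
    rintro rfl
    exact (hA.subset hz).2 hqS
  have hβρA : ∀ z ∈ A, β (ρ z) = z := by
    intro z hz
    rw [(hρ z (hAq z hz).1 (hAq z hz).2.2).2, (hAq z hz).2.1, inv_one, one_smul]
  have hA' : β ⁻¹' A = ρ '' A := by
    ext w; constructor
    · intro hw; exact ⟨β w, hw, hρβ w⟩
    · rintro ⟨z, hz, rfl⟩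
      rw [mem_preimage, hβρA z hz]; exact hz
  have hA'open : IsOpen (β ⁻¹' A) := by
    rw [isOpen_iff_mem_nhds]
    intro w hw
    obtain ⟨r, hr, hrA⟩ := hA.exists_ball hSc (subset_closure hw) (hβ1 w) (hA.subset hw).2
    have hw' : w ∈ β ⁻¹' ball (β w) r := mem_preimage.2 (mem_ball_self hr)
    refine Filter.mem_of_superset ((isOpen_ball.preimage hβ).mem_nhds hw') fun z hz => ?_
    exact hrA ⟨mem_sphere_zero_iff_norm.2 (hβ1 z), hz⟩
  have hA'conn : IsConnected (β ⁻¹' A) := by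
    rw [hA']
    exact hA.isConnected.image _ fun z hz =>
      (hρ z (hAq z hz).1 (hAq z hz).2.2).1.continuousWithinAt
  have hpath : JoinedIn (β ⁻¹' A) (ρ a) (ρ b) :=
    (hA'open.isConnected_iff_isPathConnected.1 hA'conn).joinedIn _
      (by rw [hA']; exact mem_image_of_mem _ haA) _ (by rw [hA']; exact mem_image_of_mem _ hbA)
  obtain ⟨γ, hγ⟩ := hpath
  have hγr : IsCompact (range γ) := isCompact_range γ.continuous
  obtain ⟨R, hR⟩ := (hγr.isBounded.union (isBounded_ball (x := ρ x) (r := 1))).subset_closedBall 0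
  obtain ⟨f, hf⟩ := exists_glue_of_compact hTd (agree_localSign hSc hG hβ hβ1)
    (isCompact_closedBall (0 : E 3) R) (convex_closedBall _ _)
  have hcont : ∀ w ∈ closedBall (0 : E 3) R, w ∉ β ⁻¹' S → ContinuousAt f w := by
    intro w hw hwT
    obtain ⟨ε, hε⟩ := hf w hw
    have hs : ∀ z, localSign S G β w z = 1 := fun z => if_neg hwT
    have h1 : ∀ᶠ z in nhds w, f z = ε := by
      have hT : ∀ᶠ z in nhds w, z ∉ β ⁻¹' S :=
        (hSc.preimage hβ).isOpen_compl.eventually_mem hwT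
      filter_upwards [hε, hT] with z hz hzT
      rw [hz hzT, hs, mul_one]
    exact continuousAt_const.congr (h1.mono fun z hz => hz.symm)
  have hconst : ∀ U : Set (E 3), IsPreconnected U → U ⊆ closedBall 0 R → (∀ w ∈ U, w ∉ β ⁻¹' S) →
      ∀ w ∈ U, ∀ w' ∈ U, f w = f w' := fun U hU hUR hUT w hw w' hw' =>
    hU.constant (fun z hz => (hcont z (hUR hz) (hUT z hz)).continuousWithinAt) hw hw'
  have hab : f (ρ a) = f (ρ b) := by
    refine hconst (range γ) (isPreconnected_range γ.continuous) (subset_union_left.trans hR) ?_ _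
      ⟨0, γ.source⟩ _ ⟨1, γ.target⟩
    rintro _ ⟨t, rfl⟩ ht
    exact (hA.subset (hγ t)).2 ht
  have hNR : ρ '' N ⊆ closedBall 0 R := by
    rintro _ ⟨z, hz, rfl⟩
    exact hR (Or.inr (hNN₁ hz).2.2)
  obtain ⟨ε, hε⟩ := hf (ρ x) (hNR ⟨x, hxN, rfl⟩)
  have hs : ∀ z, localSign S G β (ρ x) z = unitSign (G x (β z)) := fun z => by
    rw [localSign, if_pos (by rwa [hβx]), hβx]
  have hev : ∀ᶠ z in nhds x, (ρ z ∉ β ⁻¹' S → f (ρ z) = ε * unitSign (G x (‖z‖⁻¹ • z))) ∧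
      (z ≠ 0 ∧ (0 < G x z → 0 < G x (‖z‖⁻¹ • z)) ∧ (G x z < 0 → G x (‖z‖⁻¹ • z) < 0)) := by
    have hε' : ∀ᶠ z in nhds x, ρ z ∉ β ⁻¹' S →
        f (ρ z) = ε * localSign S G β (ρ x) (ρ z) := hxρ.1.eventually hε
    filter_upwards [hε', hN₁, hν.sign_normalized hx1] with z hz hz1 hz2
    refine ⟨fun hzT => ?_, hz2⟩
    rw [hz hzT, hs, (hρ z hz1.1 hz1.2.1).2]
  obtain ⟨O, hO, hOo, hxO⟩ := _root_.eventually_nhds_iff.1 hev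
  have hGx : G x x = 0 := (hNS x hxN).1 (by rwa [hrx])
  obtain ⟨y₁, hy₁O, hy₁N, hy₁⟩ := mem_closure_iff.1 (hcp ⟨hxN, hGx⟩) O hOo hxO
  obtain ⟨y₂, hy₂O, hy₂N, hy₂⟩ := mem_closure_iff.1 (hcn ⟨hxN, hGx⟩) O hOo hxO
  have hf₁ : f (ρ y₁) = ε := by
    rw [(hO y₁ hy₁O).1 (hnotT y₁ hy₁N (ne_of_gt hy₁)),
      unitSign_of_pos ((hO y₁ hy₁O).2.2.1 hy₁), mul_one]
  have hf₂ : f (ρ y₂) = ε * -1 := by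
    rw [(hO y₂ hy₂O).1 (hnotT y₂ hy₂N (ne_of_lt hy₂)),
      unitSign_of_neg ((hO y₂ hy₂O).2.2.2 hy₂)]
  have h₁ : f (ρ a) = f (ρ y₁) :=
    hconst (ρ '' (N ∩ {z | 0 < G x z})) (hpp.image _ (hρc _ inter_subset_left))
      ((image_mono inter_subset_left).trans hNR)
      (by rintro _ ⟨z, hz, rfl⟩; exact hnotT z hz.1 (ne_of_gt hz.2))
      _ ⟨a, ⟨haN, haG⟩, rfl⟩ _ ⟨y₁, ⟨hy₁N, hy₁⟩, rfl⟩
  have h₂ : f (ρ b) = f (ρ y₂) :=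
    hconst (ρ '' (N ∩ {z | G x z < 0})) (hpn.image _ (hρc _ inter_subset_left))
      ((image_mono inter_subset_left).trans hNR)
      (by rintro _ ⟨z, hz, rfl⟩; exact hnotT z hz.1 (ne_of_lt hz.2))
      _ ⟨b, ⟨hbN, hbG⟩, rfl⟩ _ ⟨y₂, ⟨hy₂N, hy₂⟩, rfl⟩
  have : ε = ε * -1 := hf₁.symm.trans (h₁.symm.trans (hab.trans (h₂.trans hf₂)))
  rw [left_eq_mul] at this
  exact absurd this (by decide)

/-- Some point of `S` is adherent to `A`, as otherwise `A` would be open and closed in the connected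
sphere. Adherence spreads to nearby points, since `A` contains the normalized half-neighbourhood it
meets, and connectedness of `S` finishes. -/
theorem subset_closure_side {S A : Set (E 4)} (hS : IsClosedSurface S) (hA : IsSide S A)
    {G : E 4 → E 4 → ℝ} (hG : ∀ x ∈ S, ∃ ν, IsStraightening S x (G x) ν) : S ⊆ closure A := by
  have hSc : IsClosed S := hS.isCompact.isClosed
  have hS1 : ∀ x ∈ S, ‖x‖ = 1 := fun x hx => by simpa using hS.subset_sphere hx
  have hA1 : ∀ x ∈ A, ‖x‖ = 1 := fun x hx => by simpa using (hA.subset hx).1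
  have hne0 : ∀ x : E 4, ‖x‖ = 1 → x ≠ 0 := by
    intro x h h0; rw [h0] at h; simp at h
  have hrc : ∀ x : E 4, x ≠ 0 → ContinuousAt (fun z : E 4 => ‖z‖⁻¹ • z) x := fun x hx0 =>
    (continuousAt_id.norm.inv₀ (norm_ne_zero_iff.2 hx0)).smul continuousAt_id
  have hclA : closure A ⊆ S3 := closure_minimal (fun z hz => (hA.subset hz).1) isClosed_sphere
  -- some point of the surface is adherent to the side
  have hex : ∃ x ∈ S, x ∈ closure A := by
    by_contra hcon
    push Not at hcon
    have hball : ∀ z ∈ closure A, ∃ r > 0, S3 ∩ ball z r ⊆ A := fun z hz =>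
      hA.exists_ball hSc hz (by simpa using hclA hz) (fun h => hcon z h hz)
    have hclosed : IsClosed A := by
      refine isClosed_of_closure_subset fun z hz => ?_
      obtain ⟨r, hr, h⟩ := hball z hz
      exact h ⟨hclA hz, mem_ball_self hr⟩
    have hSph : IsPreconnected (S3 : Set (E 4)) := by
      refine (isConnected_sphere ?_ 0 zero_le_one).isPreconnected
      rw [← Module.finrank_eq_rank, finrank_euclideanSpace_fin]
      norm_num
    have hO : IsOpen (⋃ z ∈ A, ⋃ r ∈ {r : ℝ | S3 ∩ ball z r ⊆ A}, ball z r) :=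
      isOpen_biUnion fun z _ => isOpen_biUnion fun r _ => isOpen_ball
    obtain ⟨p, hp⟩ := hS.isConnected.nonempty
    obtain ⟨a, ha⟩ := hA.isConnected.nonempty
    have hAO : ∀ z ∈ A, z ∈ ⋃ z ∈ A, ⋃ r ∈ {r : ℝ | S3 ∩ ball z r ⊆ A}, ball z r := by
      intro z hz
      obtain ⟨r, hr, h⟩ := hball z (subset_closure hz)
      exact mem_biUnion hz (mem_biUnion (show r ∈ {r : ℝ | S3 ∩ ball z r ⊆ A} from h)
        (mem_ball_self hr))
    obtain ⟨z, hz, hz1, hz2⟩ := hSph _ Aᶜ hO hclosed.isOpen_compl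
      (fun z _ => by
        by_cases h : z ∈ A
        · exact Or.inl (hAO z h)
        · exact Or.inr h)
      ⟨a, (hA.subset ha).1, hAO a ha⟩ ⟨p, hS.subset_sphere hp, fun h => (hA.subset h).2 hp⟩
    simp only [mem_iUnion] at hz1
    obtain ⟨y, -, r, h, hzr⟩ := hz1
    exact hz2 (h ⟨hz, hzr⟩)
  -- the set of such points is open in the surface
  have hloc : ∀ x ∈ S, x ∈ closure A → ∃ O, IsOpen O ∧ x ∈ O ∧ S ∩ O ⊆ closure A := by
    intro x hx hxA
    obtain ⟨ν, hν⟩ := hG x hx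
    obtain ⟨N, hN0, hN, hxN, -, hNS, hpp, hpn, hcp, hcn⟩ :=
      hν.exists_nhds {z | z ≠ 0} (isOpen_ne.mem_nhds (hne0 x (hS1 x hx)))
    refine ⟨N, hN, hxN, ?_⟩
    obtain ⟨a, haN, haA⟩ := mem_closure_iff.1 hxA N hN hxN
    have ha1 : ‖a‖⁻¹ • a = a := by rw [hA1 a haA, inv_one, one_smul]
    have key : ∀ H ⊆ N, IsPreconnected H → (∀ z ∈ H, G x z ≠ 0) → a ∈ H →
        N ∩ {z | G x z = 0} ⊆ closure H → S ∩ N ⊆ closure A := by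
      rintro H hHN hH hH0 haH hcl y ⟨hy, hyN⟩
      have hyr : ‖y‖⁻¹ • y = y := by rw [hS1 y hy, inv_one, one_smul]
      have himg : (fun z : E 4 => ‖z‖⁻¹ • z) '' H ⊆ A := by
        have h1 : IsPreconnected ((fun z : E 4 => ‖z‖⁻¹ • z) '' H) :=
          hH.image _ fun z hz => (hrc z (hN0 (hHN hz))).continuousWithinAt
        have h2 : (fun z : E 4 => ‖z‖⁻¹ • z) '' H ⊆ S3 \ S := by
          rintro _ ⟨z, hz, rfl⟩
          have hz0 : ‖z‖ ≠ 0 := norm_ne_zero_iff.2 (hN0 (hHN hz))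
          refine ⟨by simp [norm_smul, hz0], fun h => hH0 z hz ((hNS z (hHN hz)).1 h)⟩
        rcases subset_side_or_disjoint hA h1 h2 with h | h
        · exact h
        · exact absurd haA (Set.disjoint_left.1 h ⟨a, haH, ha1⟩)
      have hyH : y ∈ closure H := hcl ⟨hyN, (hNS y hyN).1 (by rwa [hyr])⟩
      have := (hrc y (hne0 y (hS1 y hy))).continuousWithinAt.mem_closure_image hyH
      rw [hyr] at this
      exact closure_mono himg this
    have hGa : G x a ≠ 0 := fun h => (hA.subset haA).2 (by
      have := (hNS a haN).2 h
      rwa [ha1] at this)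
    rcases lt_or_gt_of_ne hGa with h | h
    · exact key _ inter_subset_left hpn (fun z hz => ne_of_lt hz.2) ⟨haN, h⟩ hcn
    · exact key _ inter_subset_left hpp (fun z hz => ne_of_gt hz.2) ⟨haN, h⟩ hcp
  intro x hx
  by_contra hxA
  obtain ⟨p, hp, hpA⟩ := hex
  have hO : IsOpen (⋃ O ∈ {O : Set (E 4) | IsOpen O ∧ S ∩ O ⊆ closure A}, O) :=
    isOpen_biUnion fun O hO => hO.1
  have hmem : ∀ y ∈ S, y ∈ closure A → y ∈ ⋃ O ∈ {O : Set (E 4) | IsOpen O ∧ S ∩ O ⊆ closure A}, O := by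
    intro y hy hyA
    obtain ⟨O, hO, hyO, hOA⟩ := hloc y hy hyA
    exact mem_biUnion (show O ∈ {O : Set (E 4) | IsOpen O ∧ S ∩ O ⊆ closure A} from ⟨hO, hOA⟩) hyO
  obtain ⟨z, hz, hz1, hz2⟩ := hS.isConnected.isPreconnected _ (closure A)ᶜ hO
    isClosed_closure.isOpen_compl
    (fun y hy => by
      by_cases h : y ∈ closure A
      · exact Or.inl (hmem y hy h)
      · exact Or.inr h)
    ⟨p, hp, hmem p hp hpA⟩ ⟨x, hx, hxA⟩
  simp only [mem_iUnion] at hz1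
  obtain ⟨O, hO, hzO⟩ := hz1
  exact hz2 (hO.2 ⟨hz, hzO⟩)

/-- Near each of its points, a closed surface has the given side on exactly one side. -/
theorem isLocalSide_of_isSide {S A : Set (E 4)} (hS : IsClosedSurface S) (hA : IsSide S A)
    {x : E 4} (hx : x ∈ S) : IsLocalSide S A x := by
  have hex : ∀ x : E 4, ∃ G : E 4 → ℝ, x ∈ S → ∃ ν, IsStraightening S x G ν := by
    intro x
    by_cases hx : x ∈ S
    · obtain ⟨G, ν, h⟩ := exists_isStraightening hS hx
      exact ⟨G, fun _ => ⟨ν, h⟩⟩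
    · exact ⟨fun _ => 0, fun h => absurd h hx⟩
  choose G hG using hex
  obtain ⟨ν, hν⟩ := hG x hx
  have hx1 : ‖x‖ = 1 := by simpa using hS.subset_sphere hx
  have hx0 : x ≠ 0 := by intro h0; rw [h0] at hx1; simp at hx1
  obtain ⟨N₀, hN₀, hside⟩ := not_mem_side_or_of_isStraightening hS hA hG hx
  obtain ⟨N, hNN₀, hN, hxN, -, hNS, hpp, hpn, -, -⟩ :=
    hν.exists_nhds _ (Filter.inter_mem hN₀ (isOpen_ne.mem_nhds hx0))
  obtain ⟨a, haN, haA⟩ := mem_closure_iff.1 (subset_closure_side hS hA hG hx) N hN hxN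
  have hr1 : ∀ z : E 4, ‖z‖ = 1 → ‖z‖⁻¹ • z = z := fun z hz => by rw [hz, inv_one, one_smul]
  have ha1 : ‖a‖ = 1 := by simpa using (hA.subset haA).1
  have hGa : G x a ≠ 0 := fun h => (hA.subset haA).2 (by
    have := (hNS a haN).2 h
    rwa [hr1 a ha1] at this)
  have hGx : G x x = 0 := (hNS x hxN).1 (by rwa [hr1 x hx1])
  have key : ∀ H ⊆ N, IsPreconnected H → (∀ z ∈ H, G x z ≠ 0) → a ∈ H →
      ∀ z ∈ H, ‖z‖ = 1 → z ∈ A := by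
    intro H hHN hH hH0 haH z hz hz1
    have h1 : IsPreconnected ((fun z : E 4 => ‖z‖⁻¹ • z) '' H) :=
      hH.image _ fun z hz => ((continuousAt_id.norm.inv₀
        (norm_ne_zero_iff.2 (hNN₀ (hHN hz)).2)).smul continuousAt_id).continuousWithinAt
    have h2 : (fun z : E 4 => ‖z‖⁻¹ • z) '' H ⊆ S3 \ S := by
      rintro _ ⟨z, hz, rfl⟩
      have hz0 : ‖z‖ ≠ 0 := norm_ne_zero_iff.2 (hNN₀ (hHN hz)).2
      exact ⟨by simp [norm_smul, hz0], fun h => hH0 z hz ((hNS z (hHN hz)).1 h)⟩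
    rcases subset_side_or_disjoint hA h1 h2 with h | h
    · exact h ⟨z, hz, hr1 z hz1⟩
    · exact absurd haA (Set.disjoint_left.1 h ⟨a, haH, hr1 a ha1⟩)
  rcases lt_or_gt_of_ne hGa with h | h
  · have hneg : ∀ z ∈ N, ‖z‖ = 1 → 0 < G x z → z ∉ A := by
      rcases hside with h' | h'
      · exact fun z hz => h' z (hNN₀ hz).1
      · exact absurd haA (h' a (hNN₀ haN).1 ha1 h)
    refine ⟨fun z => -G x z, -ν, by rw [norm_neg, hν.norm_normal],
      by rw [inner_neg_right, hν.inner_normal, neg_zero], by simp [hGx], ?_, ?_⟩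
    · rw [map_neg]; exact hν.hasFDerivAt.neg
    · filter_upwards [hN.mem_nhds hxN] with z hz hz1
      refine ⟨fun hzS => ?_, fun hz0 => ?_, fun hz0 => ?_⟩
      · rw [(hNS z hz).1 (by rwa [hr1 z hz1]), neg_zero]
      · exact key _ inter_subset_left hpn (fun z hz => ne_of_lt hz.2) ⟨haN, h⟩ z
          ⟨hz, by simpa using hz0⟩ hz1
      · exact hneg z hz hz1 (by simpa using hz0)
  · have hneg : ∀ z ∈ N, ‖z‖ = 1 → G x z < 0 → z ∉ A := by
      rcases hside with h' | h'
      · exact absurd haA (h' a (hNN₀ haN).1 ha1 h)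
      · exact fun z hz => h' z (hNN₀ hz).1
    refine ⟨G x, ν, hν.norm_normal, hν.inner_normal, hGx, hν.hasFDerivAt, ?_⟩
    filter_upwards [hN.mem_nhds hxN] with z hz hz1
    exact ⟨fun hzS => (hNS z hz).1 (by rwa [hr1 z hz1]),
      fun hz0 => key _ inter_subset_left hpp (fun z hz => ne_of_gt hz.2) ⟨haN, h⟩ z ⟨hz, hz0⟩ hz1,
      fun hz0 => hneg z hz hz1 hz0⟩

/-! ### Regular surfaces: flatness, area, and distance to a point of the ball -/

theorem exists_flatAt_splits_of_isRegular {S A : Set (E 4)} {γ r₀ r : ℝ} {x : E 4}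
    (hS : IsClosedSurface S) (hA : IsSide S A) (hreg : IsRegular γ r₀ S)
    (hγ : γ ≤ 1 / 2000) (hx : x ∈ S) (hr : 0 < r) (hr0 : r < r₀) (hrγ : r < γ) :
    ∃ m, FlatAt S x r (20 * γ) m ∧ Splits A x r (20 * γ) m := by
  have hx1 : ‖x‖ = 1 := by simpa using hS.subset_sphere hx
  refine exists_flatAt_splits (r₁ := min r₀ γ) hS.subset_sphere hx1 hA (isLocalSide_of_isSide hS hA hx)
    (by linarith) (by linarith) ((min_le_right _ _).trans (by linarith)) ?_ r hr (lt_min hr0 hrγ)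
  intro r hr hr'
  obtain ⟨σ, φ, h⟩ := hreg x hx r hr (hr'.trans_le (min_le_left _ _))
  exact h.exists_flatAt hS.subset_sphere hx1 hr (hr'.trans_le (min_le_right _ _)).le (by linarith)

theorem IsRegularParam.area_le {S : Set (E 4)} {γ r : ℝ} {x : E 4} {σ : E 2 →ᵃⁱ[ℝ] E 4}
    {φ : E 2 → E 4} (h : IsRegularParam S γ r x σ φ) (hγ : 0 ≤ γ) (hr : 0 ≤ r) :
    μHE[2] (S ∩ ball x r) ≤ ENNReal.ofReal ((1 + γ) ^ 2 * (Real.pi * r ^ 2)) := by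
  refine (measure_mono h.subset_image).trans ?_
  refine (area_image_le (K := 1 + γ) (by linarith) (fun u hu w hw => ?_)).trans ?_
  · rw [dist_eq_norm, dist_eq_norm]
    exact h.upper u hu w hw
  · rw [area_ball_plane hr, ← ENNReal.ofReal_mul (by positivity)]

theorem exists_area_le_of_isRegular {r₀ : ℝ} (hr₀ : 0 < r₀) :
    ∃ C : ℝ, 0 < C ∧ ∀ (γ : ℝ) (S : Set (E 4)), 0 ≤ γ → γ ≤ 1 → S ⊆ S3 → IsRegular γ r₀ S →
      μHE[2] S ≤ ENNReal.ofReal C := by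
  obtain ⟨T, -, hTf, hT⟩ := (isCompact_sphere (0 : E 4) 1).finite_cover_balls
    (e := r₀ / 4) (by linarith)
  lift T to Finset (E 4) using hTf
  have hc0 : 0 < 4 * (Real.pi * (r₀ / 2) ^ 2) := by positivity
  refine ⟨(4 * (Real.pi * (r₀ / 2) ^ 2)) * (T.card + 1), by positivity, ?_⟩
  intro γ S hγ hγ1 hS hreg
  have h1 : ∀ z, μHE[2] (S ∩ ball z (r₀ / 4)) ≤ ENNReal.ofReal (4 * (Real.pi * (r₀ / 2) ^ 2)) := by
    intro z
    rcases (S ∩ ball z (r₀ / 4)).eq_empty_or_nonempty with h0 | ⟨x, hxS, hxz⟩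
    · rw [h0]; simp
    obtain ⟨σ, φ, h⟩ := hreg x hxS (r₀ / 2) (by linarith) (by linarith)
    have hsub : S ∩ ball z (r₀ / 4) ⊆ S ∩ ball x (r₀ / 2) := by
      rintro y ⟨hy, hyz⟩
      refine ⟨hy, ?_⟩
      rw [Metric.mem_ball] at hyz hxz ⊢
      linarith [dist_triangle_right y x z]
    refine (measure_mono hsub).trans ((h.area_le hγ (by linarith)).trans ?_)
    apply ENNReal.ofReal_le_ofReal
    gcongr
    nlinarith
  have hcov : S ⊆ ⋃ z ∈ T, S ∩ ball z (r₀ / 4) := by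
    intro y hy
    obtain ⟨z, hz, hyz⟩ := mem_iUnion₂.1 (hT (hS hy))
    exact mem_iUnion₂.2 ⟨z, hz, hy, hyz⟩
  calc μHE[2] S ≤ μHE[2] (⋃ z ∈ T, S ∩ ball z (r₀ / 4)) := measure_mono hcov
    _ ≤ ∑ z ∈ T, μHE[2] (S ∩ ball z (r₀ / 4)) := measure_biUnion_finset_le _ _
    _ ≤ ∑ z ∈ T, ENNReal.ofReal (4 * (Real.pi * (r₀ / 2) ^ 2)) := Finset.sum_le_sum fun z _ => h1 z
    _ = ENNReal.ofReal (4 * (Real.pi * (r₀ / 2) ^ 2) * T.card) := by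
        rw [Finset.sum_const, nsmul_eq_mul, ← ENNReal.ofReal_natCast,
          ← ENNReal.ofReal_mul (by positivity), mul_comm]
    _ ≤ _ := by
        apply ENNReal.ofReal_le_ofReal
        gcongr
        linarith

/-- Seen from a point `v`, a regular surface is nearly orthogonal to the segment from `v` to the
nearest point of the surface. -/
theorem le_norm_sub_sq_of_nearest {S : Set (E 4)} {γ θ r₀ : ℝ} {x₀ w v : E 4}
    (hreg : IsRegular γ r₀ S) (hx₀ : x₀ ∈ S) (hmin : ∀ w ∈ S, ‖x₀ - v‖ ≤ ‖w - v‖) (hγ : 0 ≤ γ)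
    (hγθ : γ ≤ θ ^ 2) (hθ : 0 < θ) (hθ1 : θ ≤ 1 / 8) (hw : w ∈ S) (hwr : 2 * ‖w - x₀‖ < r₀) :
    (1 - 12 * θ) * (‖x₀ - v‖ ^ 2 + ‖w - x₀‖ ^ 2) ≤ ‖w - v‖ ^ 2 := by
  set d := ‖w - x₀‖ with hd
  set h := ‖x₀ - v‖ with hh
  have hd0 : 0 ≤ d := norm_nonneg _
  have hh0 : 0 ≤ h := norm_nonneg _
  rcases hd0.eq_or_lt with hd00 | hdpos
  · have : w = x₀ := by
      rw [eq_comm, hd, norm_eq_zero, sub_eq_zero] at hd00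
      exact hd00
    rw [this, ← hh, ← hd00]
    nlinarith [sq_nonneg h]
  obtain ⟨σ, φ, hφ⟩ := hreg x₀ hx₀ (2 * d) (by linarith) hwr
  have hwmem : w ∈ φ '' ball 0 (2 * d) := by
    apply hφ.subset_image
    refine ⟨hw, ?_⟩
    rw [Metric.mem_ball, dist_eq_norm, ← hd]
    linarith
  obtain ⟨p, hp, hpw⟩ := hwmem
  -- The competitor `φ (θ • p)` is close to the point a fraction `θ` along the chord from `x₀` to
  -- `w`. Minimality of `x₀` bounds the first variation from below, with an error of relative size
  -- `γ / θ ≤ θ`.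
  have hp' : θ • p ∈ ball (0 : E 2) (2 * d) := by
    rw [mem_ball_zero_iff] at hp ⊢
    rw [norm_smul, Real.norm_of_nonneg hθ.le]
    nlinarith [norm_nonneg p]
  set w' := φ (θ • p) with hw'
  have hw'S : w' ∈ S := (hφ.image_subset (mem_image_of_mem φ hp')).1
  set e := w' - x₀ - θ • (w - x₀) with he
  have he_norm : ‖e‖ ≤ 4 * θ ^ 2 * d := by
    have h1 : e = (w' - σ (θ • p)) - θ • (w - σ p) := by
      rw [he, AffineIsometry.apply_eq_add σ (θ • p), AffineIsometry.apply_eq_add σ p,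
        hφ.center_plane, map_smul]
      module
    have h2 := hφ.close _ hp'
    have h3 := hφ.close _ hp
    rw [hpw] at h3
    calc ‖e‖ ≤ ‖w' - σ (θ • p)‖ + ‖θ • (w - σ p)‖ := by rw [h1]; exact norm_sub_le _ _
      _ ≤ γ * (2 * d) + θ * (γ * (2 * d)) := by
          rw [norm_smul, Real.norm_of_nonneg hθ.le]
          gcongr
      _ ≤ 4 * γ * d := by nlinarith [mul_nonneg hγ hd0]
      _ ≤ 4 * θ ^ 2 * d := by gcongr
  have hw'x : w' - x₀ = θ • (w - x₀) + e := by rw [he]; abel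
  have hw'n : ‖w' - x₀‖ ≤ 3 / 2 * θ * d := by
    calc ‖w' - x₀‖ ≤ ‖θ • (w - x₀)‖ + ‖e‖ := by rw [hw'x]; exact norm_add_le _ _
      _ ≤ θ * d + 4 * θ ^ 2 * d := by
          rw [norm_smul, Real.norm_of_nonneg hθ.le]; gcongr
      _ ≤ 3 / 2 * θ * d := by nlinarith [mul_nonneg hθ.le hd0]
  have h1 : 0 ≤ ‖w' - x₀‖ ^ 2 + 2 * inner ℝ (w' - x₀) (x₀ - v) := by
    have h2 := hmin w' hw'S
    have h3 : ‖w' - v‖ ^ 2 = ‖w' - x₀‖ ^ 2 + 2 * inner ℝ (w' - x₀) (x₀ - v) + h ^ 2 := by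
      rw [← norm_add_sq_real, sub_add_sub_cancel]
    have h4 : h ^ 2 ≤ ‖w' - v‖ ^ 2 := by gcongr
    linarith
  have h2 : inner ℝ (w' - x₀) (x₀ - v) = θ * inner ℝ (w - x₀) (x₀ - v) + inner ℝ e (x₀ - v) := by
    rw [hw'x, inner_add_left, inner_smul_left]; simp
  have h3 : inner ℝ e (x₀ - v) ≤ 4 * θ ^ 2 * d * h :=
    (real_inner_le_norm _ _).trans (mul_le_mul_of_nonneg_right he_norm hh0)
  have h4 : ‖w' - x₀‖ ^ 2 ≤ (3 / 2 * θ * d) ^ 2 := by gcongr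
  have h5 : ‖w - v‖ ^ 2 = d ^ 2 + 2 * inner ℝ (w - x₀) (x₀ - v) + h ^ 2 := by
    rw [hd, hh, ← norm_add_sq_real, sub_add_sub_cancel]
  have h6 : 0 ≤ θ * (9 / 4 * θ * d ^ 2 + 8 * θ * d * h + 2 * inner ℝ (w - x₀) (x₀ - v)) := by
    linarith only [h1, h2, h3, h4]
  have h7 := nonneg_of_mul_nonneg_right h6 hθ
  rw [h5]
  nlinarith only [h7, hθ, sq_nonneg (d - h), mul_nonneg hθ.le (sq_nonneg (d - h)),
    mul_nonneg hθ.le (sq_nonneg d), mul_nonneg hθ.le (sq_nonneg h)]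

/-! ### Area of the conformal image of a regular surface. -/

theorem one_sub_norm_sq_le {v x : E 4} (hv : ‖v‖ < 1) (hx : ‖x‖ = 1) :
    1 - ‖v‖ ^ 2 ≤ 2 * ‖x - v‖ := by
  have h1 := one_sub_norm_le_norm_sub (v := v) hx
  nlinarith [norm_nonneg v]

theorem distortion_le {γ θ : ℝ} (hγ : 0 ≤ γ) (hγθ : γ ≤ θ ^ 2) (hθ : 0 < θ) (hθ1 : θ ≤ 1 / 1000) :
    0 < (1 - 12 * θ) * (1 - γ) ^ 2 ∧
      (1 + γ) ^ 2 ≤ (1 + 100 * θ) * ((1 - 12 * θ) * (1 - γ) ^ 2) ^ 2 := by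
  have h1 : γ ≤ θ / 1000 := by nlinarith
  have h2 : 1 - 13 * θ ≤ (1 - 12 * θ) * (1 - γ) ^ 2 := by
    nlinarith [mul_nonneg hγ hθ.le, mul_nonneg (by linarith : 0 ≤ 1 - 12 * θ) (sq_nonneg γ)]
  refine ⟨by linarith, ?_⟩
  have h3 : (1 - 13 * θ) ^ 2 ≤ ((1 - 12 * θ) * (1 - γ) ^ 2) ^ 2 := by
    gcongr
    linarith
  calc (1 + γ) ^ 2 ≤ (1 + 100 * θ) * (1 - 13 * θ) ^ 2 := by
        nlinarith [mul_nonneg hθ.le (sq_nonneg θ), mul_nonneg hγ hγ]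
    _ ≤ _ := by gcongr

/-- By near-orthogonality, `‖φ u - v‖²` is at least about `h² + ‖u‖²`, so the exact chord formula
puts the map in the form required by `area_image_le_lintegral`. The kernel integrates to at most
about `(q / h)² π`, and `q ≤ 2 h`. -/
theorem area_conf_ball_le {S : Set (E 4)} {γ θ r₀ r : ℝ} {x₀ v : E 4} (hS : S ⊆ S3)
    (hreg : IsRegular γ r₀ S) (hv : ‖v‖ < 1) (hx₀ : x₀ ∈ S)
    (hmin : ∀ w ∈ S, ‖x₀ - v‖ ≤ ‖w - v‖) (hγ : 0 ≤ γ) (hγθ : γ ≤ θ ^ 2) (hθ : 0 < θ)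
    (hθ1 : θ ≤ 1 / 1000) (hr : 0 < r) (hrr : 4 * r ≤ r₀) :
    μHE[2] (conf v '' (S ∩ ball x₀ r)) ≤ ENNReal.ofReal (4 * Real.pi * (1 + 100 * θ)) := by
  obtain ⟨σ, φ, hφ⟩ := hreg x₀ hx₀ r hr (by linarith)
  have hx1 : ‖x₀‖ = 1 := by simpa using hS hx₀
  set q := 1 - ‖v‖ ^ 2 with hq
  have hq0 : 0 < q := one_sub_norm_sq_pos hv
  set h := ‖x₀ - v‖ with hh
  have hh0 : 0 < h := norm_sub_pos_of_unit hv hx1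
  have hqh : q ≤ 2 * h := one_sub_norm_sq_le hv hx1
  obtain ⟨hk0, hk1⟩ := distortion_le hγ hγθ hθ hθ1
  have hγ1 : γ ≤ 1 / 1000 := by nlinarith
  set k := (1 - 12 * θ) * (1 - γ) ^ 2 with hk
  set B : E 2 → ℝ := fun u => √(k * (h ^ 2 + ‖u‖ ^ 2)) with hB
  have hBpos : ∀ u, 0 < B u := fun u => Real.sqrt_pos.2 (by positivity)
  set g : E 2 → ℝ := fun u => √(q * (1 + γ)) / B u with hg
  have hφS : ∀ u ∈ ball (0 : E 2) r, φ u ∈ S := fun u hu =>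
    (hφ.image_subset (mem_image_of_mem φ hu)).1
  have hφ1 : ∀ u ∈ ball (0 : E 2) r, ‖φ u‖ = 1 := fun u hu => by simpa using hS (hφS u hu)
  have hBle : ∀ u ∈ ball (0 : E 2) r, B u ≤ ‖φ u - v‖ := by
    intro u hu
    have h0 : (0 : E 2) ∈ ball (0 : E 2) r := mem_ball_self hr
    have hlow := hφ.lower u hu 0 h0
    have hup := hφ.upper u hu 0 h0
    rw [hφ.center, sub_zero] at hlow hup
    rw [mem_ball_zero_iff] at hu
    have h1 := le_norm_sub_sq_of_nearest hreg hx₀ hmin hγ hγθ hθ (by linarith) (hφS u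
      (mem_ball_zero_iff.2 hu)) (by nlinarith [norm_nonneg u])
    apply Real.sqrt_le_iff.2 ⟨norm_nonneg _, _⟩
    refine le_trans ?_ h1
    have h2 : ((1 - γ) * ‖u‖) ^ 2 ≤ ‖φ u - x₀‖ ^ 2 := by
      have : 0 ≤ (1 - γ) * ‖u‖ := mul_nonneg (by linarith) (norm_nonneg _)
      gcongr
    have h3 : (1 - γ) ^ 2 * h ^ 2 ≤ h ^ 2 := by
      have : (1 - γ) ^ 2 ≤ 1 := pow_le_one₀ (by linarith) (by linarith)
      exact mul_le_of_le_one_left (sq_nonneg h) this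
    rw [hk, mul_assoc]
    refine mul_le_mul_of_nonneg_left ?_ (by linarith)
    rw [mul_add, ← mul_pow (1 - γ) ‖u‖]
    linarith
  have hsub : conf v '' (S ∩ ball x₀ r) ⊆ (fun u => conf v (φ u)) '' ball 0 r := by
    rintro _ ⟨w, hw, rfl⟩
    obtain ⟨u, hu, rfl⟩ := hφ.subset_image hw
    exact ⟨u, hu, rfl⟩
  have hmain := area_image_le_lintegral (f := fun u => conf v (φ u)) (U := ball (0 : E 2) r)
    measurableSet_ball (g := g) (by fun_prop)
    (fun u _ => div_pos (Real.sqrt_pos.2 (by positivity)) (hBpos u)) (by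
      intro u hu w hw
      rw [dist_eq_norm, dist_eq_norm, norm_conf_sub hv (hφ1 u hu) (hφ1 w hw)]
      have e1 : g u * g w = q * (1 + γ) / (B u * B w) := by
        rw [hg, div_mul_div_comm, Real.mul_self_sqrt (by positivity)]
      rw [e1, div_mul_eq_mul_div]
      have := hφ.upper u hu w hw
      have hu1 := hBle u hu
      have hw1 := hBle w hw
      have hu2 := hBpos u
      have hw2 := hBpos w
      rw [mul_assoc q]
      gcongr)
  refine (measure_mono hsub).trans (hmain.trans ?_)
  have hg4 : ∀ u, g u ^ 4 = (q * (1 + γ) / k) ^ 2 * (1 / (h ^ 2 + ‖u‖ ^ 2) ^ 2) := by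
    intro u
    have e1 : √(q * (1 + γ)) ^ 2 = q * (1 + γ) := Real.sq_sqrt (by positivity)
    have e2 : √(k * (h ^ 2 + ‖u‖ ^ 2)) ^ 2 = k * (h ^ 2 + ‖u‖ ^ 2) := Real.sq_sqrt (by positivity)
    have e3 : g u ^ 4 = (√(q * (1 + γ)) ^ 2) ^ 2 / (√(k * (h ^ 2 + ‖u‖ ^ 2)) ^ 2) ^ 2 := by
      simp only [hg, hB]
      rw [div_pow, ← pow_mul, ← pow_mul]
    rw [e3, e1, e2]
    field_simp
  calc ∫⁻ u in ball (0 : E 2) r, ENNReal.ofReal (g u ^ 4)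
      ≤ ∫⁻ u : E 2, ENNReal.ofReal (g u ^ 4) := setLIntegral_le_lintegral _ _
    _ = ENNReal.ofReal ((q * (1 + γ) / k) ^ 2) *
        ∫⁻ u : E 2, ENNReal.ofReal (1 / (h ^ 2 + ‖u‖ ^ 2) ^ 2) := by
        rw [← lintegral_const_mul' _ _ ENNReal.ofReal_ne_top]
        refine lintegral_congr fun u => ?_
        rw [hg4, ENNReal.ofReal_mul (by positivity)]
    _ = ENNReal.ofReal ((q * (1 + γ) / k) ^ 2 * (Real.pi / h ^ 2)) := by
        rw [lintegral_plane_kernel hh0, ← ENNReal.ofReal_mul (by positivity)]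
    _ ≤ _ := by
        apply ENNReal.ofReal_le_ofReal
        have e1 : (q * (1 + γ) / k) ^ 2 * (Real.pi / h ^ 2) =
            Real.pi * (q ^ 2 / h ^ 2) * ((1 + γ) ^ 2 / k ^ 2) := by
          field_simp
        have e2 : q ^ 2 / h ^ 2 ≤ 4 := by
          rw [div_le_iff₀ (by positivity)]
          nlinarith
        have e3 : (1 + γ) ^ 2 / k ^ 2 ≤ 1 + 100 * θ := by
          rw [div_le_iff₀ (by positivity)]
          exact hk1
        rw [e1]
        calc Real.pi * (q ^ 2 / h ^ 2) * ((1 + γ) ^ 2 / k ^ 2) ≤ Real.pi * 4 * (1 + 100 * θ) := by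
              gcongr
          _ = _ := by ring

/-- Away from the nearest point the surface keeps a fixed distance from `v`, so the map contracts
there by `O(1 - ‖v‖)`. Since the total area is bounded in terms of `r₀`, that part contributes
little. -/
theorem exists_area_conf_le {θ r₀ : ℝ} (hθ : 0 < θ) (hθ1 : θ ≤ 1 / 1000) (hr₀ : 0 < r₀) :
    ∃ η : ℝ, 0 < η ∧ ∀ (γ : ℝ) (S : Set (E 4)) (v : E 4), 0 ≤ γ → γ ≤ θ ^ 2 → S ⊆ S3 →
      IsCompact S → S.Nonempty → IsRegular γ r₀ S → ‖v‖ < 1 → 1 - η ≤ ‖v‖ →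
      μHE[2] (conf v '' S) ≤ ENNReal.ofReal (4 * Real.pi * (1 + 101 * θ)) := by
  obtain ⟨C, hC, hCS⟩ := exists_area_le_of_isRegular hr₀
  set r := r₀ / 4 with hr
  have hr0 : 0 < r := by positivity
  refine ⟨min 1 (Real.pi * θ * r ^ 4 / (16 * C)), by positivity, ?_⟩
  set η := min 1 (Real.pi * θ * r ^ 4 / (16 * C)) with hη
  intro γ S v hγ hγθ hS hSc hSne hreg hv hvη
  have hη0 : 0 < η := by positivity
  have hη1 : η ≤ 1 := min_le_left _ _
  have hη2 : η * (16 * C) ≤ Real.pi * θ * r ^ 4 := by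
    rw [← le_div_iff₀ (by positivity)]; exact min_le_right _ _
  obtain ⟨x₀, hx₀, hmin⟩ := hSc.exists_isMinOn hSne
    (f := fun w : E 4 => ‖w - v‖) (by fun_prop)
  replace hmin : ∀ w ∈ S, ‖x₀ - v‖ ≤ ‖w - v‖ := fun w hw => hmin hw
  have h1 := area_conf_ball_le hS hreg hv hx₀ hmin hγ hγθ hθ hθ1 hr0 (by rw [hr]; linarith)
  set q := 1 - ‖v‖ ^ 2 with hq
  have hq0 : 0 < q := one_sub_norm_sq_pos hv
  have hqη : q ≤ 2 * η := by nlinarith [norm_nonneg v]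
  have hfar : ∀ w ∈ S \ ball x₀ r, r / 2 ≤ ‖w - v‖ := by
    rintro w ⟨hw, hwr⟩
    rw [Metric.mem_ball, not_lt, dist_eq_norm] at hwr
    have := hmin w hw
    have h3 : ‖w - x₀‖ ≤ ‖w - v‖ + ‖x₀ - v‖ := by
      rw [← norm_neg (x₀ - v), neg_sub]
      exact norm_sub_le_norm_sub_add_norm_sub w v x₀
    linarith
  have h2 : μHE[2] (conf v '' (S \ ball x₀ r)) ≤ ENNReal.ofReal (4 * Real.pi * θ) := by
    refine (area_image_le (K := q / (r / 2) ^ 2) (by positivity) ?_).trans ?_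
    · intro x hx y hy
      have hx1 : ‖x‖ = 1 := by simpa using hS hx.1
      have hy1 : ‖y‖ = 1 := by simpa using hS hy.1
      rw [dist_eq_norm, dist_eq_norm, norm_conf_sub hv hx1 hy1, div_mul_eq_mul_div, pow_two (r / 2)]
      have hx2 := hfar x hx
      have hy2 := hfar y hy
      gcongr
    · have h3 : μHE[2] (S \ ball x₀ r) ≤ ENNReal.ofReal C :=
        (measure_mono sdiff_subset).trans (hCS γ S hγ (by nlinarith) hS hreg)
      refine (mul_le_mul_right h3 _).trans ?_
      rw [← ENNReal.ofReal_mul (by positivity)]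
      apply ENNReal.ofReal_le_ofReal
      have e1 : (q / (r / 2) ^ 2) ^ 2 * C = 16 * C * q ^ 2 / r ^ 4 := by
        field_simp
        ring
      rw [e1, div_le_iff₀ (by positivity)]
      have e2 : q ^ 2 ≤ 4 * η := by nlinarith
      nlinarith
  have hcov : conf v '' S ⊆ conf v '' (S ∩ ball x₀ r) ∪ conf v '' (S \ ball x₀ r) := by
    rw [← image_union, inter_union_sdiff]
  refine (measure_mono hcov).trans ((measure_union_le _ _).trans ((add_le_add h1 h2).trans ?_))
  rw [← ENNReal.ofReal_add (by positivity) (by positivity)]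
  apply ENNReal.ofReal_le_ofReal
  linarith

/-! ### Level sets near a flat piece -/

theorem dist_le_of_mem_level {M : Set (E 4)} {x w : E 4} {c τ : ℝ} (hM : ∀ y ∈ M, ‖y‖ = 1)
    (hτ : 0 ≤ τ) (hc : τ ^ 2 = 2 - 2 * c) (hx : x ∈ level M c) (hw : w ∈ M) : τ ≤ ‖w - x‖ := by
  have h1 := norm_sub_sq_of_unit (hM w hw) hx.1
  have h2 := hx.2.1 w hw
  rw [real_inner_comm] at h2
  exact (sq_le_sq₀ hτ (norm_nonneg _)).1 (by linarith)

theorem norm_sub_foot {M : Set (E 4)} {x y : E 4} {c τ : ℝ} (hM : ∀ y ∈ M, ‖y‖ = 1)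
    (hτ : 0 ≤ τ) (hc : τ ^ 2 = 2 - 2 * c) (hx : x ∈ level M c) (hy : y ∈ M)
    (hxy : inner ℝ x y = c) : ‖x - y‖ = τ := by
  have h1 := norm_sub_sq_of_unit hx.1 (hM y hy)
  rw [hxy, ← hc] at h1
  exact (sq_eq_sq₀ (norm_nonneg _) hτ).1 h1

/-- All heights are `τ` up to `θ² τ`. This settles chords longer than `2 θ τ`; for shorter ones, the
vector from the foot to `x` has length `τ` and almost full height, so it is nearly `τ N`, and the
foot inequality applies. -/
theorem abs_inner_le_of_heights {M X : Set (E 4)} {N : E 4} {c τ θ : ℝ}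
    (hM : ∀ y ∈ M, ‖y‖ = 1) (hN : ‖N‖ = 1) (hτ : 0 < τ) (hc : τ ^ 2 = 2 - 2 * c) (hθ : 0 ≤ θ)
    (hX : X ⊆ level M c) (hlow : ∀ x ∈ X, (1 - θ ^ 2) * τ ≤ inner ℝ x N)
    (hfoot : ∀ x ∈ X, ∀ y ∈ M, inner ℝ x y = c → |inner ℝ y N| ≤ θ ^ 2 * τ) :
    ∀ x ∈ X, ∀ x' ∈ X, |inner ℝ (x' - x) N| ≤ 3 * θ * ‖x' - x‖ := by
  have hup : ∀ x ∈ X, inner ℝ x N ≤ (1 + θ ^ 2) * τ := by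
    intro x hx
    obtain ⟨y, hy, hxy⟩ := (hX hx).2.2
    have h1 := norm_sub_foot hM hτ.le hc (hX hx) hy hxy
    have h2 : inner ℝ (x - y) N ≤ τ := by
      have := real_inner_le_norm (x - y) N
      rwa [h1, hN, mul_one] at this
    rw [inner_sub_left] at h2
    linarith [(abs_le.1 (hfoot x hx y hy hxy)).2]
  have key : ∀ x ∈ X, ∀ x' ∈ X, inner ℝ (x - x') N ≤ 3 * θ * ‖x - x'‖ := by
    intro x hx x' hx'
    obtain ⟨y, hy, hxy⟩ := (hX hx).2.2
    rcases le_total (2 * θ * τ) ‖x - x'‖ with hfar | hnear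
    · have h1 := hup x hx
      have h2 := hlow x' hx'
      rw [inner_sub_left]
      nlinarith [mul_le_mul_of_nonneg_left hfar hθ, mul_nonneg hθ (norm_nonneg (x - x'))]
    · set d := ‖x - x'‖ with hd
      have hd0 : 0 ≤ d := norm_nonneg _
      have h1 : inner ℝ (x' - x) y ≤ 0 := inner_sub_foot_nonpos (hX hx') hy hxy
      have h2 : inner ℝ (x' - x) x = -(d ^ 2 / 2) := by
        rw [inner_sub_self_of_unit (hX hx).1 (hX hx').1, hd, norm_sub_rev]
      have h3 : inner ℝ (x - x') (x - y) ≤ d ^ 2 / 2 := by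
        rw [← neg_sub x' x, inner_neg_left, inner_sub_right, h2]
        linarith
      have hf := norm_sub_foot hM hτ.le hc (hX hx) hy hxy
      have h4 : ‖τ • N - (x - y)‖ ≤ 2 * θ * τ := by
        have e1 : ‖τ • N - (x - y)‖ ^ 2 ≤ (2 * θ * τ) ^ 2 := by
          rw [norm_sub_sq_real, norm_smul, hN, hf, inner_smul_left, Real.norm_of_nonneg hτ.le,
            real_inner_comm, inner_sub_left]
          have := hlow x hx
          have h5 := (abs_le.1 (hfoot x hx y hy hxy)).2
          simp only [conj_trivial]
          nlinarith [mul_le_mul_of_nonneg_left this hτ.le, mul_le_mul_of_nonneg_left h5 hτ.le]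
        exact (sq_le_sq₀ (norm_nonneg _) (by positivity)).1 e1
      have h5 : inner ℝ (x - x') (τ • N - (x - y)) ≤ d * (2 * θ * τ) :=
        (real_inner_le_norm _ _).trans (mul_le_mul_of_nonneg_left h4 hd0)
      rw [inner_sub_right, inner_smul_right] at h5
      have h6 : τ * inner ℝ (x - x') N ≤ τ * (3 * θ * d) := by
        nlinarith [mul_le_mul_of_nonneg_left hnear hd0]
      exact le_of_mul_le_mul_left h6 hτ
  intro x hx x' hx'
  rw [abs_le]
  refine ⟨?_, key x' hx' x hx⟩
  have := key x hx x' hx'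
  rw [← neg_sub x' x, inner_neg_left, norm_neg] at this
  linarith

/-- Density of `M` forces points at distance `τ` to have height at least `(1 - θ²) τ` in absolute
value. The splitting fixes its sign, so that only one of the two parallel sheets is present, and
that sheet is flat with normals `N` and `y₁`. -/
theorem area_level_le_of_flatAt {M A X : Set (E 4)} {y₁ z N : E 4} {c τ R ε θ ρ : ℝ}
    (hM : ∀ y ∈ M, ‖y‖ = 1) (hy₁ : ‖y₁‖ = 1) (hN : FlatAt M y₁ R ε N) (hs : Splits A y₁ R ε N)
    (hτ : 0 < τ) (hc : τ ^ 2 = 2 - 2 * c) (hθ : 0 ≤ θ) (hθ1 : θ ≤ 1 / 15) (hRθ : R ≤ 3 * θ)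
    (hεR : ε * R ≤ θ ^ 2 * τ) (hX : X ⊆ level M c) (hside : X ⊆ A ∨ Disjoint X A)
    (hXR : ∀ x ∈ X, ‖x - y₁‖ + τ < R) (hρ : 0 ≤ ρ) (hXρ : X ⊆ closedBall z ρ) :
    μHE[2] X ≤ ENNReal.ofReal (1 / (1 - 5 / 2 * (3 * θ) ^ 2) * (Real.pi * ρ ^ 2)) := by
  have hθ2 : θ ^ 2 ≤ 1 / 225 := by nlinarith
  have habs : ∀ x ∈ X, (1 - θ ^ 2) * τ ≤ |inner ℝ x N| := by
    intro x hx
    obtain ⟨w, hw, hwx⟩ := hN.dense x (hX hx).1 (by linarith [hXR x hx])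
    have := dist_le_of_mem_level hM hτ.le hc (hX hx) hw
    linarith
  have hpos : ∀ x ∈ X, ε * R < |inner ℝ x N| := by
    intro x hx
    have := habs x hx
    nlinarith
  have hfoot : ∀ x ∈ X, ∀ y ∈ M, inner ℝ x y = c → |inner ℝ y N| ≤ θ ^ 2 * τ := by
    intro x hx y hy hxy
    refine (hN.flat y hy ?_).trans hεR
    have h1 := norm_sub_foot hM hτ.le hc (hX hx) hy hxy
    have h2 : ‖y - y₁‖ ≤ ‖x - y‖ + ‖x - y₁‖ := by
      rw [← norm_neg (x - y), neg_sub]; exact norm_sub_le_norm_sub_add_norm_sub y x y₁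
    linarith [hXR x hx]
  have hkey : ∀ x ∈ X, ∀ x' ∈ X, |inner ℝ (x' - x) N| ≤ 3 * θ * ‖x' - x‖ := by
    rcases hside with hA | hA
    · refine abs_inner_le_of_heights hM hN.norm_normal hτ hc hθ hX (fun x hx => ?_) hfoot
      rcases le_or_gt 0 (inner ℝ x N) with h | h
      · have := habs x hx; rwa [abs_of_nonneg h] at this
      · have h1 := hpos x hx
        rw [abs_of_neg h] at h1
        exact absurd (hA hx) (hs.2 x (hX hx).1 (by linarith [hXR x hx]) (by linarith))
    · have hneg := abs_inner_le_of_heights (N := -N) hM (by rw [norm_neg, hN.norm_normal]) hτ hc hθ hX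
        (fun x hx => by
          rw [inner_neg_right]
          rcases le_or_gt (inner ℝ x N) 0 with h | h
          · have := habs x hx; rwa [abs_of_nonpos h] at this
          · have h1 := hpos x hx
            rw [abs_of_pos h] at h1
            exact absurd (hs.1 x (hX hx).1 (by linarith [hXR x hx]) h1)
              (Set.disjoint_left.1 hA hx))
        (fun x hx y hy hxy => by rw [inner_neg_right, abs_neg]; exact hfoot x hx y hy hxy)
      intro x hx x' hx'
      have := hneg x hx x' hx'
      rwa [inner_neg_right, abs_neg] at this
  refine area_le_of_flat hρ (by linarith) (by linarith) hXρ hN.norm_normal hy₁ ?_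
    (fun x hx x' hx' => hkey x' hx' x hx) (fun x hx x' hx' => ?_)
  · rw [real_inner_comm, hN.inner_normal, abs_zero]; linarith
  · refine (abs_inner_sub_le_of_unit (ρ := R) (hX hx').1 (hX hx).1 ?_ ?_).trans ?_
    · linarith [hXR x' hx']
    · linarith [hXR x hx]
    · gcongr

/-- The area of a thin one-sided level set near flat pieces of `M` is almost at most that of `M`. -/
theorem mul_area_level_le_of_flatAt {M A X : Set (E 4)} {c τ ε : ℝ} {a : ℝ≥0∞}
    (hM : ∀ y ∈ M, ‖y‖ = 1) (hMm : MeasurableSet M) (hMf : μHE[2] M ≠ ⊤) (hτ : 0 < τ)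
    (hτ1 : τ ≤ 1 / 20000) (hc : τ ^ 2 = 2 - 2 * c) (hε : ε * 400 ≤ 1 / 10000)
    (hX : X ⊆ level M c) (hXm : MeasurableSet X) (hXf : μHE[2] X ≠ ⊤)
    (hside : X ⊆ A ∨ Disjoint X A)
    (hflat : ∀ x ∈ X, ∀ y ∈ M, inner ℝ x y = c →
      a ≤ μHE[2] (M ∩ ball y (99 * τ)) ∧
      ∃ N, FlatAt M y (400 * τ) ε N ∧ Splits A y (400 * τ) ε N) :
    a * μHE[2] X ≤ ENNReal.ofReal (101 / 100 * (Real.pi * (100 * τ) ^ 2)) * μHE[2] M := by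
  -- The counting radius is large against `τ`, so passing from `x` to its foot costs only the ratio
  -- `100 : 99`. Scale `400 τ` accommodates two points of one such ball together with their feet.
  refine mul_measure_le_of_ball μHE[2] (R := 100 * τ) hXm hMm hXf hMf (fun x hx => ?_)
    (fun y _ => ?_)
  · obtain ⟨y, hy, hxy⟩ := (hX hx).2.2
    refine (hflat x hx y hy hxy).1.trans (measure_mono ?_)
    rintro w ⟨hw, hwy⟩
    refine ⟨hw, ?_⟩
    rw [Metric.mem_ball] at hwy ⊢
    have h1 := norm_sub_foot hM hτ.le hc (hX hx) hy hxy
    rw [← dist_eq_norm] at h1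
    linarith [dist_triangle_right w x y]
  · rcases (X ∩ ball y (100 * τ)).eq_empty_or_nonempty with h0 | ⟨x₁, hx₁, hx₁y⟩
    · rw [h0]; simp
    obtain ⟨y₁, hy₁, hxy₁⟩ := (hX hx₁).2.2
    obtain ⟨-, N, hN, hs⟩ := hflat x₁ hx₁ y₁ hy₁ hxy₁
    refine (area_level_le_of_flatAt (X := X ∩ ball y (100 * τ)) (θ := 1 / 100) (z := y)
      (ρ := 100 * τ) hM (hM y₁ hy₁) hN hs hτ hc (by norm_num) (by norm_num) (by linarith)
      (by nlinarith) (inter_subset_left.trans hX) ?_ ?_ (by positivity)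
      (inter_subset_right.trans ball_subset_closedBall)).trans ?_
    · rcases hside with h | h
      · exact Or.inl (inter_subset_left.trans h)
      · exact Or.inr (h.mono_left inter_subset_left)
    · rintro x ⟨hx, hxy⟩
      have h1 := norm_sub_foot hM hτ.le hc (hX hx₁) hy₁ hxy₁
      rw [← dist_eq_norm] at h1 ⊢
      rw [Metric.mem_ball] at hxy hx₁y
      linarith [dist_triangle_right x x₁ y, dist_triangle x x₁ y₁]
    · apply ENNReal.ofReal_le_ofReal
      refine mul_le_mul_of_nonneg_right ?_ (by positivity)
      norm_num

/-! ### Flatness of the image under a conformal transformation -/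

/-- On an image ball with `R ‖x - v‖ ≤ c (1 - ‖v‖²)` the distance to `v`, and with it the conformal
factor, varies by a factor `1 + O(c)`. The last bound gives the scale at which flatness of the
original is needed. -/
theorem conf_scale {v x x' : E 4} {c R : ℝ} (hv : ‖v‖ < 1) (hx : ‖x‖ = 1) (hx' : ‖x'‖ = 1)
    (hc : c ≤ 1 / 100) (hRc : R * ‖x - v‖ ≤ c * (1 - ‖v‖ ^ 2))
    (h : ‖conf v x' - conf v x‖ < R) :
    ‖x' - x‖ ≤ c * ‖x' - v‖ ∧ ‖x - v‖ ≤ (1 + c) * ‖x' - v‖ ∧ (1 - c) * ‖x' - v‖ ≤ ‖x - v‖ ∧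
      ‖x' - x‖ < 2 * R * ‖x - v‖ ^ 2 / (1 - ‖v‖ ^ 2) := by
  have hD := norm_sub_pos_of_unit hv hx
  have hD' := norm_sub_pos_of_unit hv hx'
  have hq := one_sub_norm_sq_pos hv
  rw [norm_conf_sub hv hx' hx, div_lt_iff₀ (by positivity)] at h
  set D := ‖x - v‖
  set D' := ‖x' - v‖
  set q := 1 - ‖v‖ ^ 2
  set d := ‖x' - x‖ with hd
  have hd0 : 0 ≤ d := norm_nonneg _
  have h1 : d ≤ c * D' := by
    have : q * d ≤ q * (c * D') := by nlinarith
    exact le_of_mul_le_mul_left this hq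
  have h2 : D ≤ D' + d := by
    have := norm_sub_le_norm_sub_add_norm_sub x x' v
    rw [norm_sub_rev x x'] at this
    linarith
  have h3 : D' ≤ D + d := by
    have := norm_sub_le_norm_sub_add_norm_sub x' x v
    linarith
  refine ⟨h1, by linarith, by linarith, ?_⟩
  rw [lt_div_iff₀ hq]
  have hR : 0 < R := by
    by_contra hR
    push Not at hR
    have : R * (D' * D) ≤ 0 := mul_nonpos_of_nonpos_of_nonneg hR (by positivity)
    nlinarith
  have h4 : D' ≤ 2 * D := by nlinarith
  nlinarith [mul_pos hR hD]

/-- The height of `conf v x'` over the tangent plane at `conf v x`. -/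
theorem abs_inner_conf_sub_le {v x x' m : E 4} {c R : ℝ} (hv : ‖v‖ < 1) (hx : ‖x‖ = 1)
    (hx' : ‖x'‖ = 1) (hm : ‖m‖ = 1) (hxm : inner ℝ x m = 0) (hR : 0 < R)
    (hRc : R * ‖x - v‖ ≤ c * (1 - ‖v‖ ^ 2)) (h : ‖conf v x' - conf v x‖ < R) :
    |inner ℝ (conf v x') (confNormal v x m) - (1 - ‖v‖ ^ 2) * inner ℝ x' m / ‖x' - v‖ ^ 2|
      ≤ c * R := by
  have hq := one_sub_norm_sq_pos hv
  have e1 := inner_conf_sub_confNormal (m := m) hv hx hx'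
  rw [inner_sub_left, inner_confNormal_conf hv hx hxm, sub_zero, inner_sub_left, hxm, sub_zero] at e1
  set q := 1 - ‖v‖ ^ 2
  rw [e1, add_sub_cancel_left, abs_mul, abs_div, abs_of_pos hq,
    abs_of_nonneg (sq_nonneg ‖conf v x' - conf v x‖)]
  have e2 : |inner ℝ (x - v) m| ≤ ‖x - v‖ := by
    have := abs_real_inner_le_norm (x - v) m
    rwa [hm, mul_one] at this
  calc |inner ℝ (x - v) m| / q * ‖conf v x' - conf v x‖ ^ 2
      ≤ ‖x - v‖ / q * R ^ 2 := by gcongr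
    _ = (R * ‖x - v‖) * R / q := by ring
    _ ≤ (c * q) * R / q := by gcongr
    _ = c * R := by field_simp

theorem conf_error_le {D D' q R ε c : ℝ} (hD : 0 < D) (hD' : 0 < D') (hq : 0 < q) (hR : 0 < R)
    (hε : 0 ≤ ε) (hc1 : c ≤ 1 / 100) (h : D ≤ (1 + c) * D') :
    q * (ε * (2 * R * D ^ 2 / q)) / D' ^ 2 ≤ 3 * ε * R := by
  have e2 : D ≤ 6 / 5 * D' := by nlinarith
  have e3 : D ^ 2 ≤ 3 / 2 * D' ^ 2 := by nlinarith
  have e4 : q * (ε * (2 * R * D ^ 2 / q)) = ε * R * (2 * D ^ 2) := by field_simp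
  rw [e4, div_le_iff₀ (by positivity)]
  have : ε * R * (2 * D ^ 2) ≤ ε * R * (3 * D' ^ 2) :=
    mul_le_mul_of_nonneg_left (by linarith) (by positivity)
  linarith

theorem conf_dense_aux {H ε c R : ℝ} (hε : 0 ≤ ε) (hc : 0 ≤ c) (hc1 : c ≤ 1 / 100) (hR : 0 < R)
    (hH : H ≤ R) : (H + c * R + 3 * ε * R) / (1 - 2 * c) ≤ H + (4 * ε + 40 * c) * R := by
  rw [div_le_iff₀ (by linarith)]
  have h1 := mul_le_mul_of_nonneg_left hH hc
  have h2 : 0 ≤ ε * R := by positivity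
  have h3 : 0 ≤ c * R := by positivity
  have h4 : c * (ε * R) ≤ 1 / 100 * (ε * R) := mul_le_mul_of_nonneg_right hc1 h2
  have h5 : c * (c * R) ≤ 1 / 100 * (c * R) := mul_le_mul_of_nonneg_right hc1 h3
  linarith

section Transfer

variable {S A : Set (E 4)} {v x m : E 4} {ε c R : ℝ}

/-- A point of `S` near `z₀` is mapped near its image by the chord formula; the old height
multiplied by the conformal factor is the new height up to `c R`. -/
theorem exists_mem_conf_near (hS : S ⊆ S3) (hv : ‖v‖ < 1) (hx : ‖x‖ = 1) (hε : 0 ≤ ε)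
    (hε1 : ε ≤ 1 / 100) (hc : 0 ≤ c) (hc1 : c ≤ 1 / 100) (hR : 0 < R)
    (hRc : R * ‖x - v‖ ≤ c * (1 - ‖v‖ ^ 2))
    (h : FlatAt S x (2 * R * ‖x - v‖ ^ 2 / (1 - ‖v‖ ^ 2)) ε m) {z₀ : E 4} (hz₀ : ‖z₀‖ = 1)
    (hz₀R : ‖conf v z₀ - conf v x‖ < R) :
    ∃ w ∈ S, ‖conf v w - conf v z₀‖ ≤
      |inner ℝ (conf v z₀) (confNormal v x m)| + (4 * ε + 40 * c) * R := by
  have hD := norm_sub_pos_of_unit hv hx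
  have hq := one_sub_norm_sq_pos hv
  have hD' := norm_sub_pos_of_unit hv hz₀
  obtain ⟨h1, h2, -, h4⟩ := conf_scale hv hx hz₀ hc1 hRc hz₀R
  obtain ⟨w, hw, hwz⟩ := h.dense z₀ hz₀ h4
  have hw1 : ‖w‖ = 1 := by simpa using hS hw
  have hDw := norm_sub_pos_of_unit hv hw1
  refine ⟨w, hw, ?_⟩
  rw [norm_conf_sub hv hw1 hz₀]
  have e1 := abs_inner_conf_sub_le hv hx hz₀ h.norm_normal h.inner_normal hR hRc hz₀R
  have e2 := conf_error_le hD hD' hq hR hε hc1 h2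
  have e3 : |inner ℝ z₀ m| ≤ c * ‖z₀ - v‖ := by
    have := abs_real_inner_le_norm (z₀ - x) m
    rw [h.norm_normal, mul_one, inner_sub_left, h.inner_normal, sub_zero] at this
    linarith
  have e7 : |inner ℝ (conf v z₀) (confNormal v x m)| ≤ R := by
    have := abs_real_inner_le_norm (conf v z₀ - conf v x) (confNormal v x m)
    rw [norm_confNormal hv hx h.norm_normal, mul_one, inner_sub_left,
      inner_confNormal_conf hv hx h.inner_normal, sub_zero] at this
    linarith
  set D := ‖x - v‖ with hDdef
  set q := 1 - ‖v‖ ^ 2 with hqdef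
  set r := 2 * R * D ^ 2 / q with hr
  set D' := ‖z₀ - v‖ with hD'def
  set H := |inner ℝ (conf v z₀) (confNormal v x m)| with hH
  have hr0 : 0 < r := by positivity
  have e4 : ε * r ≤ c * D' := by
    have i1 : r ≤ 2 * c * D := by
      rw [hr, div_le_iff₀ hq]
      nlinarith only [hRc, hD]
    have i2 : ε * r ≤ 1 / 100 * (2 * c * D) := mul_le_mul hε1 i1 hr0.le (by norm_num)
    have i3 : D ≤ 2 * D' := by nlinarith only [h2, hc1, hD']
    have i4 : c * D ≤ c * (2 * D') := mul_le_mul_of_nonneg_left i3 hc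
    have i5 : 0 ≤ c * D' := by positivity
    linarith
  have e5 : (1 - 2 * c) * D' ≤ ‖w - v‖ := by
    have := norm_sub_le_norm_sub_add_norm_sub z₀ w v
    rw [norm_sub_rev z₀ w] at this
    linarith
  have e6 : q * |inner ℝ z₀ m| / D' ^ 2 ≤ H + c * R := by
    have i1 := abs_sub_abs_le_abs_sub (q * inner ℝ z₀ m / D' ^ 2)
      (inner ℝ (conf v z₀) (confNormal v x m))
    rw [abs_sub_comm, abs_div, abs_mul, abs_of_pos hq, abs_of_nonneg (sq_nonneg D')] at i1
    linarith
  have h12 : 0 < 1 - 2 * c := by linarith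
  have hpos : 0 < (1 - 2 * c) * D' := by positivity
  calc q * ‖w - z₀‖ / (‖w - v‖ * D')
      ≤ q * (|inner ℝ z₀ m| + ε * r) / (((1 - 2 * c) * D') * D') := by gcongr
    _ = (q * |inner ℝ z₀ m| / D' ^ 2 + q * (ε * r) / D' ^ 2) / (1 - 2 * c) := by
        field_simp
    _ ≤ (H + c * R + 3 * ε * R) / (1 - 2 * c) := by gcongr
    _ ≤ H + (4 * ε + 40 * c) * R := conf_dense_aux hε hc hc1 hR e7

/-- Flatness is inherited by the image under `conf v`, at scales that are small compared with the
scale of the map. -/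
theorem flatAt_conf (hS : S ⊆ S3) (hv : ‖v‖ < 1) (hx : ‖x‖ = 1) (hε : 0 ≤ ε)
    (hε1 : ε ≤ 1 / 100) (hc : 0 ≤ c) (hc1 : c ≤ 1 / 100) (hR : 0 < R)
    (hRc : R * ‖x - v‖ ≤ c * (1 - ‖v‖ ^ 2))
    (h : FlatAt S x (2 * R * ‖x - v‖ ^ 2 / (1 - ‖v‖ ^ 2)) ε m) :
    FlatAt (conf v '' S) (conf v x) R (4 * ε + 40 * c) (confNormal v x m) := by
  have hD := norm_sub_pos_of_unit hv hx
  have hq := one_sub_norm_sq_pos hv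
  refine ⟨norm_confNormal hv hx h.norm_normal, ?_, ?_, ?_⟩
  · exact inner_confNormal_conf hv hx h.inner_normal
  · rintro _ ⟨w, hw, rfl⟩ hwR
    have hw1 : ‖w‖ = 1 := by simpa using hS hw
    have hD' := norm_sub_pos_of_unit hv hw1
    obtain ⟨-, h2, -, h4⟩ := conf_scale hv hx hw1 hc1 hRc hwR
    have e1 := abs_inner_conf_sub_le hv hx hw1 h.norm_normal h.inner_normal hR hRc hwR
    have e3 := conf_error_le hD hD' hq hR hε hc1 h2
    have e2 : |(1 - ‖v‖ ^ 2) * inner ℝ w m / ‖w - v‖ ^ 2| ≤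
        (1 - ‖v‖ ^ 2) * (ε * (2 * R * ‖x - v‖ ^ 2 / (1 - ‖v‖ ^ 2))) / ‖w - v‖ ^ 2 := by
      rw [abs_div, abs_mul, abs_of_pos hq, abs_of_nonneg (sq_nonneg ‖w - v‖)]
      gcongr
      exact h.flat w hw h4
    have e4 := abs_sub_abs_le_abs_sub (inner ℝ (conf v w) (confNormal v x m))
      ((1 - ‖v‖ ^ 2) * inner ℝ w m / ‖w - v‖ ^ 2)
    have h5 : 0 ≤ ε * R := by positivity
    have h6 : 0 ≤ c * R := by positivity
    linarith
  · intro z hz hzR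
    have hFz₀ := conf_conf_neg hv hz
    obtain ⟨w, hw, hwz⟩ := exists_mem_conf_near hS hv hx hε hε1 hc hc1 hR hRc h
      (z₀ := conf (-v) z) (norm_conf (by rwa [norm_neg]) hz) (by rwa [hFz₀])
    rw [hFz₀] at hwz
    exact ⟨_, mem_image_of_mem _ hw, hwz⟩

theorem splits_conf (hA : A ⊆ S3) (hv : ‖v‖ < 1) (hx : ‖x‖ = 1) (hε : 0 ≤ ε) (hc : 0 ≤ c)
    (hc1 : c ≤ 1 / 100) (hR : 0 < R) (hRc : R * ‖x - v‖ ≤ c * (1 - ‖v‖ ^ 2)) (hm : ‖m‖ = 1)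
    (hxm : inner ℝ x m = 0) (hs : Splits A x (2 * R * ‖x - v‖ ^ 2 / (1 - ‖v‖ ^ 2)) ε m) :
    Splits (conf v '' A) (conf v x) R (4 * ε + 40 * c) (confNormal v x m) := by
  have hD := norm_sub_pos_of_unit hv hx
  have hq := one_sub_norm_sq_pos hv
  have h5 : 0 ≤ ε * R := by positivity
  have h6 : 0 ≤ c * R := by positivity
  constructor
  · intro z hz hzR hzN
    have hz₀ : ‖conf (-v) z‖ = 1 := norm_conf (by rwa [norm_neg]) hz
    have hFz₀ : conf v (conf (-v) z) = z := conf_conf_neg hv hz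
    set z₀ := conf (-v) z
    have hz₀R : ‖conf v z₀ - conf v x‖ < R := by rwa [hFz₀]
    obtain ⟨-, h2, -, h4⟩ := conf_scale hv hx hz₀ hc1 hRc hz₀R
    have hD' := norm_sub_pos_of_unit hv hz₀
    have e1 := (abs_le.1 (abs_inner_conf_sub_le hv hx hz₀ hm hxm hR hRc hz₀R)).2
    rw [hFz₀] at e1
    have e2 := conf_error_le hD hD' hq hR hε hc1 h2
    refine ⟨z₀, hs.1 z₀ hz₀ h4 ?_, hFz₀⟩
    have e3 : (1 - ‖v‖ ^ 2) * (ε * (2 * R * ‖x - v‖ ^ 2 / (1 - ‖v‖ ^ 2))) / ‖z₀ - v‖ ^ 2 <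
        (1 - ‖v‖ ^ 2) * inner ℝ z₀ m / ‖z₀ - v‖ ^ 2 := by linarith
    rw [div_lt_div_iff_of_pos_right (by positivity)] at e3
    exact lt_of_mul_lt_mul_left e3 hq.le
  · rintro z hz hzR hzN ⟨z₀, hz₀A, hFz₀⟩
    have hz₀ : ‖z₀‖ = 1 := by simpa using hA hz₀A
    have hz₀R : ‖conf v z₀ - conf v x‖ < R := by rwa [hFz₀]
    obtain ⟨-, h2, -, h4⟩ := conf_scale hv hx hz₀ hc1 hRc hz₀R
    have hD' := norm_sub_pos_of_unit hv hz₀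
    have e1 := (abs_le.1 (abs_inner_conf_sub_le hv hx hz₀ hm hxm hR hRc hz₀R)).1
    rw [hFz₀] at e1
    have e2 := conf_error_le hD hD' hq hR hε hc1 h2
    refine hs.2 z₀ hz₀ h4 ?_ hz₀A
    have e3 : (1 - ‖v‖ ^ 2) * inner ℝ z₀ m / ‖z₀ - v‖ ^ 2 <
        (1 - ‖v‖ ^ 2) * (-(ε * (2 * R * ‖x - v‖ ^ 2 / (1 - ‖v‖ ^ 2)))) / ‖z₀ - v‖ ^ 2 := by
      rw [mul_neg, neg_div]
      linarith
    rw [div_lt_div_iff_of_pos_right (by positivity)] at e3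
    exact lt_of_mul_lt_mul_left e3 hq.le

end Transfer

/-! ### Lower area bound for small balls of the image. -/

theorem distortion_le' {c γ : ℝ} (hγ : 0 ≤ γ) (hγc : γ ≤ c) (hc : 0 < c) (hc1 : c ≤ 1 / 100) :
    (1 - 40 * c) * ((1 + 2 * c) ^ 4 / (1 - γ) ^ 2) ≤ (1 - 10 * c) ^ 2 := by
  have h1 : 0 < 1 - γ := by linarith
  rw [← mul_div_assoc, div_le_iff₀ (by positivity)]
  have f1 : (1 + 2 * c) ^ 2 ≤ 1 + 5 * c := by nlinarith
  have f2 : (1 + 2 * c) ^ 4 ≤ 1 + 13 * c := by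
    have : (1 + 2 * c) ^ 4 = ((1 + 2 * c) ^ 2) ^ 2 := by ring
    rw [this]
    have : ((1 + 2 * c) ^ 2) ^ 2 ≤ (1 + 5 * c) ^ 2 := by gcongr
    nlinarith
  have f3 : 1 - 2 * c ≤ (1 - γ) ^ 2 := by nlinarith
  have f4 : (1 - 40 * c) * (1 + 2 * c) ^ 4 ≤ (1 - 40 * c) * (1 + 13 * c) :=
    mul_le_mul_of_nonneg_left f2 (by linarith)
  have f5 : (1 - 10 * c) ^ 2 * (1 - 2 * c) ≤ (1 - 10 * c) ^ 2 * (1 - γ) ^ 2 := by gcongr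
  nlinarith only [f4, f5, hc, hc1, mul_pos hc hc]

/-- At scale `ρ` the map is nearly a homothety of factor `q / D²`. The parametrized disk of radius
`ρ D² / q`, shrunk by `1 - 10 c` to stay in the target ball, has inverse Lipschitz constant `K`. -/
theorem le_area_conf_ball {S : Set (E 4)} {γ r₀ c ρ : ℝ} {v x : E 4} (hS : S ⊆ S3)
    (hreg : IsRegular γ r₀ S) (hv : ‖v‖ < 1) (hx : x ∈ S) (hγ : 0 ≤ γ) (hγc : γ ≤ c) (hc : 0 < c)
    (hc1 : c ≤ 1 / 100) (hρ : 0 < ρ) (hρc : ρ * ‖x - v‖ ≤ c * (1 - ‖v‖ ^ 2))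
    (hρr : ρ * ‖x - v‖ ^ 2 / (1 - ‖v‖ ^ 2) < r₀) :
    ENNReal.ofReal ((1 - 40 * c) * (Real.pi * ρ ^ 2)) ≤
      μHE[2] (conf v '' S ∩ ball (conf v x) ρ) := by
  have hx1 : ‖x‖ = 1 := by simpa using hS hx
  have hD := norm_sub_pos_of_unit hv hx1
  have hq := one_sub_norm_sq_pos hv
  set D := ‖x - v‖ with hDdef
  set q := 1 - ‖v‖ ^ 2 with hqdef
  obtain ⟨σ, φ, hφ⟩ := hreg x hx (ρ * D ^ 2 / q) (by positivity) hρr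
  set r := ρ * D ^ 2 / q with hr
  have hrq : r * q = ρ * D ^ 2 := by rw [hr]; field_simp
  have hr0 : 0 < r := by positivity
  have hrD : r ≤ c * D := by
    rw [hr, div_le_iff₀ hq]
    nlinarith
  have hsub : ball (0 : E 2) ((1 - 10 * c) * r) ⊆ ball 0 r := ball_subset_ball (by nlinarith)
  have hφS : ∀ u ∈ ball (0 : E 2) r, φ u ∈ S := fun u hu =>
    (hφ.image_subset (mem_image_of_mem φ hu)).1
  have hφ1 : ∀ u ∈ ball (0 : E 2) r, ‖φ u‖ = 1 := fun u hu => by simpa using hS (hφS u hu)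
  have hclose : ∀ u ∈ ball (0 : E 2) ((1 - 10 * c) * r), ‖φ u - x‖ ≤ (1 + c) * ((1 - 10 * c) * r) := by
    intro u hu
    have hup := hφ.upper u (hsub hu) 0 (mem_ball_self hr0)
    rw [hφ.center, sub_zero] at hup
    rw [mem_ball_zero_iff] at hu
    refine hup.trans ?_
    gcongr
  have hcr : (1 + c) * ((1 - 10 * c) * r) ≤ (1 - 5 * c) * r := by nlinarith [mul_pos hc hr0]
  have hD2 : ∀ u ∈ ball (0 : E 2) ((1 - 10 * c) * r),
      (1 - 2 * c) * D ≤ ‖φ u - v‖ ∧ ‖φ u - v‖ ≤ (1 + 2 * c) * D := by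
    intro u hu
    have h1 := hclose u hu
    have h2 : ‖φ u - x‖ ≤ c * D := by
      have : 0 ≤ c * r := by positivity
      linarith
    have h0 : 0 ≤ c * D := by positivity
    have h3 := norm_sub_le_norm_sub_add_norm_sub (φ u) x v
    have h4 := norm_sub_le_norm_sub_add_norm_sub x (φ u) v
    rw [norm_sub_rev x (φ u)] at h4
    constructor <;> linarith
  set K := (1 + 2 * c) ^ 2 * D ^ 2 / (q * (1 - γ)) with hK
  have hγ1 : 0 < 1 - γ := by linarith
  have hK0 : 0 < K := by positivity
  have hexp := area_le_of_expanding (g := fun u => conf v (φ u))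
    (U := ball (0 : E 2) ((1 - 10 * c) * r)) hK0.le (by
      intro u hu w hw
      rw [dist_eq_norm, dist_eq_norm, norm_conf_sub hv (hφ1 u (hsub hu)) (hφ1 w (hsub hw))]
      have h1 := hφ.lower u (hsub hu) w (hsub hw)
      have h2 := hD2 u hu
      have h3 := hD2 w hw
      have h4 := norm_sub_pos_of_unit hv (hφ1 u (hsub hu))
      have h5 := norm_sub_pos_of_unit hv (hφ1 w (hsub hw))
      have h6 : ‖φ u - v‖ * ‖φ w - v‖ ≤ ((1 + 2 * c) * D) * ((1 + 2 * c) * D) := by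
        gcongr
        · exact h2.2
        · exact h3.2
      calc ‖u - w‖ = K * (q * ((1 - γ) * ‖u - w‖) / (((1 + 2 * c) * D) * ((1 + 2 * c) * D))) := by
            rw [hK]; field_simp
        _ ≤ K * (q * ‖φ u - φ w‖ / (‖φ u - v‖ * ‖φ w - v‖)) := by gcongr)
  rw [area_ball_plane (by nlinarith)] at hexp
  have himg : (fun u => conf v (φ u)) '' ball (0 : E 2) ((1 - 10 * c) * r) ⊆
      conf v '' S ∩ ball (conf v x) ρ := by
    rintro _ ⟨u, hu, rfl⟩
    refine ⟨mem_image_of_mem _ (hφS u (hsub hu)), ?_⟩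
    rw [Metric.mem_ball, dist_eq_norm, norm_conf_sub hv (hφ1 u (hsub hu)) hx1]
    have h1 := hclose u hu
    have h2 := (hD2 u hu).1
    have h4 := norm_sub_pos_of_unit hv (hφ1 u (hsub hu))
    rw [div_lt_iff₀ (by positivity)]
    have h5 : q * ‖φ u - x‖ ≤ (1 - 5 * c) * (ρ * D ^ 2) := by
      rw [← hrq]
      have := mul_le_mul_of_nonneg_left (h1.trans hcr) hq.le
      linarith
    have h6 : ρ * ((1 - 2 * c) * D * D) ≤ ρ * (‖φ u - v‖ * D) := by gcongr
    have h7 : 0 < c * (ρ * D ^ 2) := by positivity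
    linarith
  have h1 := hexp.trans (mul_le_mul_right (measure_mono himg) _)
  have h2 : ENNReal.ofReal (K ^ 2) * ENNReal.ofReal ((1 - 40 * c) * (Real.pi * ρ ^ 2)) ≤
      ENNReal.ofReal (Real.pi * ((1 - 10 * c) * r) ^ 2) := by
    rw [← ENNReal.ofReal_mul (by positivity)]
    apply ENNReal.ofReal_le_ofReal
    have e1 : K ^ 2 * ((1 - 40 * c) * (Real.pi * ρ ^ 2)) =
        Real.pi * r ^ 2 * ((1 - 40 * c) * ((1 + 2 * c) ^ 4 / (1 - γ) ^ 2)) := by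
      rw [hK, hr]; field_simp
    have e2 := distortion_le' hγ hγc hc hc1
    rw [e1, mul_pow]
    calc Real.pi * r ^ 2 * ((1 - 40 * c) * ((1 + 2 * c) ^ 4 / (1 - γ) ^ 2))
        ≤ Real.pi * r ^ 2 * (1 - 10 * c) ^ 2 := by gcongr
      _ = _ := by ring
  exact (ENNReal.mul_le_mul_iff_right (ENNReal.ofReal_pos.2 (by positivity)).ne'
    ENNReal.ofReal_ne_top).1 (h2.trans h1)

/-! ### Level sets at small distance -/

/-- Here `p` bounds from below the distance from the image point to `-v`, which is `q / D`. The
conclusions are the two scale conditions at the foot, restated through the position of the level-set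
point. -/
theorem conf_good_scale {D q p τ r c : ℝ} (hD : 0 < D) (hq : 0 < q) (hp : 0 < p)
    (hpD : p * D ≤ q) (hτ : 0 < τ) (hc : 400 * τ ≤ c * p) (hr : 800 * τ * q < r * p ^ 2) :
    400 * τ * D ≤ c * q ∧ 2 * (400 * τ) * D ^ 2 / q < r := by
  have hc0 : 0 < c := by
    by_contra h
    push Not at h
    nlinarith
  constructor
  · have h1 : 400 * τ * D ≤ c * p * D := by gcongr
    have h2 : c * (p * D) ≤ c * q := by gcongr
    linarith
  · rw [div_lt_iff₀ hq]
    have h1 : (p * D) ^ 2 ≤ q ^ 2 := by gcongr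
    have h2 : 0 < p ^ 2 := by positivity
    have h3 : 800 * τ * D ^ 2 * p ^ 2 ≤ 800 * τ * q * q := by
      have : 800 * τ * (p * D) ^ 2 ≤ 800 * τ * q ^ 2 := by gcongr
      linarith
    have h4 : 800 * τ * q * q < r * p ^ 2 * q := by gcongr
    have h5 : (2 * (400 * τ) * D ^ 2) * p ^ 2 < (r * q) * p ^ 2 := by linarith
    exact lt_of_mul_lt_mul_right h5 h2.le

/-- The part of the level set away from the blow-up point has area less than `9π/2`. -/
theorem area_good_level_le {S A X : Set (E 4)} {r₀ c τ γ : ℝ} {v : E 4} (hS : IsClosedSurface S)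
    (hA : IsSide S A) (hreg : IsRegular γ r₀ S) (hγ : γ = 1 / 10 ^ 9) (hv : ‖v‖ < 1)
    (hMarea : μHE[2] (conf v '' S) ≤ ENNReal.ofReal (4 * Real.pi * (1 + 101 * (1 / 2000))))
    (hτ : 0 < τ) (hτ1 : τ ≤ 1 / 20000) (hc : τ ^ 2 = 2 - 2 * c)
    (hX : X ⊆ level (conf v '' S) c) (hXm : MeasurableSet X) (hXf : μHE[2] X ≠ ⊤)
    (hside : X ⊆ conf v '' A ∨ Disjoint X (conf v '' A))
    (hgood : ∀ x ∈ X, 400 * τ ≤ γ * (‖x + v‖ - τ) ∧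
      800 * τ * (1 - ‖v‖ ^ 2) < min r₀ γ * (‖x + v‖ - τ) ^ 2) :
    μHE[2] X ≤ ENNReal.ofReal (9 / 2 * Real.pi) := by
  have hS1 : ∀ x ∈ S, ‖x‖ = 1 := fun x hx => by simpa using hS.subset_sphere hx
  have hM : ∀ y ∈ conf v '' S, ‖y‖ = 1 := by
    rintro _ ⟨x, hx, rfl⟩; exact norm_conf hv (hS1 x hx)
  have hMc : IsCompact (conf v '' S) :=
    hS.isCompact.image_of_continuousOn ((continuousOn_conf hv).mono hS.subset_sphere)
  have hγ0 : 0 < γ := by rw [hγ]; positivity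
  have hA1 : A ⊆ S3 := fun z hz => (hA.subset hz).1
  have hq := one_sub_norm_sq_pos hv
  have hmul := mul_area_level_le_of_flatAt (A := conf v '' A) (ε := 4 * (20 * γ) + 40 * γ)
    (a := ENNReal.ofReal ((1 - 40 * γ) * (Real.pi * (99 * τ) ^ 2))) hM hMc.measurableSet
    (ne_top_of_le_ne_top ENNReal.ofReal_ne_top hMarea) hτ hτ1 hc
    (by rw [hγ]; norm_num) hX hXm hXf hside (by
      rintro x hx _ ⟨x', hx', rfl⟩ hxy
      obtain ⟨hg1, hg2⟩ := hgood x hx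
      have hD := norm_sub_pos_of_unit hv (hS1 x' hx')
      have hp : 0 < ‖x + v‖ - τ := by
        by_contra h
        push Not at h
        nlinarith
      have hpD : (‖x + v‖ - τ) * ‖x' - v‖ ≤ 1 - ‖v‖ ^ 2 := by
        have h1 := norm_sub_foot hM hτ.le hc (hX hx) (mem_image_of_mem _ hx') hxy
        have h2 : ‖x + v‖ ≤ ‖x - conf v x'‖ + ‖conf v x' + v‖ := by
          have := norm_add_le (x - conf v x') (conf v x' + v)
          have e : x - conf v x' + (conf v x' + v) = x + v := by abel
          rwa [e] at this
        have h3 := norm_conf_add_self hv (hS1 x' hx')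
        rw [← le_div_iff₀ hD, ← h3]
        linarith
      obtain ⟨hs1, hs2⟩ := conf_good_scale hD hq hp hpD hτ hg1 hg2
      constructor
      · refine le_area_conf_ball hS.subset_sphere hreg hv hx' hγ0.le le_rfl hγ0
          (by rw [hγ]; norm_num) (by positivity) ?_ ?_
        · have : 0 ≤ τ * ‖x' - v‖ := by positivity
          linarith
        · refine lt_of_le_of_lt ?_ (hs2.trans_le (min_le_left _ _))
          refine div_le_div_of_nonneg_right (mul_le_mul_of_nonneg_right ?_ (sq_nonneg _)) hq.le
          linarith
      · obtain ⟨m, hm, hms⟩ := exists_flatAt_splits_of_isRegular hS hA hreg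
          (by rw [hγ]; norm_num) hx' (r := 2 * (400 * τ) * ‖x' - v‖ ^ 2 / (1 - ‖v‖ ^ 2))
          (by positivity) (hs2.trans_le (min_le_left _ _)) (hs2.trans_le (min_le_right _ _))
        have hε : 20 * γ ≤ 1 / 100 := by rw [hγ]; norm_num
        have hc1 : γ ≤ 1 / 100 := by rw [hγ]; norm_num
        exact ⟨_, flatAt_conf hS.subset_sphere hv (hS1 x' hx') (by positivity) hε hγ0.le hc1
            (by positivity) hs1 hm,
          splits_conf hA1 hv (hS1 x' hx') (by positivity) hγ0.le hc1 (by positivity) hs1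
            hm.norm_normal hm.inner_normal hms⟩)
  -- The factors `101/100`, `(100/99)²`, `1 + 101/2000` and `1 / (1 - 40γ)` keep `4π` below `9π/2`.
  have h2 : ENNReal.ofReal ((1 - 40 * γ) * (Real.pi * (99 * τ) ^ 2)) * μHE[2] X ≤
      ENNReal.ofReal ((1 - 40 * γ) * (Real.pi * (99 * τ) ^ 2)) *
        ENNReal.ofReal (9 / 2 * Real.pi) := by
    refine hmul.trans ((mul_le_mul_right hMarea _).trans ?_)
    rw [← ENNReal.ofReal_mul (by positivity), ← ENNReal.ofReal_mul (by rw [hγ]; positivity)]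
    apply ENNReal.ofReal_le_ofReal
    have : 0 ≤ Real.pi ^ 2 * τ ^ 2 := by positivity
    rw [hγ]
    nlinarith only [this]
  refine (ENNReal.mul_le_mul_iff_right (ENNReal.ofReal_pos.2 ?_).ne' ENNReal.ofReal_ne_top).1 h2
  have : 0 < 1 - 40 * γ := by rw [hγ]; norm_num
  positivity

theorem bad_scale {a b D q p τ r : ℝ} (hr : 0 < r) (hq : 0 < q) (hτ : 0 < τ) (hp : 2 * τ ≤ p)
    (hD : 0 < D) (hD2 : D ≤ 2) (hb : b = q / D) (hba : b ≤ a + τ) (hpa : p = a - τ)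
    (hbad : r * p ^ 2 ≤ 800 * τ * q) (hp4 : τ ≤ p) :
    a ≤ (3200 / r + 1) * τ ∧ τ ≤ 800 * q / r := by
  have h1 : q / 2 ≤ b := by
    rw [hb]; gcongr
  have h2 : q ≤ 4 * p := by linarith
  have hp0 : 0 < p := by linarith
  have h3 : r * p ≤ 3200 * τ := by
    have : (r * p) * p ≤ (3200 * τ) * p := by nlinarith
    exact le_of_mul_le_mul_right this hp0
  constructor
  · have : p ≤ 3200 / r * τ := by
      rw [div_mul_eq_mul_div, le_div_iff₀ hr]; linarith
    linarith
  · rw [le_div_iff₀ hr]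
    have h4 : r * τ ^ 2 ≤ r * p ^ 2 := by gcongr
    have : (τ * r) * τ ≤ (800 * q) * τ := by nlinarith
    exact le_of_mul_le_mul_right this hτ

/-- If the original scale required at the foot is too large, the point lies within a multiple of `τ`
of `-v`. Every image point is at least about `1 - ‖v‖²` from `-v`, which also forces `τ` to be of
order `1 - ‖v‖²`. -/
theorem norm_add_le_of_bad {S : Set (E 4)} {x v : E 4} {c τ r : ℝ} (hS1 : ∀ x ∈ S, ‖x‖ = 1)
    (hv : ‖v‖ < 1) (hτ : 0 < τ) (hc : τ ^ 2 = 2 - 2 * c) (hx : x ∈ level (conf v '' S) c)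
    (hr : 0 < r) (h1 : 2 * τ ≤ ‖x + v‖ - τ)
    (h2 : r * (‖x + v‖ - τ) ^ 2 ≤ 800 * τ * (1 - ‖v‖ ^ 2)) :
    ‖x + v‖ ≤ (3200 / r + 1) * τ ∧ τ ≤ 800 * (1 - ‖v‖ ^ 2) / r := by
  have hM : ∀ y ∈ conf v '' S, ‖y‖ = 1 := by
    rintro _ ⟨x, hx, rfl⟩; exact norm_conf hv (hS1 x hx)
  obtain ⟨_, ⟨x', hx', rfl⟩, hxy⟩ := hx.2.2
  have h3 := norm_sub_foot hM hτ.le hc hx (mem_image_of_mem _ hx') hxy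
  have h4 := norm_sub_le (x + v) (x - conf v x')
  have e : x + v - (x - conf v x') = conf v x' + v := by abel
  rw [h3, e] at h4
  have hD := norm_sub_pos_of_unit hv (hS1 x' hx')
  refine bad_scale hr (one_sub_norm_sq_pos hv) hτ h1 hD ?_
    (norm_conf_add_self hv (hS1 x' hx')) h4 rfl h2 (by linarith)
  have := norm_sub_le x' v
  rw [hS1 x' hx'] at this
  linarith

theorem exists_small_const {a C k : ℝ} (ha : 0 < a) (hC : 0 < C) (hk : 0 < k) :
    ∃ η : ℝ, 0 < η ∧ η ≤ a ∧ η ≤ 1 ∧ C * (k * η) ^ 2 ≤ 1 / 4 := by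
  refine ⟨min a (min 1 (1 / (4 * C * k ^ 2))), by positivity, min_le_left _ _,
    (min_le_right _ _).trans (min_le_left _ _), ?_⟩
  set η := min a (min 1 (1 / (4 * C * k ^ 2))) with hη
  have hη0 : 0 < η := by positivity
  have hη1 : η ≤ 1 := (min_le_right _ _).trans (min_le_left _ _)
  have h1 : η * (4 * C * k ^ 2) ≤ 1 := by
    rw [← le_div_iff₀ (by positivity)]
    exact (min_le_right _ _).trans (min_le_right _ _)
  calc C * (k * η) ^ 2 = (C * k ^ 2 * η) * η := by ring
    _ ≤ (1 / 4) * 1 := by gcongr; linarith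
    _ = 1 / 4 := by ring

/-- The level set splits into a part treated by `area_good_level_le` and two parts near `-v` of
crude area at most `1/4` each. In one the crude constant is absolute and fixes `τ₀`. In the other it
depends on `r₀`, but there `τ = O(1 - ‖v‖)`, so `η` compensates; thus `τ₀` is independent of `r₀`.
-/
theorem exists_area_level_conf_le_of_small : ∃ τ₀ : ℝ, 0 < τ₀ ∧ τ₀ ≤ 1 ∧ ∀ r₀ : ℝ, 0 < r₀ →
    ∃ η : ℝ, 0 < η ∧ ∀ (S A X : Set (E 4)) (v : E 4) (c : ℝ), IsClosedSurface S → IsSide S A →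
      IsRegular (1 / 10 ^ 9) r₀ S → ‖v‖ < 1 → 1 - η ≤ ‖v‖ → c < 1 → 2 - 2 * c ≤ τ₀ ^ 2 →
      X ⊆ level (conf v '' S) c → MeasurableSet X →
      (X ⊆ conf v '' A ∨ Disjoint X (conf v '' A)) → μHE[2] X ≤ ENNReal.ofReal (5 * Real.pi) := by
  obtain ⟨C₁, hC₁, hcrude₁⟩ := exists_area_level_le_of_scale (2 * (400 * 10 ^ 9 + 1))
  obtain ⟨τ₀, hτ₀0, hτ₀1, -, hτ₀2⟩ := exists_small_const (a := 1 / 20000) (k := 1) (by norm_num)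
    hC₁ one_pos
  rw [one_mul] at hτ₀2
  refine ⟨τ₀, hτ₀0, hτ₀1.trans (by norm_num), fun r₀ hr₀ => ?_⟩
  obtain ⟨ηM, hηM, hMarea⟩ := exists_area_conf_le (θ := 1 / 2000) (by norm_num) (by norm_num) hr₀
  set r₁ := min r₀ (1 / 10 ^ 9 : ℝ) with hr₁
  have hr₁0 : 0 < r₁ := by positivity
  obtain ⟨C₂, hC₂, hcrude₂⟩ := exists_area_level_le_of_scale (2 * (3200 / r₁ + 1))
  obtain ⟨η, hη0, hηM', hη1, hη2⟩ := exists_small_const (k := 1600 / r₁) hηM hC₂ (by positivity)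
  refine ⟨η, hη0, ?_⟩
  intro S A X v c hS hA hreg hv hvη hc1 hcτ hX hXm hside
  have hS1 : ∀ x ∈ S, ‖x‖ = 1 := fun x hx => by simpa using hS.subset_sphere hx
  have hM : ∀ y ∈ conf v '' S, ‖y‖ = 1 := by
    rintro _ ⟨x, hx, rfl⟩; exact norm_conf hv (hS1 x hx)
  have hq := one_sub_norm_sq_pos hv
  have hqη : 1 - ‖v‖ ^ 2 ≤ 2 * η := by nlinarith [norm_nonneg v]
  set τ := √(2 - 2 * c) with hτ
  have hτ0 : 0 < τ := Real.sqrt_pos.2 (by linarith)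
  have hτc : τ ^ 2 = 2 - 2 * c := Real.sq_sqrt (by linarith)
  have hττ₀ : τ ≤ τ₀ := (sq_le_sq₀ hτ0.le hτ₀0.le).1 (by rw [hτc]; exact hcτ)
  have hτsmall : τ ≤ 1 / 20000 := hττ₀.trans hτ₀1
  have hc2 : 1 / 2 ≤ c := by nlinarith
  set s := √(1 - c ^ 2) with hs
  have hs0 : 0 < s := Real.sqrt_pos.2 (by nlinarith)
  have hs2 : s ^ 2 = 1 - c ^ 2 := Real.sq_sqrt (by nlinarith)
  have hcs : c ^ 2 + s ^ 2 = 1 := by linarith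
  have hsτ : s ^ 2 ≤ τ ^ 2 := by rw [hs2, hτc]; nlinarith
  -- The chordal distance `τ` and the sine `s` are comparable because `c ≥ 1/2`; this allows crude
  -- bounds at radius `O(s)` to be used at radius `O(τ)`.
  have hτs : τ ≤ 2 * s := (sq_le_sq₀ hτ0.le (by positivity)).1 (by rw [mul_pow, hs2, hτc]; nlinarith)
  set q := 1 - ‖v‖ ^ 2 with hqdef
  set f : E 4 → ℝ := fun x => ‖x + v‖ - τ with hf
  have hfc : Continuous f := by fun_prop
  set X₀ := X ∩ {x | 400 * 10 ^ 9 * τ ≤ f x} ∩ {x | 800 * τ * q < r₁ * f x ^ 2} with hX₀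
  set X₁ := X ∩ {x | f x < 400 * 10 ^ 9 * τ} with hX₁
  set X₂ := X ∩ {x | 400 * 10 ^ 9 * τ ≤ f x} ∩ {x | r₁ * f x ^ 2 ≤ 800 * τ * q} with hX₂
  have hcov : X ⊆ X₀ ∪ (X₁ ∪ X₂) := by
    intro x hx
    rcases lt_or_ge (f x) (400 * 10 ^ 9 * τ) with h | h
    · exact Or.inr (Or.inl ⟨hx, h⟩)
    · rcases lt_or_ge (800 * τ * q) (r₁ * f x ^ 2) with h' | h'
      · exact Or.inl ⟨⟨hx, h⟩, h'⟩
      · exact Or.inr (Or.inr ⟨⟨hx, h⟩, h'⟩)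
  have hX₀X : X₀ ⊆ X := fun x hx => hx.1.1
  have hXf : μHE[2] X ≠ ⊤ := by
    obtain ⟨C, -, h⟩ := exists_area_level_le_of_scale (1 / s)
    refine ne_top_of_le_ne_top ENNReal.ofReal_ne_top (h _ X c s 0 hM hs0 hcs hX ?_)
    intro x hx
    rw [mem_closedBall_zero_iff, (hX hx).1, one_div_mul_cancel hs0.ne']
  have hArea₀ : μHE[2] X₀ ≤ ENNReal.ofReal (9 / 2 * Real.pi) := by
    refine area_good_level_le hS hA hreg rfl hv ?_ hτ0 hτsmall hτc (hX₀X.trans hX) ?_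
      (ne_top_of_le_ne_top hXf (measure_mono hX₀X)) ?_ ?_
    · exact hMarea _ S v (by norm_num) (by norm_num) hS.subset_sphere hS.isCompact
        hS.isConnected.nonempty hreg hv (by linarith)
    · exact (hXm.inter (measurableSet_le measurable_const hfc.measurable)).inter
        (measurableSet_lt measurable_const (by fun_prop))
    · rcases hside with h | h
      · exact Or.inl (hX₀X.trans h)
      · exact Or.inr (h.mono_left hX₀X)
    · rintro x ⟨⟨hx, h1⟩, h2⟩
      refine ⟨?_, h2⟩
      have h3 : 400 * 10 ^ 9 * τ ≤ f x := h1
      change 400 * τ ≤ 1 / 10 ^ 9 * f x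
      linarith
  have hArea₁ : μHE[2] X₁ ≤ ENNReal.ofReal (1 / 4) := by
    refine (hcrude₁ _ X₁ c s (-v) hM hs0 hcs (inter_subset_left.trans hX) ?_).trans
      (ENNReal.ofReal_le_ofReal ?_)
    · rintro x ⟨hx, h1⟩
      have h2 : ‖x + v‖ - τ < 400 * 10 ^ 9 * τ := h1
      rw [mem_closedBall, dist_eq_norm, sub_neg_eq_add]
      linarith
    · calc C₁ * s ^ 2 ≤ C₁ * τ₀ ^ 2 := by
            exact mul_le_mul_of_nonneg_left (hsτ.trans (pow_le_pow_left₀ hτ0.le hττ₀ 2)) hC₁.le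
        _ ≤ 1 / 4 := hτ₀2
  have hb : ∀ x ∈ X₂, ‖x + v‖ ≤ (3200 / r₁ + 1) * τ ∧ τ ≤ 800 * q / r₁ := by
    rintro x ⟨⟨hx, h1⟩, h2⟩
    have h1' : 400 * 10 ^ 9 * τ ≤ ‖x + v‖ - τ := h1
    exact norm_add_le_of_bad hS1 hv hτ0 hτc (hX hx) hr₁0 (by linarith) h2
  have hArea₂ : μHE[2] X₂ ≤ ENNReal.ofReal (1 / 4) := by
    rcases X₂.eq_empty_or_nonempty with h0 | ⟨x₂, hx₂⟩
    · rw [h0]; simp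
    refine (hcrude₂ _ X₂ c s (-v) hM hs0 hcs (fun x hx => hX hx.1.1) ?_).trans
      (ENNReal.ofReal_le_ofReal ?_)
    · intro x hx
      rw [mem_closedBall, dist_eq_norm, sub_neg_eq_add]
      refine (hb x hx).1.trans ?_
      have h3 : 0 ≤ 3200 / r₁ + 1 := by positivity
      have h4 := mul_le_mul_of_nonneg_left hτs h3
      linarith
    · have h2 : τ ≤ 1600 / r₁ * η := by
        refine (hb x₂ hx₂).2.trans ?_
        rw [div_mul_eq_mul_div]
        gcongr ?_ / _
        linarith
      refine le_trans (mul_le_mul_of_nonneg_left (hsτ.trans ?_) hC₂.le) hη2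
      exact pow_le_pow_left₀ hτ0.le h2 2
  calc μHE[2] X ≤ μHE[2] X₀ + (μHE[2] X₁ + μHE[2] X₂) :=
        (measure_mono hcov).trans ((measure_union_le _ _).trans
          (add_le_add le_rfl (measure_union_le _ _)))
    _ ≤ ENNReal.ofReal (9 / 2 * Real.pi) + (ENNReal.ofReal (1 / 4) + ENNReal.ofReal (1 / 4)) :=
        add_le_add hArea₀ (add_le_add hArea₁ hArea₂)
    _ ≤ ENNReal.ofReal (5 * Real.pi) := by
        rw [← ENNReal.ofReal_add (by norm_num) (by norm_num),
          ← ENNReal.ofReal_add (by positivity) (by norm_num)]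
        apply ENNReal.ofReal_le_ofReal
        linarith [Real.pi_gt_three]

/-! ### Level sets at large distance -/

section NearRound

variable {S A : Set (E 4)} {x₀ v m : E 4} {N δ ε ε₀ : ℝ}

/-- Outside the region where `S` is known to be flat, or near `S`, the image under `conf v` is
close to a round sphere. -/
theorem round_height_le (hv : ‖v‖ < 1) (hδ : δ = 1 - ‖v‖) (hN : 8 ≤ N) (hε : 20 / N ^ 2 ≤ ε)
    (hε₀ : 2 * ε₀ * N ^ 2 ≤ ε) (hm : ‖m‖ = 1) (hxm : inner ℝ x₀ m = 0)
    (hh : ‖x₀ - v‖ ≤ N * δ) {x : E 4} (hx : ‖x‖ = 1)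
    (hcase : ‖x - x₀‖ < N ^ 2 * δ → |inner ℝ x m| ≤ ε₀ * (N ^ 2 * δ)) :
    (1 - ‖v‖ ^ 2) * |inner ℝ x m| / ‖x - v‖ ^ 2 ≤ ε := by
  have hδ0 : 0 < δ := by rw [hδ]; linarith
  have hq : 1 - ‖v‖ ^ 2 ≤ 2 * δ := by rw [hδ]; nlinarith [norm_nonneg v]
  have hq0 := one_sub_norm_sq_pos hv
  have hD := norm_sub_pos_of_unit hv hx
  have hDδ : δ ≤ ‖x - v‖ := by rw [hδ]; exact one_sub_norm_le_norm_sub hx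
  have hN2 : 8 * N ≤ N ^ 2 := by nlinarith
  rcases lt_or_ge ‖x - x₀‖ (N ^ 2 * δ) with hlt | hge
  · rw [div_le_iff₀ (by positivity)]
    calc (1 - ‖v‖ ^ 2) * |inner ℝ x m| ≤ (2 * δ) * (ε₀ * (N ^ 2 * δ)) := by
          gcongr
          exact hcase hlt
      _ = (2 * ε₀ * N ^ 2) * δ ^ 2 := by ring
      _ ≤ ε * ‖x - v‖ ^ 2 := by
          have h1 : 0 ≤ ε := le_trans (by positivity) hε
          gcongr
  · have h1 : |inner ℝ x m| ≤ ‖x - x₀‖ := by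
      have := abs_real_inner_le_norm (x - x₀) m
      rwa [hm, mul_one, inner_sub_left, hxm, sub_zero] at this
    have h2 : N * δ ≤ ‖x - x₀‖ / 8 := by nlinarith
    have h3 : ‖x - x₀‖ / 2 ≤ ‖x - v‖ := by
      have := norm_sub_le_norm_sub_add_norm_sub x v x₀
      rw [norm_sub_rev v x₀] at this
      linarith [norm_nonneg (x - x₀)]
    have h0 : 0 < ‖x - x₀‖ := lt_of_lt_of_le (by positivity) hge
    refine le_trans ?_ hε
    calc (1 - ‖v‖ ^ 2) * |inner ℝ x m| / ‖x - v‖ ^ 2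
        ≤ (2 * δ) * ‖x - x₀‖ / (‖x - x₀‖ / 2) ^ 2 := by gcongr
      _ = 8 * δ / ‖x - x₀‖ := by field_simp; ring
      _ ≤ 8 * δ / (N ^ 2 * δ) := by gcongr
      _ = 8 / N ^ 2 := by field_simp
      _ ≤ 20 / N ^ 2 := by gcongr; norm_num

/-- The great sphere tangent to `S` at `x₀` is mapped exactly to a hyperplane section. Within `N² δ`
of `x₀` flatness controls the deviation; farther out everything is sent within `O(1 / N²)` of `-v`,
and a point of `S` at distance at least `N² δ / 4` supplies density there. -/
theorem conf_near_round (hS : S ⊆ S3) (hv : ‖v‖ < 1) (hδ : δ = 1 - ‖v‖) (hN : 8 ≤ N)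
    (hε : 20 / N ^ 2 ≤ ε) (hε₀0 : 0 ≤ ε₀) (hε₀ : 2 * ε₀ * N ^ 2 ≤ ε)
    (hh : ‖x₀ - v‖ ≤ N * δ) (hflat : FlatAt S x₀ (N ^ 2 * δ) ε₀ m)
    (hs : Splits A x₀ (N ^ 2 * δ) ε₀ m) (hA : A ⊆ S3)
    (hfar : ∃ w ∈ S, N ^ 2 * δ / 4 ≤ ‖w - x₀‖) :
    ∃ (n : E 4) (b : ℝ), ‖n‖ = 1 ∧ |b| ≤ 1 ∧ (∀ y ∈ conf v '' S, |inner ℝ y n - b| ≤ ε) ∧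
      (∀ z : E 4, ‖z‖ = 1 → inner ℝ z n = b → ∃ w ∈ conf v '' S, ‖w - z‖ ≤ ε) ∧
      (∀ z : E 4, ‖z‖ = 1 → z ∉ conf v '' A → inner ℝ z n ≤ b + ε) ∧
      (∀ z : E 4, ‖z‖ = 1 → z ∈ conf v '' A → b - ε ≤ inner ℝ z n) := by
  have hδ0 : 0 < δ := by rw [hδ]; linarith
  have hq : 1 - ‖v‖ ^ 2 ≤ 2 * δ := by rw [hδ]; nlinarith [norm_nonneg v]
  have hq0 := one_sub_norm_sq_pos hv
  have hv' : ‖-v‖ < 1 := by rwa [norm_neg]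
  have hε0 : 0 < ε := lt_of_lt_of_le (by positivity) hε
  set κ := inner ℝ (x₀ - v) m with hκ
  set nh := (1 - ‖v‖ ^ 2) • m - (2 * κ) • v with hnh
  have hnn : ‖nh‖ ^ 2 = (1 - ‖v‖ ^ 2) ^ 2 + 4 * κ ^ 2 :=
    norm_sq_conf_normal hflat.norm_normal hflat.inner_normal
  have hnq : 1 - ‖v‖ ^ 2 ≤ ‖nh‖ := by
    refine (sq_le_sq₀ hq0.le (norm_nonneg _)).1 ?_
    rw [hnn]; nlinarith [sq_nonneg κ]
  have hn0 : 0 < ‖nh‖ := hq0.trans_le hnq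
  have hform : ∀ x : E 4, ‖x‖ = 1 → inner ℝ (conf v x) (‖nh‖⁻¹ • nh) - ‖nh‖⁻¹ * (2 * κ) =
      ‖nh‖⁻¹ * (inner ℝ x m * ‖conf v x + v‖ ^ 2) := by
    intro x hx
    rw [inner_smul_right, inner_conf_normal hv hx hflat.inner_normal]
    ring
  have hsize : ∀ x : E 4, ‖x‖ = 1 → ‖nh‖⁻¹ * (|inner ℝ x m| * ‖conf v x + v‖ ^ 2) ≤
      (1 - ‖v‖ ^ 2) * |inner ℝ x m| / ‖x - v‖ ^ 2 := by
    intro x hx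
    rw [norm_conf_add_self hv hx]
    have hD := norm_sub_pos_of_unit hv hx
    calc ‖nh‖⁻¹ * (|inner ℝ x m| * ((1 - ‖v‖ ^ 2) / ‖x - v‖) ^ 2)
        ≤ (1 - ‖v‖ ^ 2)⁻¹ * (|inner ℝ x m| * ((1 - ‖v‖ ^ 2) / ‖x - v‖) ^ 2) := by gcongr
      _ = _ := by field_simp
  have hpt : ∀ x : E 4, ‖x‖ = 1 →
      (‖x - x₀‖ < N ^ 2 * δ → |inner ℝ x m| ≤ ε₀ * (N ^ 2 * δ)) →
      |inner ℝ (conf v x) (‖nh‖⁻¹ • nh) - ‖nh‖⁻¹ * (2 * κ)| ≤ ε := by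
    intro x hx hcase
    rw [hform x hx, abs_mul, abs_mul, abs_of_pos (inv_pos.2 hn0), abs_of_nonneg (sq_nonneg ‖conf v x + v‖)]
    exact (hsize x hx).trans (round_height_le hv hδ hN hε hε₀ hflat.norm_normal
      hflat.inner_normal hh hx hcase)
  refine ⟨‖nh‖⁻¹ • nh, ‖nh‖⁻¹ * (2 * κ), ?_, ?_, ?_, ?_, ?_, ?_⟩
  · rw [norm_smul, norm_inv, norm_norm, inv_mul_cancel₀ hn0.ne']
  · rw [abs_mul, abs_of_pos (inv_pos.2 hn0), inv_mul_le_iff₀ hn0, mul_one]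
    refine (sq_le_sq₀ (abs_nonneg _) hn0.le).1 ?_
    rw [sq_abs, hnn]
    nlinarith [sq_nonneg (1 - ‖v‖ ^ 2)]
  · rintro _ ⟨x, hx, rfl⟩
    exact hpt x (by simpa using hS hx) (hflat.flat x hx)
  · intro z hz hzn
    have hz₀ : ‖conf (-v) z‖ = 1 := norm_conf hv' hz
    have hFz₀ : conf v (conf (-v) z) = z := conf_conf_neg hv hz
    set z₀ := conf (-v) z
    have hD := norm_sub_pos_of_unit hv hz₀
    have hDδ : δ ≤ ‖z₀ - v‖ := by rw [hδ]; exact one_sub_norm_le_norm_sub hz₀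
    have hz₀m : inner ℝ z₀ m = 0 := by
      have h1 := hform z₀ hz₀
      rw [hFz₀, hzn, sub_self] at h1
      have h2 : ‖z + v‖ ≠ 0 := by
        rw [← hFz₀, norm_conf_add_self hv hz₀]
        positivity
      have h3 := (mul_eq_zero.1 h1.symm).resolve_left (inv_pos.2 hn0).ne'
      exact (mul_eq_zero.1 h3).resolve_right (pow_ne_zero 2 h2)
    rcases lt_or_ge ‖z₀ - x₀‖ (N ^ 2 * δ) with hlt | hge
    · obtain ⟨w, hw, hwz⟩ := hflat.dense z₀ hz₀ hlt
      rw [hz₀m, abs_zero, zero_add] at hwz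
      have hw1 : ‖w‖ = 1 := by simpa using hS hw
      have hDw : δ ≤ ‖w - v‖ := by rw [hδ]; exact one_sub_norm_le_norm_sub hw1
      refine ⟨_, mem_image_of_mem _ hw, ?_⟩
      rw [← hFz₀, norm_conf_sub hv hw1 hz₀]
      refine le_trans ?_ hε₀
      calc (1 - ‖v‖ ^ 2) * ‖w - z₀‖ / (‖w - v‖ * ‖z₀ - v‖)
          ≤ (2 * δ) * (ε₀ * (N ^ 2 * δ)) / (δ * δ) := by gcongr
        _ = 2 * ε₀ * N ^ 2 := by field_simp
    · obtain ⟨w, hw, hwx⟩ := hfar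
      have hw1 : ‖w‖ = 1 := by simpa using hS hw
      refine ⟨_, mem_image_of_mem _ hw, ?_⟩
      have hN2 : 8 * (N * δ) ≤ N ^ 2 * δ := by
        rw [← mul_assoc]
        exact mul_le_mul_of_nonneg_right (by nlinarith) hδ0.le
      have h1 : N ^ 2 * δ / 8 ≤ ‖w - v‖ := by
        have := norm_sub_le_norm_sub_add_norm_sub w v x₀
        rw [norm_sub_rev v x₀] at this
        linarith
      have h2 : N ^ 2 * δ / 2 ≤ ‖z₀ - v‖ := by
        have := norm_sub_le_norm_sub_add_norm_sub z₀ v x₀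
        rw [norm_sub_rev v x₀] at this
        have : 0 < N * δ := by positivity
        linarith
      have e : conf v w - z = (conf v w + v) - (conf v z₀ + v) := by rw [hFz₀]; abel
      rw [e]
      refine (norm_sub_le _ _).trans ?_
      rw [norm_conf_add_self hv hw1, norm_conf_add_self hv hz₀]
      calc (1 - ‖v‖ ^ 2) / ‖w - v‖ + (1 - ‖v‖ ^ 2) / ‖z₀ - v‖
          ≤ (2 * δ) / (N ^ 2 * δ / 8) + (2 * δ) / (N ^ 2 * δ / 2) := by gcongr
        _ = 20 / N ^ 2 := by field_simp; norm_num
        _ ≤ ε := hε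
  · intro z hz hzA
    by_contra hcon
    push Not at hcon
    have hz₀ : ‖conf (-v) z‖ = 1 := norm_conf hv' hz
    have hFz₀ : conf v (conf (-v) z) = z := conf_conf_neg hv hz
    set z₀ := conf (-v) z
    have hpos : 0 < inner ℝ z₀ m := by
      by_contra h0
      push Not at h0
      have h1 := hform z₀ hz₀
      rw [hFz₀] at h1
      have h2 : ‖nh‖⁻¹ * (inner ℝ z₀ m * ‖z + v‖ ^ 2) ≤ 0 :=
        mul_nonpos_of_nonneg_of_nonpos (inv_pos.2 hn0).le
          (mul_nonpos_of_nonpos_of_nonneg h0 (sq_nonneg _))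
      linarith
    have h3 : ¬ (‖z₀ - x₀‖ < N ^ 2 * δ → |inner ℝ z₀ m| ≤ ε₀ * (N ^ 2 * δ)) := by
      intro h
      have := (abs_le.1 (hpt z₀ hz₀ h)).2
      rw [hFz₀] at this
      linarith
    push Not at h3
    rw [abs_of_pos hpos] at h3
    exact hzA ⟨z₀, hs.1 z₀ hz₀ h3.1 h3.2, hFz₀⟩
  · rintro z hz ⟨z₀, hz₀A, hFz₀⟩
    by_contra hcon
    push Not at hcon
    have hz₀ : ‖z₀‖ = 1 := by simpa using hA hz₀A
    have hneg : inner ℝ z₀ m < 0 := by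
      by_contra h0
      push Not at h0
      have h1 := hform z₀ hz₀
      rw [hFz₀] at h1
      have h2 : 0 ≤ ‖nh‖⁻¹ * (inner ℝ z₀ m * ‖z + v‖ ^ 2) := by positivity
      linarith
    have h3 : ¬ (‖z₀ - x₀‖ < N ^ 2 * δ → |inner ℝ z₀ m| ≤ ε₀ * (N ^ 2 * δ)) := by
      intro h
      have := (abs_le.1 (hpt z₀ hz₀ h)).1
      rw [hFz₀] at this
      linarith
    push Not at h3
    rw [abs_of_neg hneg] at h3
    exact hs.2 z₀ hz₀ h3.1 (by linarith) hz₀A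

/-- If `S` is far from `v` compared with `δ`, its image collapses to `-v / ‖v‖`, treated as the
degenerate round sphere of height `1`. -/
theorem conf_near_point (hv : ‖v‖ < 1) (hv0 : v ≠ 0) (hδ : δ = 1 - ‖v‖) (hN : 0 < N)
    (hε : 2 / N + δ ≤ ε) (hS : S ⊆ S3) (hne : S.Nonempty) (hfar : ∀ w ∈ S, N * δ ≤ ‖w - v‖) :
    ∃ n : E 4, ‖n‖ = 1 ∧ (∀ y ∈ conf v '' S, |inner ℝ y n - 1| ≤ ε) ∧
      (∀ z : E 4, ‖z‖ = 1 → inner ℝ z n = 1 → ∃ w ∈ conf v '' S, ‖w - z‖ ≤ ε) := by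
  have hδ0 : 0 < δ := by rw [hδ]; linarith
  have hvn : 0 < ‖v‖ := norm_pos_iff.2 hv0
  have hq : 1 - ‖v‖ ^ 2 ≤ 2 * δ := by rw [hδ]; nlinarith [norm_nonneg v]
  have hn1 : ‖(-‖v‖⁻¹) • v‖ = 1 := by
    rw [norm_smul, norm_neg, norm_inv, norm_norm, inv_mul_cancel₀ hvn.ne']
  have hnv : ‖-v - (-‖v‖⁻¹) • v‖ = δ := by
    have e : -v - (-‖v‖⁻¹) • v = (‖v‖⁻¹ - 1) • v := by module
    have h1 : 0 ≤ ‖v‖⁻¹ - 1 := by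
      rw [sub_nonneg]; exact (one_le_inv₀ hvn).2 hv.le
    rw [e, norm_smul, Real.norm_of_nonneg h1, sub_mul, inv_mul_cancel₀ hvn.ne', one_mul, hδ]
  have hclose : ∀ w ∈ S, ‖conf v w - (-‖v‖⁻¹) • v‖ ≤ ε := by
    intro w hw
    have hw1 : ‖w‖ = 1 := by simpa using hS hw
    have e : conf v w - (-‖v‖⁻¹) • v = (conf v w + v) + (-v - (-‖v‖⁻¹) • v) := by abel
    rw [e]
    refine (norm_add_le _ _).trans ?_
    rw [hnv, norm_conf_add_self hv hw1]
    have := hfar w hw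
    have h0 := one_sub_norm_sq_pos hv
    have h1 : (1 - ‖v‖ ^ 2) / ‖w - v‖ ≤ 2 / N := by
      calc (1 - ‖v‖ ^ 2) / ‖w - v‖ ≤ (2 * δ) / (N * δ) := by gcongr
        _ = 2 / N := by field_simp
    linarith
  refine ⟨(-‖v‖⁻¹) • v, hn1, ?_, ?_⟩
  · rintro _ ⟨w, hw, rfl⟩
    refine le_trans ?_ (hclose w hw)
    have h1 : inner ℝ (conf v w) ((-‖v‖⁻¹) • v) - 1 =
        inner ℝ (conf v w - (-‖v‖⁻¹) • v) ((-‖v‖⁻¹) • v) := by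
      rw [inner_sub_left, real_inner_self_eq_norm_sq, hn1]; norm_num
    rw [h1]
    have := abs_real_inner_le_norm (conf v w - (-‖v‖⁻¹) • v) ((-‖v‖⁻¹) • v)
    rwa [hn1, mul_one] at this
  · intro z hz hzn
    obtain ⟨w, hw⟩ := hne
    refine ⟨_, mem_image_of_mem _ hw, ?_⟩
    have : z = (-‖v‖⁻¹) • v := by
      have h1 := norm_sub_sq_of_unit hz hn1
      rw [hzn] at h1
      have h2 : ‖z - (-‖v‖⁻¹) • v‖ = 0 := by nlinarith [norm_nonneg (z - (-‖v‖⁻¹) • v)]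
      exact sub_eq_zero.1 (norm_eq_zero.1 h2)
    rw [this]
    exact hclose w hw

end NearRound

/-- The closeness `ε` required by the round-sphere estimate depends only on `s₀`. It determines the
blow-up ratio `N`, and `N` determines `γ`; the scale `N² δ` must fit below `r₀`, which only
restricts `η`. -/
theorem exists_area_level_conf_le_of_large {s₀ : ℝ} (hs₀ : 0 < s₀) (hs₁ : s₀ ≤ 1) :
    ∃ γ : ℝ, 0 < γ ∧ ∀ r₀ : ℝ, 0 < r₀ → ∃ η : ℝ, 0 < η ∧
      ∀ (S A X : Set (E 4)) (v : E 4) (c s : ℝ), IsClosedSurface S → IsSide S A →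
      IsRegular γ r₀ S → ‖v‖ < 1 → 1 - η ≤ ‖v‖ → s₀ ≤ s → c ^ 2 + s ^ 2 = 1 →
      X ⊆ level (conf v '' S) c → (X ⊆ conf v '' A ∨ Disjoint X (conf v '' A)) →
      μHE[2] X ≤ ENNReal.ofReal (5 * Real.pi) := by
  obtain ⟨ε, hε, hround⟩ := exists_area_level_near_round_le hs₀ hs₁
  set N := 8 + 20 / ε with hNdef
  have hN8 : 8 ≤ N := by rw [hNdef]; linarith [div_pos (by norm_num : (0 : ℝ) < 20) hε]
  have hN0 : 0 < N := by linarith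
  have hNε : 20 ≤ N * ε := by
    rw [hNdef, add_mul, div_mul_cancel₀ _ hε.ne']; linarith
  have hε1 : 20 / N ^ 2 ≤ ε := by
    rw [div_le_iff₀ (by positivity)]
    nlinarith
  have hε2 : 2 / N ≤ ε / 2 := by
    rw [div_le_iff₀ hN0]; linarith
  set γ := min (1 / 2000) (ε / (40 * N ^ 2)) with hγdef
  have hγ0 : 0 < γ := by positivity
  have hγ1 : γ ≤ 1 / 2000 := min_le_left _ _
  have hγ2 : 2 * (20 * γ) * N ^ 2 ≤ ε := by
    have : γ * (40 * N ^ 2) ≤ ε := by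
      rw [← le_div_iff₀ (by positivity)]; exact min_le_right _ _
    linarith
  refine ⟨γ, hγ0, fun r₀ hr₀ => ?_⟩
  set r₁ := min r₀ γ with hr₁
  have hr₁0 : 0 < r₁ := by positivity
  refine ⟨min (1 / 2) (min (ε / 2) (r₁ / (2 * N ^ 2))), by positivity, ?_⟩
  intro S A X v c s hS hA hreg hv hvη hs hcs hX hside
  have hS1 : ∀ x ∈ S, ‖x‖ = 1 := fun x hx => by simpa using hS.subset_sphere hx
  have hM : ∀ y ∈ conf v '' S, ‖y‖ = 1 := by
    rintro _ ⟨x, hx, rfl⟩; exact norm_conf hv (hS1 x hx)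
  have hA1 : A ⊆ S3 := fun z hz => (hA.subset hz).1
  set δ := 1 - ‖v‖ with hδ
  have hδ0 : 0 < δ := by rw [hδ]; linarith
  have hδη : δ ≤ min (1 / 2) (min (ε / 2) (r₁ / (2 * N ^ 2))) := by rw [hδ]; linarith
  have hδ1 : δ ≤ 1 / 2 := hδη.trans (min_le_left _ _)
  have hδ2 : δ ≤ ε / 2 := hδη.trans ((min_le_right _ _).trans (min_le_left _ _))
  have hδ3 : N ^ 2 * δ < r₁ := by
    have h1 : δ * (2 * N ^ 2) ≤ r₁ := by
      rw [← le_div_iff₀ (by positivity)]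
      exact hδη.trans ((min_le_right _ _).trans (min_le_right _ _))
    linarith
  obtain ⟨x₀, hx₀, hmin⟩ := hS.isCompact.exists_isMinOn hS.isConnected.nonempty
    (f := fun w : E 4 => ‖w - v‖) (by fun_prop)
  replace hmin : ∀ w ∈ S, ‖x₀ - v‖ ≤ ‖w - v‖ := fun w hw => hmin hw
  rcases le_total ‖x₀ - v‖ (N * δ) with hnear | hfar
  · have hr0 : 0 < N ^ 2 * δ := by positivity
    obtain ⟨m, hm, hms⟩ := exists_flatAt_splits_of_isRegular hS hA hreg hγ1 hx₀ hr0
      (hδ3.trans_le (min_le_left _ _)) (hδ3.trans_le (min_le_right _ _))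
    have hfarpt : ∃ w ∈ S, N ^ 2 * δ / 4 ≤ ‖w - x₀‖ := by
      obtain ⟨σ, φ, hφ⟩ := hreg x₀ hx₀ _ hr0 (hδ3.trans_le (min_le_left _ _))
      have hp : (EuclideanSpace.single 0 (N ^ 2 * δ / 2) : E 2) ∈ ball (0 : E 2) (N ^ 2 * δ) := by
        rw [mem_ball_zero_iff, PiLp.norm_single, Real.norm_of_nonneg (by positivity)]
        linarith
      have hlow := hφ.lower _ hp 0 (mem_ball_self hr0)
      rw [hφ.center, sub_zero, PiLp.norm_single, Real.norm_of_nonneg (by positivity)] at hlow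
      refine ⟨_, (hφ.image_subset (mem_image_of_mem φ hp)).1, le_trans ?_ hlow⟩
      nlinarith
    obtain ⟨n, b, hn, hb, h1, h2, h3, h4⟩ := conf_near_round hS.subset_sphere hv hδ hN8 hε1
      (by positivity) hγ2 hnear hm hms hA1 hfarpt
    refine hround _ X n b c s hM hn hb hs hcs h1 h2 hX ?_
    rcases hside with h | h
    · exact Or.inr fun x hx => h4 x (hX hx).1 (h hx)
    · exact Or.inl fun x hx => h3 x (hX hx).1 (Set.disjoint_left.1 h hx)
  · obtain ⟨n, hn, h1, h2⟩ := conf_near_point (ε := ε) hv (by rintro rfl; rw [norm_zero] at hδ; linarith) hδ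
      hN0 (by linarith) hS.subset_sphere hS.isConnected.nonempty
      (fun w hw => hfar.trans (hmin w hw))
    refine hround _ X n 1 c s hM hn (by norm_num) hs hcs h1 h2 hX (Or.inl fun x hx => ?_)
    have := real_inner_le_norm x n
    rw [(hX hx).1, hn, one_mul] at this
    linarith

/-! ### The canonical family consists of level sets -/

section SphereDist

variable {M B : Set (E 4)}

theorem sphereDist_le {x y : E 4} (hy : y ∈ M) :
    sphereDist M x ≤ InnerProductGeometry.angle x y :=
  ciInf_le (f := fun y : M => InnerProductGeometry.angle x (y : E 4))
    ⟨0, by rintro _ ⟨y, rfl⟩; exact InnerProductGeometry.angle_nonneg _ _⟩ ⟨y, hy⟩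

theorem continuous_angle_sphere (hM : M ⊆ S3) :
    Continuous fun p : S3 × M => InnerProductGeometry.angle (p.1 : E 4) (p.2 : E 4) := by
  have : (fun p : S3 × M => InnerProductGeometry.angle (p.1 : E 4) (p.2 : E 4)) =
      fun p : S3 × M => Real.arccos (inner ℝ (p.1 : E 4) (p.2 : E 4)) := by
    funext p
    have h1 : ‖(p.1 : E 4)‖ = 1 := mem_sphere_zero_iff_norm.1 p.1.2
    have h2 : ‖(p.2 : E 4)‖ = 1 := mem_sphere_zero_iff_norm.1 (hM p.2.2)
    rw [InnerProductGeometry.angle, h1, h2, mul_one, div_one]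
  rw [this]
  exact Real.continuous_arccos.comp (by fun_prop)

theorem exists_sphereDist_eq (hM : M ⊆ S3) (hMc : IsCompact M) (hne : M.Nonempty) {x : E 4}
    (hx : x ∈ S3) : ∃ y ∈ M, sphereDist M x = InnerProductGeometry.angle x y := by
  have := isCompact_iff_compactSpace.1 hMc
  have := hne.to_subtype
  obtain ⟨y, -, hy⟩ := isCompact_univ.exists_isMinOn (univ_nonempty (α := M))
    (f := fun y : M => InnerProductGeometry.angle x (y : E 4))
    ((continuous_angle_sphere hM).comp (Continuous.prodMk_right (⟨x, hx⟩ : S3))).continuousOn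
  exact ⟨y, y.2, le_antisymm (sphereDist_le y.2) (le_ciInf fun z => hy (mem_univ z))⟩

theorem continuous_sphereDist (hM : M ⊆ S3) (hMc : IsCompact M) :
    Continuous fun x : S3 => sphereDist M x := by
  have := isCompact_iff_compactSpace.1 hMc
  have := isCompact_univ.continuous_sInf (K := (univ : Set M))
    (f := fun (x : S3) (y : M) => InnerProductGeometry.angle (x : E 4) (y : E 4))
    (continuous_angle_sphere hM)
  simp only [image_univ] at this
  exact this

theorem sphereDist_eq_zero {x : E 4} (hx : x ∈ M) (hx0 : x ≠ 0) : sphereDist M x = 0 :=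
  le_antisymm ((sphereDist_le hx).trans_eq (InnerProductGeometry.angle_self hx0))
    (Real.iInf_nonneg fun _ => InnerProductGeometry.angle_nonneg _ _)

theorem mem_level_of_sphereDist_eq (hM : M ⊆ S3) (hMc : IsCompact M) (hne : M.Nonempty)
    {x : E 4} {t : ℝ} (hx : x ∈ S3) (ht : sphereDist M x = |t|) : x ∈ level M (Real.cos t) := by
  have hx1 : ‖x‖ = 1 := mem_sphere_zero_iff_norm.1 hx
  have hcos : ∀ y ∈ M, Real.cos (InnerProductGeometry.angle x y) = inner ℝ x y := by
    intro y hy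
    rw [InnerProductGeometry.cos_angle, hx1, mem_sphere_zero_iff_norm.1 (hM hy), mul_one, div_one]
  refine ⟨hx1, fun y hy => ?_, ?_⟩
  · rw [← hcos y hy, ← Real.cos_abs t, ← ht]
    exact Real.cos_le_cos_of_nonneg_of_le_pi (ht ▸ abs_nonneg t)
      (InnerProductGeometry.angle_le_pi _ _) (sphereDist_le hy)
  · obtain ⟨y, hy, h⟩ := exists_sphereDist_eq hM hMc hne hx
    exact ⟨y, hy, by rw [← hcos y hy, ← h, ht, Real.cos_abs]⟩

/-- The two branches meet only on the frontier of `B`, where the distance vanishes. Continuity is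
what places the frontier of a sublevel set inside a level set. -/
theorem continuous_signedDist (hM : M ⊆ S3) (hMc : IsCompact M)
    (hB : frontier {x : S3 | (x : E 4) ∈ B} ⊆ {x : S3 | (x : E 4) ∈ M}) :
    Continuous fun x : S3 => signedDist M B x := by
  classical
  have h := continuous_sphereDist hM hMc
  unfold signedDist
  refine Continuous.if (fun x hx => ?_) h.neg h
  have hxM : (x : E 4) ∈ M := hB hx
  rw [sphereDist_eq_zero hxM (ne_zero_of_mem_unit_sphere x), neg_zero]

end SphereDist

section Canonical

variable {S A : Set (E 4)} {v : E 4}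

theorem IsSide.frontier_subset (hS : IsClosed S) (hA : IsSide S A) :
    frontier {x : S3 | (x : E 4) ∈ A} ⊆ {x : S3 | (x : E 4) ∈ S} := by
  intro x hx
  by_contra hxS
  have hcl : (x : E 4) ∈ closure A :=
    closure_mono (image_preimage_subset _ _)
      (image_closure_subset_closure_image continuous_subtype_val (mem_image_of_mem _ hx.1))
  obtain ⟨r, hr, h⟩ := hA.exists_ball hS hcl (mem_sphere_zero_iff_norm.1 x.2) hxS
  refine hx.2 (mem_interior_iff_mem_nhds.2 (Filter.mem_of_superset (ball_mem_nhds x hr) ?_))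
  exact fun z hz => h ⟨z.2, hz⟩

/-- On the sphere, images under `conf v` are preimages under the continuous map `conf (-v)`, and
frontiers of preimages lie in preimages of frontiers. -/
theorem frontier_conf_subset (hS : IsClosed S) (hSS : S ⊆ S3) (hA : IsSide S A) (hv : ‖v‖ < 1) :
    frontier {x : S3 | (x : E 4) ∈ conf v '' A} ⊆ {x : S3 | (x : E 4) ∈ conf v '' S} := by
  have hv' : ‖-v‖ < 1 := by rwa [norm_neg]
  let f : S3 → S3 := fun x =>
    ⟨conf (-v) x, mem_sphere_zero_iff_norm.2 (norm_conf hv' (mem_sphere_zero_iff_norm.1 x.2))⟩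
  have hf : Continuous f :=
    ((continuousOn_conf hv').comp_continuous continuous_subtype_val fun x => x.2).subtype_mk _
  have key : ∀ T ⊆ S3, {x : S3 | (x : E 4) ∈ conf v '' T} = f ⁻¹' {x : S3 | (x : E 4) ∈ T} := by
    intro T hT
    ext x
    constructor
    · rintro ⟨z, hz, hzx⟩
      change conf (-v) x ∈ T
      rwa [← hzx, conf_neg_conf hv (mem_sphere_zero_iff_norm.1 (hT hz))]
    · exact fun h => ⟨_, h, conf_conf_neg hv (mem_sphere_zero_iff_norm.1 x.2)⟩
  rw [key A fun z hz => (hA.subset hz).1, key S hSS]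
  exact (hf.frontier_preimage_subset _).trans (preimage_mono (hA.frontier_subset hS))

theorem isCompact_conf_image (hS : IsClosedSurface S) (hv : ‖v‖ < 1) : IsCompact (conf v '' S) :=
  hS.isCompact.image_of_continuousOn ((continuousOn_conf hv).mono hS.subset_sphere)

theorem isClosed_canonical (S A : Set (E 4)) (v : E 4) (t : ℝ) : IsClosed (canonical S A v t) :=
  (isClosed_sphere.isClosedEmbedding_subtypeVal).isClosedMap _ isClosed_frontier

theorem signedDist_of_mem_canonical (hS : IsClosedSurface S) (hA : IsSide S A) (hv : ‖v‖ < 1)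
    {t : ℝ} {x : E 4} (hx : x ∈ canonical S A v t) :
    x ∈ S3 ∧ signedDist (conf v '' S) (conf v '' A) x = t := by
  have hM : conf v '' S ⊆ S3 := by
    rintro _ ⟨y, hy, rfl⟩
    exact mem_sphere_zero_iff_norm.2 (norm_conf hv (mem_sphere_zero_iff_norm.1 (hS.subset_sphere hy)))
  obtain ⟨x, hx, rfl⟩ := hx
  exact ⟨x.2, frontier_lt_subset_eq (continuous_signedDist hM (isCompact_conf_image hS hv)
    (frontier_conf_subset hS.isCompact.isClosed hS.subset_sphere hA hv)) continuous_const hx⟩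

theorem canonical_subset_level (hS : IsClosedSurface S) (hA : IsSide S A) (hv : ‖v‖ < 1) (t : ℝ) :
    canonical S A v t ⊆ level (conf v '' S) (Real.cos t) := by
  intro x hx
  obtain ⟨hx3, hxt⟩ := signedDist_of_mem_canonical hS hA hv hx
  have h0 : 0 ≤ sphereDist (conf v '' S) x :=
    Real.iInf_nonneg fun _ => InnerProductGeometry.angle_nonneg _ _
  refine mem_level_of_sphereDist_eq ?_ (isCompact_conf_image hS hv)
    (hS.isConnected.nonempty.image _) hx3 ?_
  · rintro _ ⟨y, hy, rfl⟩
    exact mem_sphere_zero_iff_norm.2 (norm_conf hv (mem_sphere_zero_iff_norm.1 (hS.subset_sphere hy)))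
  · rw [← hxt, signedDist]
    split_ifs
    · rw [abs_neg, abs_of_nonneg h0]
    · rw [abs_of_nonneg h0]

theorem canonical_side (hS : IsClosedSurface S) (hA : IsSide S A) (hv : ‖v‖ < 1) {t : ℝ}
    (ht : t ≠ 0) :
    canonical S A v t ⊆ conf v '' A ∨ Disjoint (canonical S A v t) (conf v '' A) := by
  have h0 : ∀ x, 0 ≤ sphereDist (conf v '' S) x := fun x =>
    Real.iInf_nonneg fun _ => InnerProductGeometry.angle_nonneg _ _
  rcases lt_or_gt_of_ne ht with h | h
  · refine Or.inl fun x hx => ?_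
    have := (signedDist_of_mem_canonical hS hA hv hx).2
    rw [signedDist] at this
    split_ifs at this with hxA
    · exact hxA
    · linarith [h0 x]
  · refine Or.inr (Set.disjoint_left.2 fun x hx hxA => ?_)
    have := (signedDist_of_mem_canonical hS hA hv hx).2
    rw [signedDist, if_pos hxA] at this
    linarith [h0 x]

end Canonical

/-! ### Assembly of the distance regimes. -/

theorem level_one_subset {M : Set (E 4)} (hM : ∀ y ∈ M, ‖y‖ = 1) : level M 1 ⊆ M := by
  rintro x ⟨hx, -, y, hy, hxy⟩
  have h1 := norm_sub_sq_of_unit hx (hM y hy)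
  rw [hxy, mul_one, sub_self, sq_eq_zero_iff, norm_eq_zero, sub_eq_zero] at h1
  rwa [h1]

/-- Level sets on the far side are close to the antipode of every point of `M`. -/
theorem level_subset_closedBall_neg {M : Set (E 4)} {c s : ℝ} (hM : ∀ y ∈ M, ‖y‖ = 1)
    (hc : c ≤ 0) (hs : 0 ≤ s) (hcs : c ^ 2 + s ^ 2 = 1) {y : E 4} (hy : y ∈ M) :
    level M c ⊆ closedBall (-y) (2 * s) := by
  rintro x ⟨hx, h, -⟩
  have hc1 : -1 ≤ c := by nlinarith
  have h1 := norm_sub_sq_of_unit hx (show ‖-y‖ = 1 by rw [norm_neg, hM y hy])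
  rw [inner_neg_right] at h1
  have h2 := h y hy
  rw [mem_closedBall, dist_eq_norm]
  refine (sq_le_sq₀ (norm_nonneg _) (by positivity)).1 ?_
  rw [h1]
  nlinarith

theorem exists_area_level_le_of_neg : ∃ s₁ : ℝ, 0 < s₁ ∧ ∀ (M X : Set (E 4)) (c s : ℝ),
    (∀ y ∈ M, ‖y‖ = 1) → M.Nonempty → c ≤ 0 → 0 ≤ s → s ≤ s₁ → c ^ 2 + s ^ 2 = 1 →
    X ⊆ level M c → μHE[2] X ≤ ENNReal.ofReal (5 * Real.pi) := by
  obtain ⟨C, hC, h⟩ := exists_area_level_le_of_scale 2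
  refine ⟨min 1 (1 / C), by positivity, ?_⟩
  rintro M X c s hM ⟨y, hy⟩ hc hs hs₁ hcs hX
  have hball := hX.trans (level_subset_closedBall_neg hM hc hs hcs hy)
  rcases hs.eq_or_lt with rfl | hs0
  · rw [mul_zero, closedBall_zero] at hball
    exact (measure_mono hball).trans (by rw [area_singleton]; exact zero_le)
  · refine (h M X c s (-y) hM hs0 hcs hX hball).trans (ENNReal.ofReal_le_ofReal ?_)
    have h1 : s ≤ 1 := hs₁.trans (min_le_left _ _)
    have h2 : C * s ≤ 1 := by
      rw [mul_comm, ← le_div_iff₀ hC]; exact hs₁.trans (min_le_right _ _)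
    nlinarith [Real.pi_gt_three]

/-- The area estimate, without the hypotheses on the genus and the Willmore energy. -/
theorem exists_area_canonical_le : ∃ γ₁ : ℝ, 0 < γ₁ ∧ ∀ r₀ : ℝ, 0 < r₀ → ∃ η : ℝ, 0 < η ∧
    ∀ (S A : Set (E 4)) (v : E 4) (t : ℝ), IsClosedSurface S → IsRegular γ₁ r₀ S → IsSide S A →
      ‖v‖ < 1 → 1 - η ≤ ‖v‖ → μHE[2] (canonical S A v t) ≤ ENNReal.ofReal (5 * Real.pi) := by
  obtain ⟨τ₀, hτ₀, hτ₁, hsmall⟩ := exists_area_level_conf_le_of_small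
  obtain ⟨s₁, hs₁, hneg⟩ := exists_area_level_le_of_neg
  -- The sine threshold depends only on the absolute `τ₀` and `s₁`, so `γ₂` is chosen before `r₀`.
  obtain ⟨γ₂, hγ₂, hlarge⟩ := exists_area_level_conf_le_of_large
    (s₀ := min s₁ (τ₀ / 2)) (by positivity) ((min_le_right _ _).trans (by linarith))
  refine ⟨min (1 / 10 ^ 9) γ₂, by positivity, fun r₀ hr₀ => ?_⟩
  obtain ⟨η₁, hη₁, h₁⟩ := hsmall r₀ hr₀
  obtain ⟨η₂, hη₂, h₂⟩ := hlarge r₀ hr₀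
  obtain ⟨η₃, hη₃, h₃⟩ := exists_area_conf_le (θ := 1 / 2000) (by norm_num) (by norm_num) hr₀
  refine ⟨min η₁ (min η₂ η₃), by positivity, fun S A v t hS hreg hA hv hvη => ?_⟩
  have hv₁ : 1 - η₁ ≤ ‖v‖ := by linarith [min_le_left η₁ (min η₂ η₃)]
  have hv₂ : 1 - η₂ ≤ ‖v‖ := by
    linarith [min_le_right η₁ (min η₂ η₃), min_le_left η₂ η₃]
  have hv₃ : 1 - η₃ ≤ ‖v‖ := by
    linarith [min_le_right η₁ (min η₂ η₃), min_le_right η₂ η₃]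
  have hreg₁ : IsRegular (1 / 10 ^ 9) r₀ S := hreg.mono (min_le_left _ _)
  have hM : ∀ y ∈ conf v '' S, ‖y‖ = 1 := by
    rintro _ ⟨y, hy, rfl⟩
    exact norm_conf hv (mem_sphere_zero_iff_norm.1 (hS.subset_sphere hy))
  have hX := canonical_subset_level hS hA hv t
  have hcs : Real.cos t ^ 2 + |Real.sin t| ^ 2 = 1 := by
    rw [sq_abs]; exact Real.cos_sq_add_sin_sq t
  -- At zero distance there is no side to choose and the level set is contained in `Σ_v`, whose area
  -- is bounded directly.
  rcases (Real.cos_le_one t).eq_or_lt with hc | hc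
  · rw [hc] at hX
    refine (measure_mono (hX.trans (level_one_subset hM))).trans ((h₃ _ S v (by norm_num) (by norm_num)
      hS.subset_sphere hS.isCompact hS.isConnected.nonempty hreg₁ hv hv₃).trans
      (ENNReal.ofReal_le_ofReal ?_))
    nlinarith [Real.pi_pos]
  have hside := canonical_side hS hA hv (t := t) (by rintro rfl; simp at hc)
  by_cases hτ : 2 - 2 * Real.cos t ≤ τ₀ ^ 2
  · exact h₁ S A _ v _ hS hA hreg₁ hv hv₁ hc hτ hX (isClosed_canonical S A v t).measurableSet hside
  rcases le_or_gt (min s₁ (τ₀ / 2)) |Real.sin t| with hs | hs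
  · exact h₂ S A _ v _ _ hS hA (hreg.mono (min_le_right _ _)) hv hv₂ hs hcs hX hside
  · push Not at hτ
    have hs2 : |Real.sin t| < τ₀ / 2 := hs.trans_le (min_le_right _ _)
    refine hneg _ _ _ _ hM (hS.isConnected.nonempty.image _) ?_ (abs_nonneg _)
      (hs.trans_le (min_le_left _ _)).le hcs hX
    -- For positive cosine, `1 - cos t ≤ sin² t < τ₀² / 4`, which would already have put `t` in the
    -- small-distance case; so only distances at least `π / 2` remain.
    by_contra hcon
    push Not at hcon
    have h4 : |Real.sin t| ^ 2 < (τ₀ / 2) ^ 2 := by gcongr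
    nlinarith

end CanonicalFamily

theorem mainTheorem5 :
    ∃ γ₁ : ℝ, 0 < γ₁ ∧ ∀ r₀ : ℝ, 0 < r₀ → ∃ η₁ : ℝ, 0 < η₁ ∧
      ∀ (γ : ℝ) (S A : Set (EuclideanSpace ℝ (Fin 4))),
        0 < γ → γ ≤ γ₁ →
        CanonicalFamily.IsClosedSurface S →
        1 ≤ CanonicalFamily.genus S →
        CanonicalFamily.IsRegular γ r₀ S →
        CanonicalFamily.willmore S ≤ ENNReal.ofReal (8 * Real.pi) →
        CanonicalFamily.IsSide S A →
        ∀ (v : EuclideanSpace ℝ (Fin 4)) (t : ℝ),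
          ‖v‖ < 1 → 1 - η₁ ≤ ‖v‖ → t ∈ Set.Icc (-Real.pi) Real.pi →
          CanonicalFamily.area (CanonicalFamily.canonical S A v t) ≤
            ENNReal.ofReal (5 * Real.pi) := by
  obtain ⟨γ₁, hγ₁, h⟩ := CanonicalFamily.exists_area_canonical_le
  refine ⟨γ₁, hγ₁, fun r₀ hr₀ => ?_⟩
  obtain ⟨η, hη, h⟩ := h r₀ hr₀
  exact ⟨η, hη, fun γ S A _ hγ hS _ hreg _ hA v t hv hvη _ =>
    h S A v t hS (hreg.mono hγ) hA hv hvη⟩
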